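/- **Theorem.** Let $n\ge 1$ be an integer and let $\mathcal S(V)$, $V=\mathbb C^n$, be the rank $n$ $\beta\gamma$-system, i.e. the vertex algebra of fields on its Fock space generated by even fields $\beta^{i},\gamma^{i}$ ($1\le i\le n$) with $\beta^{i}(z)\gamma^{k}(w)\sim\delta_{ik}(z-w)^{-1}$, $\beta^i(z)\beta^k(w)\sim 0\sim\gamma^i(z)\gamma^k(w)$. For fields $a,b$ let $a\circ_m b$ ($m\in\mathbb Z$) be the circle products, so that $a(z)b(w)\sim\sum_{m\ge0}(a\circ_m b)(w)(z-w)^{-m-1}$ and $:\!ab\!:\,=a\circ_{-1}b$ is the normally ordered (Wick) product, iterated from the right. Let $\mathcal W_{1+\infty,-n}\subset\mathcal S(V)$ be the vertex subalgebra generated by the fields $$j^l=\sum_{i=1}^n:\gamma^{i}\,\partial^l\beta^{i}:,\qquad l\ge 0$$ (the free field realization of $\mathcal W_{1+\infty}$ at central charge $-n$). Let $\mathcal H$ be the vertex subalgebra generated by $j^0$, and let $\mathcal A=\mathrm{Com}(\mathcal H,\mathcal W_{1+\infty,-n})$ be its commutant, the set of all $a\in\mathcal W_{1+\infty,-n}$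 with $[a(z),h(w)]=0$ for all $h\in\mathcal H$. Put $$L=\frac1{2n}\Big(:j^0j^0:+\,n\,\partial j^0-2n\,j^1\Big),$$ $$W=\;:j^0j^0j^0:+\tfrac{3n}{2}:j^0\partial j^0:-\,3n:j^0j^1:+\tfrac{n^2}{4}\partial^2j^0-\tfrac{3n^2}{2}\partial j^1+\tfrac{3n^2}{2}j^2 .$$ Then: 1. $j^0$ is a Heisenberg field of level $-n$, i.e. $j^0(z)j^0(w)\sim -n(z-w)^{-2}$, and $\mathcal W_{1+\infty,-n}=\mathcal H\otimes\mathcal A$ as vertex algebras: the map $h\otimes a\mapsto\;:ha:$ is an isomorphism of the tensor product vertex algebra $\mathcal H\otimes\mathcal A$ onto $\mathcal W_{1+\infty,-n}$. 2. $\mathcal A$ is generated as a vertex algebra by $L$ and $W$. 3. $\mathcal A$ is a conformal vertex algebra with Virasoro element $L$ of central charge $-n-1$: $L(z)L(w)\sim\frac{-n-1}{2}(z-w)^{-4}+2L(w)(z-w)^{-2}+\partial L(w)(z-w)^{-1}$, $L\circ_0 a=\partial a$ for all $a\in\mathcal A$, and $L\circ_1$ is diagonalizable on $\mathcal A$ with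 eigenvalues in $\mathbb Z_{\ge0}$. Moreover $W$ is primary of conformal weight $3$: $L(z)W(w)\sim 3W(w)(z-w)^{-2}+\partial W(w)(z-w)^{-1}$. 4. If $n=1$, then $\mathcal A$ is the simple Zamolodchikov $\mathcal W_3$ algebra with $c=-2$: $\mathcal A$ is a simple vertex algebra, and for some $\mu\in\mathbb C\setminus\{0\}$ the field $\widetilde W=\mu W$ satisfies $$\widetilde W(z)\widetilde W(w)\sim\frac{c/3}{(z-w)^{6}}+\frac{2L(w)}{(z-w)^{4}}+\frac{\partial L(w)}{(z-w)^{3}}+\frac{2b\Lambda(w)+\frac3{10}\partial^2L(w)}{(z-w)^{2}}+\frac{b\,\partial\Lambda(w)+\frac1{15}\partial^3L(w)}{z-w}$$ with $c=-2$, $b=\frac{16}{22+5c}=\frac43$ and $\Lambda=\,:LL:-\frac3{10}\partial^2L$. -/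

import Mathlib

noncomputable section

namespace WInfinity

open VertexOperator

/-! ### Quantum operators and circle products

Vertex algebras are treated as commutative quantum operator algebras: spaces of fields on a fixed
(purely even) complex vector space `V`, closed under all circle products. -/

/-- The space `QO(V)` of linear maps `V → V((z))`, i.e. of fields `a(z) = ∑ a(m) z^{-m-1}` such that
for every `v` one has `a(m) v = 0` for `m ≫ 0`. -/
abbrev QO (V : Type*) [AddCommGroup V] [Module ℂ V] := VertexOperator ℂ V

section QO

variable {V : Type*} [AddCommGroup V] [Module ℂ V]

/-- The Fourier mode `a(m)`, the coefficient of `z^{-m-1}`. -/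
def mode (a : QO V) (m : ℤ) : Module.End ℂ V := ncoeff a m

theorem mode_bdd (a : QO V) (v : V) : ∃ N : ℤ, ∀ m, N ≤ m → mode a m v = 0 :=
  ⟨-HahnSeries.order ((HahnModule.of ℂ).symm (a v)), fun m hm =>
    ncoeff_eq_zero_of_lt_order a m v (by omega)⟩

/-- The field with prescribed modes `f m`. -/
def ofModes (f : ℤ → Module.End ℂ V) (hf : ∀ v, ∃ N : ℤ, ∀ m, N ≤ m → f m v = 0) : QO V :=
  VertexOperator.of_coeff (fun y => f (-y - 1)) (by
    intro v
    obtain ⟨N, hN⟩ := hf v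
    refine ⟨-N, fun y hy => ?_⟩
    by_contra h
    exact hy (hN _ (by omega)))

theorem mode_ofModes (f : ℤ → Module.End ℂ V) (hf) (m : ℤ) : mode (ofModes f hf) m = f m := by
  simp [mode, ofModes]

theorem QO_ext {a b : QO V} (h : ∀ m, mode a m = mode b m) : a = b := by
  apply HVertexOperator.coeff_inj
  funext y
  rw [coeff_eq_ncoeff, coeff_eq_ncoeff]
  exact h _

/-- The unit of `QO(V)`: the constant field `1`. -/
def one : QO V :=
  ofModes (fun m => if m = -1 then LinearMap.id else 0) fun v => ⟨0, fun m hm => by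
    rw [if_neg (by omega)]; rfl⟩

/-- Formal differentiation: `(∂a)(m) = -m a(m-1)`. -/
def der (a : QO V) : QO V :=
  ofModes (fun m => (-m : ℤ) • mode a (m - 1)) fun v => by
    obtain ⟨N, hN⟩ := mode_bdd a v
    exact ⟨N + 1, fun m hm => by simp [hN (m - 1) (by omega)]⟩

/-- The `j`-th summand of `(a ∘ₙ b)(m) v`. -/
def circTerm (n : ℤ) (a b : QO V) (m : ℤ) (v : V) (j : ℕ) : V :=
  ((-1) ^ j * Ring.choose n j : ℤ) •
    (mode a (n - j) (mode b (m + j) v) - n.negOnePow • mode b (m + n - j) (mode a j v))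

theorem circTerm_finite (n : ℤ) (a b : QO V) (m : ℤ) (v : V) :
    (Function.support (circTerm n a b m v)).Finite := by
  obtain ⟨N, hN⟩ := mode_bdd a v
  obtain ⟨M, hM⟩ := mode_bdd b v
  refine (Set.finite_Iio (N.toNat + (M - m).toNat)).subset fun j hj => ?_
  by_contra h
  simp only [Set.mem_Iio, not_lt] at h
  apply hj
  simp [circTerm, hN j (by omega), hM (m + j) (by omega)]

/-- The modes of the `n`-th circle product: the coefficient of `w^{-m-1}` in
`Res_z a(z) b(w) ι_{|z|>|w|}(z-w)^n - Res_z b(w) a(z) ι_{|w|>|z|}(z-w)^n`, that is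
`∑_{j ≥ 0} (-1)^j (n choose j) (a(n-j) b(m+j) - (-1)^n b(m+n-j) a(j))`. -/
def circMode (n : ℤ) (a b : QO V) (m : ℤ) : Module.End ℂ V where
  toFun v := ∑ᶠ j : ℕ, circTerm n a b m v j
  map_add' u v := by
    rw [← finsum_add_distrib (circTerm_finite n a b m u) (circTerm_finite n a b m v)]
    refine finsum_congr fun j => ?_
    simp only [circTerm, map_add, smul_add, smul_sub]
    abel
  map_smul' r v := by
    rw [RingHom.id_apply, smul_finsum' r (circTerm_finite n a b m v)]
    refine finsum_congr fun j => ?_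
    simp only [circTerm, map_smul]
    rw [smul_comm r, smul_sub r, smul_comm r n.negOnePow]

/-- The `n`-th circle product `a ∘ₙ b` on `QO(V)`. -/
def circ (n : ℤ) (a b : QO V) : QO V :=
  ofModes (circMode n a b) fun v => by
    obtain ⟨N, hN⟩ := mode_bdd a v
    obtain ⟨M, hM⟩ := mode_bdd b v
    choose K hK using fun j : ℕ => mode_bdd b (mode a j v)
    obtain ⟨B, hB⟩ := ((Finset.range N.toNat).image fun j => K j - n + j).bddAbove
    refine ⟨max M B, fun m hm => ?_⟩
    change ∑ᶠ j : ℕ, circTerm n a b m v j = 0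
    refine finsum_eq_zero_of_forall_eq_zero fun j => ?_
    have h1 : mode b (m + j) v = 0 := hM _ (by have := le_max_left M B; omega)
    have h2 : mode b (m + n - j) (mode a j v) = 0 := by
      by_cases hj : j < N.toNat
      · have : K j - n + j ≤ B := hB (by
          simp only [Finset.coe_image, Set.mem_image, Finset.coe_range, Set.mem_Iio]
          exact ⟨j, hj, rfl⟩)
        exact hK j _ (by have := le_max_right M B; omega)
      · rw [hN j (by omega), map_zero]
    simp [circTerm, h1, h2]

theorem mode_circ (n : ℤ) (a b : QO V) (m : ℤ) (v : V) :
    mode (circ n a b) m v = ∑ᶠ j : ℕ, ((-1) ^ j * Ring.choose n j : ℤ) •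
      (mode a (n - j) (mode b (m + j) v) -
        n.negOnePow • mode b (m + n - j) (mode a j v)) := by
  rw [circ, mode_ofModes]; rfl

/-- The Wick product `:ab:`; iterated Wick products are nested to the right. -/
def wick (a b : QO V) : QO V := circ (-1) a b

/-! ### Vertex algebras -/

/-- `(z-w)^N [a(z), b(w)] = 0`, coefficientwise. -/
def CommuteToOrder (N : ℕ) (a b : QO V) : Prop :=
  ∀ m k : ℤ, ∑ i ∈ Finset.range (N + 1), ((-1) ^ i * (N.choose i : ℤ)) •
    (mode a (m + N - i) * mode b (k + i) - mode b (k + i) * mode a (m + N - i)) = 0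

/-- `a` and `b` quantum commute. -/
def QuantumCommute (a b : QO V) : Prop := ∃ N, CommuteToOrder N a b

/-- `a` and `b` commute: `[a(z), b(w)] = 0`. -/
def FieldCommute (a b : QO V) : Prop := ∀ m k : ℤ, Commute (mode a m) (mode b k)

/-- A quantum operator algebra: a subspace containing `1` and closed under all circle products. -/
structure IsQOA (A : Submodule ℂ (QO V)) : Prop where
  one_mem : one ∈ A
  circ_mem : ∀ a ∈ A, ∀ b ∈ A, ∀ n : ℤ, circ n a b ∈ A

/-- A vertex algebra: a quantum operator algebra whose elements pairwise quantum commute. -/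
structure IsVertexAlgebra (A : Submodule ℂ (QO V)) : Prop extends IsQOA A where
  quantumCommute : ∀ a ∈ A, ∀ b ∈ A, QuantumCommute a b

/-- The subalgebra generated by a set of fields: the smallest subspace that contains the set and
the unit and is closed under all circle products. -/
def generatedBy (S : Set (QO V)) : Submodule ℂ (QO V) :=
  sInf {A | IsQOA A ∧ S ⊆ A}

/-- The commutant `Com(H, U)`. -/
def commutant (H U : Submodule ℂ (QO V)) : Submodule ℂ (QO V) where
  carrier := {a | a ∈ U ∧ ∀ h ∈ H, FieldCommute a h}
  zero_mem' := ⟨U.zero_mem, fun h _ m k => by simp [mode]⟩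
  add_mem' := fun {a b} ha hb => ⟨U.add_mem ha.1 hb.1, fun h hh m k => by
    simpa [mode] using (ha.2 h hh m k).add_left (hb.2 h hh m k)⟩
  smul_mem' := fun r {a} ha => ⟨U.smul_mem r ha.1, fun h hh m k => by
    simpa [mode] using (ha.2 h hh m k).smul_left r⟩

/-- A vertex algebra is simple if it is nonzero and its only (two-sided) ideals are `0` and
itself. -/
structure IsSimpleVA (A : Submodule ℂ (QO V)) : Prop where
  ne_bot : A ≠ ⊥
  eq_bot_or_eq : ∀ I : Submodule ℂ (QO V), I ≤ A →
    (∀ a ∈ A, ∀ b ∈ I, ∀ n : ℤ, circ n a b ∈ I ∧ circ n b a ∈ I) → I = ⊥ ∨ I = A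

/-- `U = H ⊗ A` as vertex algebras, internally: `H` and `A` are commuting vertex subalgebras, and
`h ⊗ a ↦ :ha:` is a linear isomorphism `H ⊗ A → U` which carries the tensor product structure
`(h ⊗ a) ∘ₙ (h' ⊗ a') = ∑_k (h ∘_k h') ⊗ (a ∘_{n-k-1} a')` to the circle products of `U`. -/
structure IsTensorDecomposition (U H A : Submodule ℂ (QO V)) : Prop where
  left : IsVertexAlgebra H
  right : IsVertexAlgebra A
  commute : ∀ h ∈ H, ∀ a ∈ A, FieldCommute h a
  equiv : ∃ e : TensorProduct ℂ H A ≃ₗ[ℂ] U, ∀ (h : H) (a : A),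
    (e (TensorProduct.tmul ℂ h a) : QO V) = wick (h : QO V) (a : QO V)
  finite : ∀ h ∈ H, ∀ h' ∈ H, ∀ a ∈ A, ∀ a' ∈ A, ∀ n : ℤ,
    (Function.support fun k : ℤ => wick (circ k h h') (circ (n - k - 1) a a')).Finite
  circ_wick : ∀ h ∈ H, ∀ h' ∈ H, ∀ a ∈ A, ∀ a' ∈ A, ∀ n : ℤ,
    circ n (wick h a) (wick h' a') =
      ∑ᶠ k : ℤ, wick (circ k h h') (circ (n - k - 1) a a')

/-! ### Operator product expansions -/

/-- `J(z) J(w) ∼ κ (z-w)^{-2}`: `J` is a Heisenberg field of level `κ`. -/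
structure IsHeisenberg (J : QO V) (κ : ℂ) : Prop where
  quantumCommute : QuantumCommute J J
  circ_zero : circ 0 J J = 0
  circ_one : circ 1 J J = κ • one
  circ_high : ∀ k : ℤ, 2 ≤ k → circ k J J = 0

/-- `L(z) L(w) ∼ (c/2) (z-w)^{-4} + 2 L(w) (z-w)^{-2} + ∂L(w) (z-w)^{-1}`: `L` is a Virasoro field
of central charge `c`. -/
structure IsVirasoro (L : QO V) (c : ℂ) : Prop where
  quantumCommute : QuantumCommute L L
  circ_zero : circ 0 L L = der L
  circ_one : circ 1 L L = (2 : ℂ) • L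
  circ_two : circ 2 L L = 0
  circ_three : circ 3 L L = (c / 2) • one
  circ_high : ∀ k : ℤ, 4 ≤ k → circ k L L = 0

/-- `L(z) a(w) ∼ h a(w) (z-w)^{-2} + ∂a(w) (z-w)^{-1}`: `a` is primary of conformal weight `h`. -/
structure IsPrimary (L a : QO V) (h : ℂ) : Prop where
  quantumCommute : QuantumCommute L a
  circ_zero : circ 0 L a = der a
  circ_one : circ 1 L a = h • a
  circ_high : ∀ k : ℤ, 2 ≤ k → circ k L a = 0

/-- `A` is a conformal vertex algebra with conformal (Virasoro) element `L` of central charge `c`: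
`L ∘₀` is `∂`, and `L ∘₁` is diagonalizable with nonnegative integral eigenvalues. -/
structure IsConformal (A : Submodule ℂ (QO V)) (L : QO V) (c : ℂ) : Prop
    extends IsVertexAlgebra A where
  mem : L ∈ A
  virasoro : IsVirasoro L c
  circ_zero : ∀ a ∈ A, circ 0 L a = der a
  graded : A ≤ Submodule.span ℂ {a | a ∈ A ∧ ∃ k : ℕ, circ 1 L a = (k : ℂ) • a}

/-- The field `Λ = :LL: - (3/10) ∂²L`. -/
def quasiLL (L : QO V) : QO V := wick L L - (3 / 10 : ℂ) • der (der L)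

/-- `A`, with generators `L` and `W`, is the simple Zamolodchikov `W₃` algebra of central charge
`c ≠ -22/5`: it is the simple vertex algebra generated by a Virasoro field `L` of central charge `c`
and a primary field `W` of weight `3` with
`W(z) W(w) ∼ (c/3) (z-w)^{-6} + 2 L (z-w)^{-4} + ∂L (z-w)^{-3}
  + (2 b Λ + (3/10) ∂²L) (z-w)^{-2} + (b ∂Λ + (1/15) ∂³L) (z-w)^{-1}`, where `b = 16/(22+5c)`. -/
structure IsZamolodchikovW3 (A : Submodule ℂ (QO V)) (L W : QO V) (c : ℂ) : Prop
    extends IsVertexAlgebra A, IsSimpleVA A where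
  generated : A = generatedBy {L, W}
  virasoro : IsVirasoro L c
  primary : IsPrimary L W 3
  circ_zero : circ 0 W W =
    (16 / (22 + 5 * c)) • der (quasiLL L) + (1 / 15 : ℂ) • der (der (der L))
  circ_one : circ 1 W W =
    (2 * (16 / (22 + 5 * c))) • quasiLL L + (3 / 10 : ℂ) • der (der L)
  circ_two : circ 2 W W = der L
  circ_three : circ 3 W W = (2 : ℂ) • L
  circ_four : circ 4 W W = 0
  circ_five : circ 5 W W = (c / 3) • one
  circ_high : ∀ k : ℤ, 6 ≤ k → circ k W W = 0

end QO

/-! ### The `βγ`-system of rank `n` and `W_{1+∞,-n}` -/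

/-- The free field on a polynomial ring whose creation modes (`a(-k-1)`, `k ≥ 0`) are
multiplications by the variables `x k`, and whose annihilation modes (`a(k)`, `k ≥ 0`) are the
derivations `ε ∂/∂(y k)`. -/
def freeField {σ : Type} (x y : ℕ → σ) (hy : Function.Injective y) (ε : ℂ) :
    QO (MvPolynomial σ ℂ) :=
  ofModes
    (fun m => if m < 0 then LinearMap.mulLeft ℂ (MvPolynomial.X (x (-m - 1).toNat))
      else ε • (MvPolynomial.pderiv (R := ℂ) (y m.toNat)).toLinearMap)
    (by
      classical
      intro v
      have hfin : {k : ℕ | y k ∈ v.vars}.Finite :=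
        Set.Finite.preimage hy.injOn v.vars.finite_toSet
      obtain ⟨B, hB⟩ := hfin.bddAbove
      refine ⟨B + 1, fun m hm => ?_⟩
      rw [if_neg (by omega)]
      have : y m.toNat ∉ v.vars := fun h => by
        have := hB h
        omega
      simp [MvPolynomial.pderiv_eq_zero_of_notMem_vars this])

/-- Variables of the Fock space: `inl (i, k)` is the state `∂^k β^{x_i}/k!`, and
`inr (i, k)` is the state `∂^k γ^{x'_i}/k!`. -/
abbrev Idx (n : ℕ) := (Fin n × ℕ) ⊕ (Fin n × ℕ)

/-- The Fock space of the rank `n` `βγ`-system `S(V)`, `V = ℂⁿ`. -/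
abbrev Fock (n : ℕ) := MvPolynomial (Idx n) ℂ

/-- The field `β^{x_i}(z)`. The fields `β`, `γ` have `[β^{x_i}(m), γ^{x'_j}(k)] = δ_{ij} δ_{m+k,-1}`,
that is `β^{x_i}(z) γ^{x'_j}(w) ∼ δ_{ij} (z-w)^{-1}`, and all other brackets vanish. -/
def beta (n : ℕ) (i : Fin n) : QO (Fock n) :=
  freeField (fun k => Sum.inl (i, k)) (fun k => Sum.inr (i, k))
    (fun _ _ h => by simpa using h) 1

/-- The field `γ^{x'_i}(z)`. -/
def gamma (n : ℕ) (i : Fin n) : QO (Fock n) :=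
  freeField (fun k => Sum.inr (i, k)) (fun k => Sum.inl (i, k))
    (fun _ _ h => by simpa using h) (-1)

/-- The fields `j^l = ∑ᵢ :γ^{x'_i} ∂^l β^{x_i}:`. -/
def j (n l : ℕ) : QO (Fock n) := ∑ i : Fin n, wick (gamma n i) (der^[l] (beta n i))

/-- The vertex algebra `W_{1+∞,-n}`, identified with its image in the `βγ`-system: the vertex
subalgebra generated by the fields `j^l`, `l ≥ 0`. -/
def W1inf (n : ℕ) : Submodule ℂ (QO (Fock n)) := generatedBy (Set.range (j n))

/-- The Heisenberg algebra generated by `j^0`. -/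
def heis (n : ℕ) : Submodule ℂ (QO (Fock n)) := generatedBy {j n 0}

/-- The commutant `A = Com(H, W_{1+∞,-n})`. -/
def algA (n : ℕ) : Submodule ℂ (QO (Fock n)) := commutant (heis n) (W1inf n)

/-- `L = (1/2n) (:j⁰j⁰: + n ∂j⁰ - 2n j¹)`. -/
def fieldL (n : ℕ) : QO (Fock n) :=
  (1 / (2 * n) : ℂ) • (wick (j n 0) (j n 0) + (n : ℂ) • der (j n 0) - (2 * n : ℂ) • j n 1)

/-- `W = :j⁰j⁰j⁰: + (3n/2) :j⁰∂j⁰: - 3n :j⁰j¹: + (n²/4) ∂²j⁰ - (3n²/2) ∂j¹ + (3n²/2) j²`. -/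
def fieldW (n : ℕ) : QO (Fock n) :=
  wick (j n 0) (wick (j n 0) (j n 0)) + (3 * n / 2 : ℂ) • wick (j n 0) (der (j n 0))
    - (3 * n : ℂ) • wick (j n 0) (j n 1) + ((n : ℂ) ^ 2 / 4) • der (der (j n 0))
    - (3 * (n : ℂ) ^ 2 / 2) • der (j n 1) + (3 * (n : ℂ) ^ 2 / 2) • j n 2

end WInfinity

end

noncomputable section

namespace WInfinity

open Filter

section QOTheory

variable {V : Type*} [AddCommGroup V] [Module ℂ V]

/-! ### Modes and circle products -/

/-! Everything takes place inside the `βγ`-system. Its fields are mutually local, creative and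
covariant, and the vacuum is cyclic, so a field is determined by its state `a(-1)Ω` (Goddard
uniqueness, `hasStates_generatedBy`). Since the state of `a ∘ₘ b` is `a(m)` applied to the state of
`b`, every operator product becomes a computation with modes acting on polynomials. Locality passes
to generated algebras by Dong's lemma.

The currents act on the modes of `β` and `γ` by the linear rules `j_beta` and `j_gamma`. These rules
give `j² ∘₁ jᵇ = 2∂jᵇ - (b+2) jᵇ⁺¹`, so `j⁰, j¹, j²` generate all the currents. As `n ≠ 0`, `j¹` and
`j²` can be traded for `L` and `W` (`W1inf_eq`). The correction terms in `L` and `W` make all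
`j⁰(k)`, `k ≥ 0`, annihilate their states, hence both fields commute with `j⁰`.

The algebra is thus generated by a Heisenberg field of nonzero level and by fields commuting with
it. The products `:ha:` span it because their span is closed under circle products. They are
independent because a vector of the Heisenberg vacuum module killed by all `J(k)`, `k ≥ 0`, is a
multiple of the vacuum: a number operator counts Heisenberg factors. The same argument identifies
the commutant with the algebra generated by `L` and `W`.

On vectors killed by the `j⁰(k)`, `k ≥ 0`, the nonnegative modes of `L` are those of `-j¹`. There
`-j¹(0)` is translation and `-j¹(1)` is a weight grading of the Fock space with nonnegative weights,
which gives the conformal structure.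

For `n = 1` the operator product of `W` with itself is computed in the Fock space. For simplicity, a
nonzero ideal `I` of the commutant gives an ideal `H ⊗ I` of the whole algebra, and its states form
a subspace stable under all modes of all `jˡ`. Interpolation in `l` isolates the operators
`β(q)γ(p)` with `p, q ≥ 0`, which are second derivatives up to sign. They lower a vector of charge
zero to a nonzero constant, so `H ⊗ I` contains the unit, and hence so does `I`. -/

@[simp] theorem mode_add (a b : QO V) (m : ℤ) : mode (a + b) m = mode a m + mode b m := by
  simp [mode]

@[simp] theorem mode_sub (a b : QO V) (m : ℤ) : mode (a - b) m = mode a m - mode b m := by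
  simp [mode]

@[simp] theorem mode_smul (r : ℂ) (a : QO V) (m : ℤ) : mode (r • a) m = r • mode a m := by
  simp [mode]

@[simp] theorem mode_zero (m : ℤ) : mode (0 : QO V) m = 0 := by
  simp [mode]

theorem mode_sum {ι : Type*} (s : Finset ι) (a : ι → QO V) (m : ℤ) :
    mode (∑ i ∈ s, a i) m = ∑ i ∈ s, mode (a i) m := by
  simp [mode]

/-- The map `a ↦ a(m)` as a linear map. -/
def modeLin (m : ℤ) : QO V →ₗ[ℂ] Module.End ℂ V where
  toFun a := mode a m
  map_add' a b := mode_add a b m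
  map_smul' r a := mode_smul r a m

@[simp] theorem modeLin_apply (m : ℤ) (a : QO V) : modeLin m a = mode a m := rfl

theorem mode_one (m : ℤ) : mode (one : QO V) m = if m = -1 then LinearMap.id else 0 := by
  rw [one, mode_ofModes]

theorem mode_der (a : QO V) (m : ℤ) : mode (der a) m = (-m : ℤ) • mode a (m - 1) := by
  rw [der, mode_ofModes]

theorem eventually_mode_eq_zero (a : QO V) (v : V) (m : ℤ) :
    ∀ᶠ j : ℕ in atTop, mode a (m + j) v = 0 := by
  obtain ⟨N, hN⟩ := mode_bdd a v
  filter_upwards [eventually_ge_atTop (N - m).toNat] with j hj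
  exact hN _ (by omega)

/-- The signed binomial coefficient `(-1)^j (n choose j)`. -/
def signedChoose (n : ℤ) (j : ℕ) : ℤ := (-1) ^ j * Ring.choose n j

@[simp] theorem signedChoose_zero (n : ℤ) : signedChoose n 0 = 1 := by
  simp [signedChoose]

theorem signedChoose_succ_succ (n : ℤ) (j : ℕ) :
    signedChoose (n + 1) (j + 1) = signedChoose n (j + 1) - signedChoose n j := by
  simp only [signedChoose, Ring.choose_succ_succ, pow_succ]
  ring

theorem succ_mul_signedChoose_succ (n : ℤ) (j : ℕ) :
    ((j : ℤ) + 1) * signedChoose n (j + 1) = -(n - j) * signedChoose n j := by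
  have h := Ring.choose_smul_choose n (Nat.le_succ j)
  have h2 : Ring.choose (n - j) (j + 1 - j) = n - j := by
    rw [Nat.add_sub_cancel_left, Ring.choose_one_right]
  rw [Nat.succ_eq_add_one] at h
  rw [h2] at h
  have h3 : (j + 1).choose j = j + 1 := by simp
  rw [h3] at h
  simp only [nsmul_eq_mul] at h
  push_cast at h
  simp only [signedChoose, pow_succ]
  linear_combination (-(-1) ^ j) * h

theorem signedChoose_natCast (N i : ℕ) : signedChoose (N : ℤ) i = (-1) ^ i * (N.choose i : ℤ) := by
  simp [signedChoose, Ring.choose_natCast]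

theorem signedChoose_neg_one (j : ℕ) : signedChoose (-1) j = 1 := by
  induction j with
  | zero => simp
  | succ j ih =>
    have := succ_mul_signedChoose_succ (-1) j
    rw [ih] at this
    have h : ((j : ℤ) + 1) ≠ 0 := by positivity
    exact mul_left_cancel₀ h (by linarith)

theorem signedChoose_neg_two (j : ℕ) : signedChoose (-2) j = j + 1 := by
  induction j with
  | zero => simp
  | succ j ih =>
    have := succ_mul_signedChoose_succ (-2) j
    rw [ih] at this
    have h : ((j : ℤ) + 1) ≠ 0 := by positivity
    apply mul_left_cancel₀ h
    push_cast
    linarith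

/-- Any finite number of such truncations hold simultaneously for large `M`, so identities between
circle products reduce to manipulations of finite sums. -/
theorem mode_circ_eventually (n : ℤ) (a b : QO V) (m : ℤ) (v : V) :
    ∀ᶠ M : ℕ in atTop, mode (circ n a b) m v =
      ∑ j ∈ Finset.range M, signedChoose n j • mode a (n - j) (mode b (m + j) v) -
      n.negOnePow • ∑ j ∈ Finset.range M, signedChoose n j • mode b (m + n - j) (mode a j v) := by
  obtain ⟨M₀, h⟩ := eventually_atTop.1 ((eventually_mode_eq_zero a v 0).and
    (eventually_mode_eq_zero b v m))
  filter_upwards [eventually_ge_atTop M₀] with M hM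
  rw [mode_circ, finsum_eq_sum_of_support_subset (s := Finset.range M), Finset.smul_sum,
    ← Finset.sum_sub_distrib]
  · refine Finset.sum_congr rfl fun j _ => ?_
    rw [smul_sub, smul_comm n.negOnePow]
    rfl
  · intro j hj
    simp only [Finset.coe_range, Set.mem_Iio]
    by_contra hlt
    obtain ⟨h1, h2⟩ := h j (by omega)
    rw [zero_add] at h1
    exact hj (by simp [h1, h2])

theorem circ_add_left (n : ℤ) (a a' b : QO V) : circ n (a + a') b = circ n a b + circ n a' b := by
  refine QO_ext fun m => LinearMap.ext fun v => ?_
  obtain ⟨M, h1, h2, h3⟩ := ((mode_circ_eventually n (a + a') b m v).and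
    ((mode_circ_eventually n a b m v).and (mode_circ_eventually n a' b m v))).exists
  simp only [mode_add, LinearMap.add_apply, h1, h2, h3, map_add, smul_add, Finset.sum_add_distrib]
  abel

theorem circ_add_right (n : ℤ) (a b b' : QO V) : circ n a (b + b') = circ n a b + circ n a b' := by
  refine QO_ext fun m => LinearMap.ext fun v => ?_
  obtain ⟨M, h1, h2, h3⟩ := ((mode_circ_eventually n a (b + b') m v).and
    ((mode_circ_eventually n a b m v).and (mode_circ_eventually n a b' m v))).exists
  simp only [mode_add, LinearMap.add_apply, h1, h2, h3, map_add, smul_add, Finset.sum_add_distrib]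
  abel

theorem circ_smul_left (n : ℤ) (r : ℂ) (a b : QO V) : circ n (r • a) b = r • circ n a b := by
  refine QO_ext fun m => LinearMap.ext fun v => ?_
  obtain ⟨M, h1, h2⟩ := ((mode_circ_eventually n (r • a) b m v).and
    (mode_circ_eventually n a b m v)).exists
  simp only [mode_smul, LinearMap.smul_apply, h1, h2, map_smul, smul_sub, Finset.smul_sum,
    smul_comm r]

theorem circ_smul_right (n : ℤ) (r : ℂ) (a b : QO V) : circ n a (r • b) = r • circ n a b := by
  refine QO_ext fun m => LinearMap.ext fun v => ?_
  obtain ⟨M, h1, h2⟩ := ((mode_circ_eventually n a (r • b) m v).and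
    (mode_circ_eventually n a b m v)).exists
  simp only [mode_smul, LinearMap.smul_apply, h1, h2, map_smul, smul_sub, Finset.smul_sum,
    smul_comm r]

/-- The circle product as a bilinear map. -/
def circLin (n : ℤ) : QO V →ₗ[ℂ] QO V →ₗ[ℂ] QO V :=
  LinearMap.mk₂ ℂ (circ n) (circ_add_left n) (circ_smul_left n) (circ_add_right n)
    (circ_smul_right n)

@[simp] theorem circLin_apply (n : ℤ) (a b : QO V) : circLin n a b = circ n a b := rfl

@[simp] theorem circ_zero_left (n : ℤ) (b : QO V) : circ n 0 b = 0 :=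
  LinearMap.map_zero₂ (circLin n) b

@[simp] theorem circ_zero_right (n : ℤ) (a : QO V) : circ n a 0 = 0 :=
  map_zero (circLin n a)

theorem der_add (a b : QO V) : der (a + b) = der a + der b :=
  QO_ext fun m => by simp [mode_der]

theorem der_smul (r : ℂ) (a : QO V) : der (r • a) = r • der a :=
  QO_ext fun m => by simp [mode_der]

/-- The unit has a single nonzero mode, so one summand survives: `j = -m-1` in the first half when
`m < 0`, `j = m-1` in the second half when `m > 0`. It makes every algebra closed under circle
products closed under `∂`. -/
theorem circ_neg_two_one (a : QO V) : circ (-2) a one = der a := by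
  refine QO_ext fun m => LinearMap.ext fun v => ?_
  rw [mode_circ, mode_der]
  have key : ∀ j : ℕ, ((-1) ^ j * Ring.choose (-2 : ℤ) j : ℤ) = j + 1 := signedChoose_neg_two
  have hs : (-2 : ℤ).negOnePow = 1 := rfl
  simp only [key, mode_one, hs, one_smul]
  rcases lt_trichotomy m 0 with hm | rfl | hm
  · rw [finsum_eq_single _ (-m - 1).toNat]
    · have e : (((-m - 1).toNat : ℕ) : ℤ) = -m - 1 := by omega
      rw [e, if_pos (by omega), if_neg (by omega)]
      simp only [LinearMap.id_apply, LinearMap.zero_apply, sub_zero, LinearMap.smul_apply]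
      congr 1
      · ring
      · congr 2; ring
    · intro j hj
      rw [if_neg (by omega), if_neg (by omega)]
      simp
  · rw [finsum_eq_zero_of_forall_eq_zero]
    · simp
    · intro j
      rw [if_neg (by omega), if_neg (by omega)]
      simp
  · rw [finsum_eq_single _ (m - 1).toNat]
    · have e : (((m - 1).toNat : ℕ) : ℤ) = m - 1 := by omega
      rw [e, if_neg (by omega), if_pos (by omega)]
      simp only [LinearMap.id_apply, LinearMap.zero_apply, map_zero, zero_sub,
        smul_neg, neg_smul]
      simp
    · intro j hj
      rw [if_neg (by omega), if_neg (by omega)]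
      simp

theorem sum_range_succ_smul_shift {G : Type*} [AddCommGroup G] (c : ℕ → ℤ) (X : ℕ → G) (M : ℕ)
    (h : X M = 0) :
    ∑ j ∈ Finset.range M, (((j : ℤ) + 1) * c (j + 1)) • X (j + 1) =
      ∑ j ∈ Finset.range M, ((j : ℤ) * c j) • X j := by
  have e := Finset.sum_range_succ' (fun j : ℕ => ((j : ℤ) * c j) • X j) M
  rw [Finset.sum_range_succ, h] at e
  simpa using e.symm

/-- An index shift based on `(j+1)c(j+1) = -(n-j)c(j)` rewrites the sums containing `der a` over the
same terms as those of `der b`. The scalars `j` and `-(m+j)` in the first half, and `n-j` and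
`-(m+n-j)` in the second, then both add up to `-m`. -/
theorem der_circ (n : ℤ) (a b : QO V) :
    der (circ n a b) = circ n (der a) b + circ n a (der b) := by
  refine QO_ext fun m => LinearMap.ext fun v => ?_
  obtain ⟨M, h1, h2, h3, h5, h6⟩ := ((mode_circ_eventually n a b (m - 1) v).and
    ((mode_circ_eventually n (der a) b m v).and ((mode_circ_eventually n a (der b) m v).and
    ((eventually_mode_eq_zero a v (-1)).and (eventually_mode_eq_zero b v (m - 1)))))).exists
  rw [mode_add, LinearMap.add_apply, h2, h3, mode_der, LinearMap.smul_apply, h1]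
  have hX := sum_range_succ_smul_shift (signedChoose n)
    (fun j => mode a (n - j) (mode b (m - 1 + j) v)) M (by simp [h6])
  have hY := sum_range_succ_smul_shift (signedChoose n)
    (fun j => mode b (m + n - j) (mode a (-1 + j) v)) M (by simp [h5])
  have hX' : ∑ j ∈ Finset.range M, signedChoose n j • mode (der a) (n - j) (mode b (m + j) v) =
      ∑ j ∈ Finset.range M, ((j : ℤ) * signedChoose n j) •
        mode a (n - j) (mode b (m - 1 + j) v) := by
    rw [← hX]
    refine Finset.sum_congr rfl fun j _ => ?_
    have i1 : n - ((j + 1 : ℕ) : ℤ) = n - j - 1 := by push_cast; ring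
    have i2 : m - 1 + ((j + 1 : ℕ) : ℤ) = m + j := by push_cast; ring
    rw [succ_mul_signedChoose_succ, mode_der, LinearMap.smul_apply, smul_smul, i1, i2,
      mul_comm (signedChoose n j)]
  have hY' : ∑ j ∈ Finset.range M, signedChoose n j • mode b (m + n - j) (mode (der a) j v) =
      ∑ j ∈ Finset.range M, ((n - j) * signedChoose n j) •
        mode b (m - 1 + n - j) (mode a j v) := by
    have : ∀ j : ℕ, signedChoose n j • mode b (m + n - j) (mode (der a) j v) =
        -(((j : ℤ) * signedChoose n j) • mode b (m + n - j) (mode a (-1 + j) v)) := by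
      intro j
      rw [mode_der, LinearMap.smul_apply, map_zsmul, smul_smul, ← neg_smul, mul_neg, mul_comm,
        show (-1 + (j : ℤ)) = j - 1 by ring]
    rw [Finset.sum_congr rfl fun j _ => this j, Finset.sum_neg_distrib, ← hY,
      ← Finset.sum_neg_distrib]
    refine Finset.sum_congr rfl fun j _ => ?_
    have i1 : m + n - ((j + 1 : ℕ) : ℤ) = m - 1 + n - j := by push_cast; ring
    have i2 : -1 + ((j + 1 : ℕ) : ℤ) = j := by push_cast; ring
    rw [succ_mul_signedChoose_succ, i1, i2, ← neg_smul]
    congr 1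
    ring
  rw [hX', hY', smul_sub, sub_add_sub_comm, ← Finset.sum_add_distrib, ← smul_add,
    ← Finset.sum_add_distrib, smul_comm (-m), Finset.smul_sum, Finset.smul_sum]
  congr 1
  · refine Finset.sum_congr rfl fun j _ => ?_
    rw [mode_der, LinearMap.smul_apply, map_zsmul, smul_smul, smul_smul,
      show m + (j : ℤ) - 1 = m - 1 + j by ring, ← add_smul]
    congr 1
    ring
  · congr 1
    refine Finset.sum_congr rfl fun j _ => ?_
    rw [mode_der, LinearMap.smul_apply, smul_smul, smul_smul,
      show m + n - (j : ℤ) - 1 = m - 1 + n - j by ring, ← add_smul]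
    congr 1
    ring

/-! ### Commuting fields -/

theorem FieldCommute.symm {a b : QO V} (h : FieldCommute a b) : FieldCommute b a :=
  fun m k => (h k m).symm

theorem FieldCommute.apply {a b : QO V} (h : FieldCommute a b) (m k : ℤ) (v : V) :
    mode a m (mode b k v) = mode b k (mode a m v) :=
  LinearMap.congr_fun (h m k) v

/-- The fields all of whose modes commute with an operator on `V` form a quantum operator
algebra. -/
theorem commute_mode_circ {f : Module.End ℂ V} {a b : QO V} (ha : ∀ m, Commute f (mode a m))
    (hb : ∀ m, Commute f (mode b m)) (n m : ℤ) : Commute f (mode (circ n a b) m) := by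
  refine LinearMap.ext fun v => ?_
  have ha' : ∀ m v, f (mode a m v) = mode a m (f v) := fun m v => LinearMap.congr_fun (ha m) v
  have hb' : ∀ m v, f (mode b m v) = mode b m (f v) := fun m v => LinearMap.congr_fun (hb m) v
  obtain ⟨M, h1, h2⟩ := ((mode_circ_eventually n a b m v).and
    (mode_circ_eventually n a b m (f v))).exists
  simp only [Module.End.mul_apply, h1, h2, map_sub, map_sum, map_zsmul, ha', hb',
    Units.smul_def]

theorem FieldCommute.circ_right {a b c : QO V} (hb : FieldCommute a b) (hc : FieldCommute a c)
    (n : ℤ) : FieldCommute a (circ n b c) :=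
  fun m k => commute_mode_circ (hb m) (hc m) n k

theorem fieldCommute_one (a : QO V) : FieldCommute a one := by
  intro m k
  rw [mode_one]
  split_ifs
  · exact Commute.one_right _
  · exact Commute.zero_right _

/-- The fields commuting with all members of a set. -/
def centralizer (X : Set (QO V)) : Submodule ℂ (QO V) where
  carrier := {a | ∀ x ∈ X, FieldCommute x a}
  zero_mem' := fun x _ m k => by simp
  add_mem' := fun {a b} ha hb x hx m k => by
    simpa using (ha x hx m k).add_right (hb x hx m k)
  smul_mem' := fun r {a} ha x hx m k => by
    simpa using (ha x hx m k).smul_right r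

theorem isQOA_centralizer (X : Set (QO V)) : IsQOA (centralizer X) where
  one_mem := fun x _ => fieldCommute_one x
  circ_mem := fun _ ha _ hb n x hx => (ha x hx).circ_right (hb x hx) n

/-! ### Generated algebras -/

theorem isQOA_generatedBy (X : Set (QO V)) : IsQOA (generatedBy X) where
  one_mem := by
    simp only [generatedBy, Submodule.mem_sInf]
    exact fun A hA => hA.1.one_mem
  circ_mem := by
    simp only [generatedBy, Submodule.mem_sInf]
    exact fun a ha b hb n A hA => hA.1.circ_mem _ (ha A hA) _ (hb A hA) n

theorem subset_generatedBy (X : Set (QO V)) : X ⊆ generatedBy X := by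
  intro x hx
  simp only [generatedBy, SetLike.mem_coe, Submodule.mem_sInf]
  exact fun A hA => hA.2 hx

theorem generatedBy_le {X : Set (QO V)} {A : Submodule ℂ (QO V)} (hA : IsQOA A) (hX : X ⊆ A) :
    generatedBy X ≤ A :=
  sInf_le ⟨hA, hX⟩

theorem generatedBy_mono {X Y : Set (QO V)} (h : X ⊆ Y) : generatedBy X ≤ generatedBy Y :=
  generatedBy_le (isQOA_generatedBy Y) (h.trans (subset_generatedBy Y))

theorem IsQOA.der_mem {A : Submodule ℂ (QO V)} (hA : IsQOA A) {a : QO V} (ha : a ∈ A) :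
    der a ∈ A := by
  rw [← circ_neg_two_one]
  exact hA.circ_mem _ ha _ hA.one_mem _

theorem IsQOA.wick_mem {A : Submodule ℂ (QO V)} (hA : IsQOA A) {a b : QO V} (ha : a ∈ A)
    (hb : b ∈ A) : wick a b ∈ A :=
  hA.circ_mem _ ha _ hb _

theorem fieldCommute_generatedBy {a : QO V} {X : Set (QO V)} (h : ∀ x ∈ X, FieldCommute a x)
    {b : QO V} (hb : b ∈ generatedBy X) : FieldCommute a b :=
  generatedBy_le (isQOA_centralizer {a}) (fun x hx y hy => by rw [hy]; exact h x hx) hb a rfl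

theorem fieldCommute_generatedBy_generatedBy {X Y : Set (QO V)}
    (h : ∀ x ∈ X, ∀ y ∈ Y, FieldCommute x y) {a b : QO V} (ha : a ∈ generatedBy X)
    (hb : b ∈ generatedBy Y) : FieldCommute a b :=
  fieldCommute_generatedBy (fun y hy =>
    (fieldCommute_generatedBy (fun x hx => (h x hx y hy).symm) ha).symm) hb

end QOTheory

/-! ### Difference operators -/

section Translate

variable {G M : Type*} [AddCommGroup G] [AddCommGroup M]

variable (M) in
/-- Translation of functions by `d`. -/
def translate (d : G) : Module.End ℤ (G → M) where
  toFun f x := f (x + d)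
  map_add' _ _ := rfl
  map_smul' _ _ := rfl

@[simp] theorem translate_apply (d : G) (f : G → M) (x : G) : translate M d f x = f (x + d) := rfl

theorem translate_commute (d e : G) : Commute (translate M d) (translate M e) :=
  LinearMap.ext fun f => funext fun x => by
    simp [add_right_comm]

theorem translate_pow_apply (d : G) (k : ℕ) (f : G → M) (x : G) :
    (translate M d ^ k) f x = f (x + k • d) := by
  induction k generalizing x with
  | zero => simp
  | succ k ih =>
    rw [pow_succ', Module.End.mul_apply, translate_apply, ih, add_assoc, succ_nsmul']

variable (M) in
/-- The difference of the translations by `d` and by `e`. -/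
def diffOp (d e : G) : Module.End ℤ (G → M) := translate M d - translate M e

theorem diffOp_apply (d e : G) (f : G → M) (x : G) : diffOp M d e f x = f (x + d) - f (x + e) := rfl

/-- Multiplying a formal distribution by `z-w` acts on its coefficients as a difference of two
commuting translations. The binomial theorem gives the sum that occurs in `CommuteToOrder`. -/
theorem diffOp_pow_apply (d e : G) (N : ℕ) (f : G → M) (x : G) :
    (diffOp M d e ^ N) f x =
      ∑ i ∈ Finset.range (N + 1), ((-1) ^ i * (N.choose i : ℤ)) •
        f (x + ((N : ℤ) - i) • d + (i : ℤ) • e) := by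
  rw [diffOp, sub_eq_neg_add, ((translate_commute (M := M) e d).neg_left).add_pow, LinearMap.sum_apply,
    Finset.sum_apply]
  refine Finset.sum_congr rfl fun i hi => ?_
  have hi' : i ≤ N := by simpa [Nat.lt_succ_iff] using hi
  have e1 : ((N.choose i : ℕ) : Module.End ℤ (G → M)) f = (N.choose i : ℤ) • f := by
    rw [Module.End.natCast_apply, natCast_zsmul]
  rw [Module.End.mul_apply, Module.End.mul_apply, neg_pow, Module.End.mul_apply, e1]
  have e2 : ∀ g : G → M, ((-1 : Module.End ℤ (G → M)) ^ i) g = ((-1 : ℤ) ^ i) • g := by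
    intro g
    rcases Nat.even_or_odd i with h | h
    · simp [h.neg_one_pow]
    · simp [h.neg_one_pow]
  rw [e2, Pi.smul_apply, translate_pow_apply, translate_pow_apply, Pi.smul_apply, smul_smul]
  congr 2
  rw [add_right_comm, ← Nat.cast_sub hi', natCast_zsmul, natCast_zsmul]

theorem diffOp_commute (d e d' e' : G) : Commute (diffOp M d e) (diffOp M d' e') :=
  ((translate_commute d d').sub_right (translate_commute d e')).sub_left
    ((translate_commute e d').sub_right (translate_commute e e'))

theorem translate_commute_diffOp (c d e : G) : Commute (translate M c) (diffOp M d e) :=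
  (translate_commute c d).sub_right (translate_commute c e)

/-- `f` is the pointwise eventually constant sum of the sequence `g`. -/
def IsLocallyFiniteSum {G M : Type*} [AddCommGroup M] (f : G → M) (g : ℕ → G → M) : Prop :=
  ∀ x, ∀ᶠ K in atTop, f x = ∑ j ∈ Finset.range K, g j x

theorem IsLocallyFiniteSum.diffOp_pow {f : G → M} {g : ℕ → G → M}
    (h : IsLocallyFiniteSum f g) (d e : G) (N : ℕ) :
    IsLocallyFiniteSum ((diffOp M d e ^ N) f) (fun j => (diffOp M d e ^ N) (g j)) := by
  induction N with
  | zero => simpa using h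
  | succ N ih =>
    intro x
    filter_upwards [ih (x + d), ih (x + e)] with K h1 h2
    simp only [pow_succ', Module.End.mul_apply, diffOp_apply, h1, h2, Finset.sum_sub_distrib]

theorem IsLocallyFiniteSum.eq_zero {G M : Type*} [AddCommGroup M] {f : G → M} {g : ℕ → G → M}
    (h : IsLocallyFiniteSum f g) (hg : ∀ j, g j = 0) : f = 0 := by
  funext x
  obtain ⟨K, hK⟩ := (h x).exists
  rw [hK]
  simp [hg]

/-- If `(z-w)^M` and `(z-u)^N (w-u)^N` annihilate `f`, then so does `(w-u)^{M+2N}`. -/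
theorem diffOp_pow_eq_zero {d₁ d₂ d₃ : G} {f : G → M} {K N : ℕ} (h₁ : (diffOp M d₁ d₂ ^ K) f = 0)
    (h₂ : (diffOp M d₁ d₃ ^ N) ((diffOp M d₂ d₃ ^ N) f) = 0) :
    (diffOp M d₂ d₃ ^ (K + N + N)) f = 0 := by
  -- This is `w-u = -(z-w) + (z-u)`. In the expansion of its power `K+N` every term contains
  -- `(z-w)^K` or `(z-u)^N`; the remaining factor `(w-u)^N` is kept aside for `h₂`.
  have e : diffOp M d₂ d₃ = -diffOp M d₁ d₂ + diffOp M d₁ d₃ := by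
    simp only [diffOp]; abel
  rw [pow_add, Module.End.mul_apply]
  nth_rw 1 [e]
  rw [((diffOp_commute (M := M) d₁ d₂ d₁ d₃).neg_left).add_pow, LinearMap.sum_apply]
  refine Finset.sum_eq_zero fun i _ => ?_
  rw [Module.End.mul_apply, Module.End.mul_apply, Module.End.natCast_apply, map_nsmul, map_nsmul]
  convert smul_zero _
  rcases le_or_gt K i with hi | hi
  · obtain ⟨t, rfl⟩ := Nat.exists_eq_add_of_le' hi
    have c := ((diffOp_commute (M := M) d₁ d₂ d₁ d₃).pow_pow K (K + N - (t + K))).eq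
    have c' := ((diffOp_commute (M := M) d₁ d₂ d₂ d₃).pow_pow K N).eq
    rw [neg_pow, Module.End.mul_apply, pow_add (diffOp M d₁ d₂), Module.End.mul_apply,
      ← Module.End.mul_apply (diffOp M d₁ d₂ ^ K), c, Module.End.mul_apply,
      ← Module.End.mul_apply (diffOp M d₁ d₂ ^ K), c', Module.End.mul_apply, h₁]
    simp
  · obtain ⟨t, ht⟩ : ∃ t, K + N - i = t + N := ⟨K - i, by omega⟩
    rw [ht, pow_add, Module.End.mul_apply, h₂, map_zero, map_zero]

end Translate

/-! ### Locality of fields, Dong's lemma and the commutator formula -/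

section Locality

variable {V : Type*} [AddCommGroup V] [Module ℂ V]

theorem commuteToOrder_iff {N : ℕ} {a b : QO V} : CommuteToOrder N a b ↔
    ∀ v, (diffOp V ((1, 0) : ℤ × ℤ) (0, 1) ^ N) (fun x : ℤ × ℤ =>
      mode a x.1 (mode b x.2 v) - mode b x.2 (mode a x.1 v)) = 0 := by
  constructor
  · intro h v
    funext x
    rw [diffOp_pow_apply]
    have := LinearMap.congr_fun (h x.1 x.2) v
    simpa only [LinearMap.sum_apply, add_sub_assoc, LinearMap.smul_apply, LinearMap.sub_apply,
      Module.End.mul_apply, Prod.fst_add, Prod.snd_add, Prod.smul_mk, smul_eq_mul, mul_one,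
      mul_zero, add_zero, LinearMap.zero_apply, Pi.zero_apply] using this
  · intro h m k
    refine LinearMap.ext fun v => ?_
    have := congrFun (h v) (m, k)
    rw [diffOp_pow_apply] at this
    simpa only [LinearMap.sum_apply, add_sub_assoc, LinearMap.smul_apply, LinearMap.sub_apply,
      Module.End.mul_apply, Prod.fst_add, Prod.snd_add, Prod.smul_mk, smul_eq_mul, mul_one,
      mul_zero, add_zero, LinearMap.zero_apply, Pi.zero_apply] using this

theorem CommuteToOrder.mono {N N' : ℕ} {a b : QO V} (h : CommuteToOrder N a b) (hN : N ≤ N') :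
    CommuteToOrder N' a b := by
  rw [commuteToOrder_iff] at h ⊢
  intro v
  obtain ⟨k, rfl⟩ := Nat.exists_eq_add_of_le' hN
  rw [pow_add, Module.End.mul_apply, h v, map_zero]

theorem CommuteToOrder.symm {N : ℕ} {a b : QO V} (h : CommuteToOrder N a b) :
    CommuteToOrder N b a := by
  intro m k
  have := h k m
  rw [← Finset.sum_range_reflect] at this
  -- Reversing the sum contributes the sign `(-1)^N`, and reversing the commutator one more.
  have h2 : ((-1 : ℤ) ^ (N + 1)) • (∑ j ∈ Finset.range (N + 1),
      ((-1) ^ (N + 1 - 1 - j) * (N.choose (N + 1 - 1 - j) : ℤ)) •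
      (mode a (k + N - ((N + 1 - 1 - j : ℕ) : ℤ)) * mode b (m + ((N + 1 - 1 - j : ℕ) : ℤ)) -
        mode b (m + ((N + 1 - 1 - j : ℕ) : ℤ)) * mode a (k + N - ((N + 1 - 1 - j : ℕ) : ℤ)))) = 0 := by
    rw [this, smul_zero]
  rw [← h2, Finset.smul_sum]
  refine Finset.sum_congr rfl fun i hi => ?_
  have hi' : i ≤ N := by simpa [Nat.lt_succ_iff] using hi
  have c1 : ((N + 1 - 1 - i : ℕ) : ℤ) = N - i := by omega
  rw [c1, Nat.add_sub_cancel, Nat.choose_symm hi', show k + (N : ℤ) - (N - i) = k + i by ring,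
    show m + ((N : ℤ) - i) = m + N - i by ring, smul_smul, ← neg_sub (mode b _ * _), smul_neg,
    ← neg_smul]
  congr 1
  have : (-1 : ℤ) ^ (N + 1) * (-1) ^ (N - i) = -(-1) ^ i := by
    obtain ⟨t, rfl⟩ := Nat.exists_eq_add_of_le hi'
    rw [Nat.add_sub_cancel_left, pow_succ, pow_add]
    have : ((-1 : ℤ) ^ t) * (-1) ^ t = 1 := by rw [← mul_pow]; simp
    linear_combination (-(-1) ^ i) * this
  rw [← mul_assoc, this]
  ring

theorem QuantumCommute.symm {a b : QO V} (h : QuantumCommute a b) : QuantumCommute b a :=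
  h.imp fun _ hN => hN.symm

theorem FieldCommute.quantumCommute {a b : QO V} (h : FieldCommute a b) : QuantumCommute a b :=
  ⟨0, fun m k => by simp [(h m k).eq]⟩

theorem QuantumCommute.add_right {a b b' : QO V} (h : QuantumCommute a b)
    (h' : QuantumCommute a b') : QuantumCommute a (b + b') := by
  obtain ⟨N, hN⟩ := h
  obtain ⟨N', hN'⟩ := h'
  refine ⟨max N N', fun m k => ?_⟩
  have h1 := hN.mono (le_max_left N N') m k
  have h2 := hN'.mono (le_max_right N N') m k
  rw [← add_zero (0 : Module.End ℂ V)]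
  nth_rw 1 [← h1]
  rw [← h2, ← Finset.sum_add_distrib]
  refine Finset.sum_congr rfl fun i _ => ?_
  rw [← smul_add, mode_add]
  congr 1
  noncomm_ring

theorem QuantumCommute.smul_right {a b : QO V} (h : QuantumCommute a b) (r : ℂ) :
    QuantumCommute a (r • b) := by
  obtain ⟨N, hN⟩ := h
  refine ⟨N, fun m k => ?_⟩
  have h1 := congrArg (r • ·) (hN m k)
  simp only [smul_zero, Finset.smul_sum] at h1
  rw [← h1]
  refine Finset.sum_congr rfl fun i _ => ?_
  rw [smul_comm r, smul_sub r, mode_smul, mul_smul_comm, smul_mul_assoc]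

/-! ### Dong's lemma -/

/-- The field `z^p a(z)`. -/
def shiftField (p : ℤ) (a : QO V) : QO V :=
  ofModes (fun m => mode a (p + m)) fun v => by
    obtain ⟨N, hN⟩ := mode_bdd a v
    exact ⟨N - p, fun m hm => hN _ (by omega)⟩

theorem mode_shiftField (p : ℤ) (a : QO V) (m : ℤ) : mode (shiftField p a) m = mode a (p + m) := by
  rw [shiftField, mode_ofModes]

/-- The coefficients of the two-variable distribution
`a(z)b(w) ι_{|z|>|w|}(z-w)^n - b(w)a(z) ι_{|w|>|z|}(z-w)^n`. -/
def circDist (n : ℤ) (a b : QO V) (p q : ℤ) : Module.End ℂ V := mode (circ n (shiftField p a) b) q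

theorem circDist_zero_left (n : ℤ) (a b : QO V) (q : ℤ) :
    circDist n a b 0 q = mode (circ n a b) q := by
  have : shiftField 0 a = a := QO_ext fun m => by rw [mode_shiftField, zero_add]
  rw [circDist, this]

theorem circDist_eventually (n : ℤ) (a b : QO V) (p q : ℤ) (v : V) :
    ∀ᶠ K : ℕ in atTop, circDist n a b p q v =
      ∑ j ∈ Finset.range K, signedChoose n j • mode a (p + n - j) (mode b (q + j) v) -
      n.negOnePow • ∑ j ∈ Finset.range K,
        signedChoose n j • mode b (q + n - j) (mode a (p + j) v) := by
  simpa [circDist, mode_shiftField, add_sub_assoc] using mode_circ_eventually n (shiftField p a) b q v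

theorem sum_signedChoose_succ {G : Type*} [AddCommGroup G] (n : ℤ) (X : ℕ → G) (K : ℕ)
    (h : X K = 0) :
    ∑ j ∈ Finset.range K, signedChoose (n + 1) j • X j =
      ∑ j ∈ Finset.range K, signedChoose n j • X j -
        ∑ j ∈ Finset.range K, signedChoose n j • X (j + 1) := by
  have key : ∀ K : ℕ, ∑ j ∈ Finset.range (K + 1), signedChoose (n + 1) j • X j =
      ∑ j ∈ Finset.range (K + 1), signedChoose n j • X j -
        ∑ j ∈ Finset.range K, signedChoose n j • X (j + 1) := by
    intro K
    induction K with
    | zero => simp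
    | succ K ih =>
      rw [Finset.sum_range_succ, ih, Finset.sum_range_succ _ (K + 1),
        Finset.sum_range_succ (fun j => signedChoose n j • X (j + 1)) K, signedChoose_succ_succ,
        sub_smul]
      abel
  have := key K
  rw [Finset.sum_range_succ, Finset.sum_range_succ, h] at this
  simpa using this

/-- In both expansion domains `(z-w)` times the expansion of `(z-w)^n` is the expansion of
`(z-w)^(n+1)`; on coefficients this is Pascal's rule. -/
theorem circDist_succ (n : ℤ) (a b : QO V) (p q : ℤ) :
    circDist n a b (p + 1) q - circDist n a b p (q + 1) = circDist (n + 1) a b p q := by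
  refine LinearMap.ext fun v => ?_
  obtain ⟨K, h1, h2, h3, h4, h5⟩ := ((circDist_eventually n a b (p + 1) q v).and
    ((circDist_eventually n a b p (q + 1) v).and ((circDist_eventually (n + 1) a b p q v).and
    ((eventually_mode_eq_zero a v p).and (eventually_mode_eq_zero b v q))))).exists
  rw [LinearMap.sub_apply, h1, h2, h3]
  have hX := sum_signedChoose_succ n (fun j => mode a (p + (n + 1) - j) (mode b (q + j) v)) K
    (by simp [h5])
  have hY := sum_signedChoose_succ n (fun j => mode b (q + (n + 1) - j) (mode a (p + j) v)) K
    (by simp [h4])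
  rw [hX, hY, Int.negOnePow_succ]
  have i1 : ∀ j : ℕ, p + (n + 1) - ((j + 1 : ℕ) : ℤ) = p + n - j := fun j => by push_cast; ring
  have i2 : ∀ j : ℕ, q + (n + 1) - ((j + 1 : ℕ) : ℤ) = q + n - j := fun j => by push_cast; ring
  have i3 : ∀ j : ℕ, q + ((j + 1 : ℕ) : ℤ) = q + 1 + j := fun j => by push_cast; ring
  have i4 : ∀ j : ℕ, p + ((j + 1 : ℕ) : ℤ) = p + 1 + j := fun j => by push_cast; ring
  simp only [i1, i2, i3, i4, show p + 1 + n = p + (n + 1) by ring,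
    show q + 1 + n = q + (n + 1) by ring]
  rw [Units.neg_smul, smul_sub]
  abel

/-- For a nonnegative exponent the two expansions of `(z-w)^N` coincide, so the distribution is
`(z-w)^N [a(z), b(w)]`. -/
theorem circDist_natCast (N : ℕ) (a b : QO V) (p q : ℤ) (v : V) :
    circDist N a b p q v = ∑ j ∈ Finset.range (N + 1), ((-1) ^ j * (N.choose j : ℤ)) •
      (mode a (p + N - j) (mode b (q + j) v) - mode b (q + j) (mode a (p + N - j) v)) := by
  obtain ⟨K, h1, hK⟩ := ((circDist_eventually N a b p q v).and (eventually_ge_atTop (N + 1))).exists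
  rw [h1]
  have hz : ∀ X : ℕ → V, ∑ j ∈ Finset.range K, signedChoose N j • X j =
      ∑ j ∈ Finset.range (N + 1), signedChoose N j • X j := by
    intro X
    refine (Finset.sum_subset (by simpa using hK) fun j _ hj => ?_).symm
    rw [signedChoose_natCast, Nat.choose_eq_zero_of_lt (by simpa using hj)]
    simp
  have e : (N : ℤ).negOnePow • ∑ j ∈ Finset.range (N + 1),
      signedChoose N j • mode b (q + N - j) (mode a (p + j) v) =
      ∑ j ∈ Finset.range (N + 1),
        signedChoose N j • mode b (q + j) (mode a (p + N - j) v) := by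
    rw [← Finset.sum_range_reflect, Finset.smul_sum]
    refine Finset.sum_congr rfl fun i hi => ?_
    have hi' : i ≤ N := by simpa [Nat.lt_succ_iff] using hi
    have c1 : ((N + 1 - 1 - i : ℕ) : ℤ) = N - i := by omega
    rw [c1, show q + (N : ℤ) - (N - i) = q + i by ring, show p + ((N : ℤ) - i) = p + N - i by ring,
      signedChoose_natCast, signedChoose_natCast, Nat.add_sub_cancel, Nat.choose_symm hi',
      Units.smul_def, smul_smul, Int.coe_negOnePow_natCast, ← mul_assoc]
    congr 2
    obtain ⟨t, rfl⟩ := Nat.exists_eq_add_of_le hi'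
    rw [Nat.add_sub_cancel_left, pow_add, mul_assoc, ← mul_pow]
    simp
  rw [hz, hz, e, ← Finset.sum_sub_distrib]
  simp only [smul_sub, signedChoose_natCast]

theorem CommuteToOrder.circDist_eq_zero {N : ℕ} {a b : QO V} (h : CommuteToOrder N a b)
    (p q : ℤ) : circDist N a b p q = 0 := by
  refine LinearMap.ext fun v => ?_
  have := LinearMap.congr_fun (h p q) v
  rw [circDist_natCast]
  simpa only [LinearMap.sum_apply, LinearMap.smul_apply, LinearMap.sub_apply,
    Module.End.mul_apply] using this

/-- Dong's lemma. -/
theorem QuantumCommute.circ_left {a b c : QO V} (hab : QuantumCommute a b)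
    (hac : QuantumCommute a c) (hbc : QuantumCommute b c) (n : ℤ) :
    QuantumCommute (circ n a b) c := by
  obtain ⟨N₁, h₁⟩ := hab
  obtain ⟨N₂, h₂⟩ := hac
  obtain ⟨N₃, h₃⟩ := hbc
  replace h₂ := h₂.mono (le_max_left N₂ N₃)
  replace h₃ := h₃.mono (le_max_right N₂ N₃)
  generalize max N₂ N₃ = N at h₂ h₃
  -- Multiplication by `(z-w)^K` raises the exponent `n` to `n+K`; `K` is so large that locality of
  -- `a` and `b` then kills the distribution.
  obtain ⟨K, hK⟩ : ∃ K : ℕ, CommuteToOrder (n + K).toNat a b ∧ 0 ≤ n + K :=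
    ⟨(N₁ - n).toNat, h₁.mono (by omega), by omega⟩
  refine ⟨K + N + N, ?_⟩
  rw [commuteToOrder_iff]
  intro v
  let f : ℤ → ℤ × ℤ × ℤ → V := fun n x =>
    circDist n a b x.1 x.2.1 (mode c x.2.2 v) - mode c x.2.2 (circDist n a b x.1 x.2.1 v)
  have hf : ∀ K : ℕ, (diffOp V ((1, 0, 0) : ℤ × ℤ × ℤ) (0, 1, 0) ^ K) (f n) = f (n + K) := by
    intro K
    induction K with
    | zero => simp
    | succ K ih =>
      rw [pow_succ', Module.End.mul_apply, ih]
      funext x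
      have := circDist_succ (n + K) a b x.1 x.2.1
      simp only [diffOp_apply, f, Nat.cast_add, Nat.cast_one, ← add_assoc, ← this,
        LinearMap.sub_apply, map_sub, Prod.fst_add, Prod.snd_add, add_zero]
      abel
  let F : ℤ × ℤ × ℤ → V := fun x => mode a x.1 (mode b x.2.1 (mode c x.2.2 v)) -
    mode c x.2.2 (mode a x.1 (mode b x.2.1 v))
  let F' : ℤ × ℤ × ℤ → V := fun x => mode b x.2.1 (mode a x.1 (mode c x.2.2 v)) -
    mode c x.2.2 (mode b x.2.1 (mode a x.1 v))
  -- The commutator of the two-variable distribution with `c(u)` is a locally finite sum of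
  -- translates of the coefficients of `[a(z)b(w), c(u)]` and `[b(w)a(z), c(u)]`. It is therefore
  -- enough to annihilate these two families.
  have hsum : IsLocallyFiniteSum (f n) (fun j => signedChoose n j • translate V (n - j, ↑j, 0) F -
      ((n.negOnePow : ℤ) * signedChoose n j) • translate V (↑j, n - j, 0) F') := by
    intro x
    filter_upwards [circDist_eventually n a b x.1 x.2.1 (mode c x.2.2 v),
      circDist_eventually n a b x.1 x.2.1 v] with K h1 h2
    simp only [f, F, F', h1, h2, map_sub, map_sum, map_zsmul, Units.smul_def, Finset.smul_sum,
      ← Finset.sum_sub_distrib, Pi.sub_apply, Pi.smul_apply, translate_apply, Prod.fst_add,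
      Prod.snd_add, add_zero, smul_sub, mul_smul, add_sub_assoc]
    refine Finset.sum_congr rfl fun j _ => ?_
    abel
  let ZU := diffOp V ((1, 0, 0) : ℤ × ℤ × ℤ) (0, 0, 1)
  let WU := diffOp V ((0, 1, 0) : ℤ × ℤ × ℤ) (0, 0, 1)
  have hc : Commute (ZU ^ N) (WU ^ N) := (diffOp_commute _ _ _ _).pow_pow N N
  have hac : ∀ (u : ℤ → V) (g : ℤ → Module.End ℂ V), (ZU ^ N) (fun x => g x.2.1
      (mode a x.1 (mode c x.2.2 (u x.2.1)) - mode c x.2.2 (mode a x.1 (u x.2.1)))) = 0 := by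
    intro u g
    funext x
    have := congrArg (g x.2.1) (LinearMap.congr_fun (h₂ x.1 x.2.2) (u x.2.1))
    rw [diffOp_pow_apply]
    simpa only [LinearMap.sum_apply, add_sub_assoc, LinearMap.smul_apply, LinearMap.sub_apply,
      Module.End.mul_apply, Prod.fst_add, Prod.snd_add, Prod.smul_mk, smul_eq_mul, mul_one,
      mul_zero, add_zero, LinearMap.zero_apply, Pi.zero_apply, map_sum, map_zsmul,
      map_zero] using this
  have hbc : ∀ (u : ℤ → V) (g : ℤ → Module.End ℂ V), (WU ^ N) (fun x => g x.1
      (mode b x.2.1 (mode c x.2.2 (u x.1)) - mode c x.2.2 (mode b x.2.1 (u x.1)))) = 0 := by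
    intro u g
    funext x
    have := congrArg (g x.1) (LinearMap.congr_fun (h₃ x.2.1 x.2.2) (u x.1))
    rw [diffOp_pow_apply]
    simpa only [LinearMap.sum_apply, add_sub_assoc, LinearMap.smul_apply, LinearMap.sub_apply,
      Module.End.mul_apply, Prod.fst_add, Prod.snd_add, Prod.smul_mk, smul_eq_mul, mul_one,
      mul_zero, add_zero, LinearMap.zero_apply, Pi.zero_apply, map_sum, map_zsmul,
      map_zero] using this
  -- In `[ab, c] = a[b,c] + [a,c]b` the first term is killed by `(w-u)^N` and the second by
  -- `(z-u)^N`.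
  have hF : (ZU ^ N) ((WU ^ N) F) = 0 := by
    have e : F = (fun x => mode a x.1
        (mode b x.2.1 (mode c x.2.2 v) - mode c x.2.2 (mode b x.2.1 v))) +
        (fun x => (1 : Module.End ℂ V) (mode a x.1 (mode c x.2.2 (mode b x.2.1 v)) -
          mode c x.2.2 (mode a x.1 (mode b x.2.1 v)))) := by
      funext x
      simp [F]
    rw [e, map_add, map_add, hbc (fun _ => v) (fun p => mode a p), map_zero, zero_add,
      ← Module.End.mul_apply, hc.eq, Module.End.mul_apply, hac (fun q => mode b q v) (fun _ => 1),
      map_zero]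
  have hF' : (ZU ^ N) ((WU ^ N) F') = 0 := by
    have e : F' = (fun x => mode b x.2.1
        (mode a x.1 (mode c x.2.2 v) - mode c x.2.2 (mode a x.1 v))) +
        (fun x => (1 : Module.End ℂ V) (mode b x.2.1 (mode c x.2.2 (mode a x.1 v)) -
          mode c x.2.2 (mode b x.2.1 (mode a x.1 v)))) := by
      funext x
      simp [F']
    rw [e, map_add, map_add, hbc (fun p => mode a p v) (fun _ => 1), map_zero, add_zero,
      ← Module.End.mul_apply, hc.eq, Module.End.mul_apply, hac (fun _ => v) (fun q => mode b q),
      map_zero]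
  have hct : ∀ d, Commute (ZU ^ N * WU ^ N) (translate V d) := fun d =>
    ((translate_commute_diffOp d _ _).symm.pow_left N).mul_left
      ((translate_commute_diffOp d _ _).symm.pow_left N)
  have hQ : (ZU ^ N) ((WU ^ N) (f n)) = 0 := by
    refine ((hsum.diffOp_pow _ _ N).diffOp_pow _ _ N).eq_zero fun j => ?_
    have e1 : ∀ d, (ZU ^ N) ((WU ^ N) (translate V d F)) = 0 := fun d => by
      rw [← Module.End.mul_apply, ← Module.End.mul_apply, (hct d).eq, Module.End.mul_apply,
        Module.End.mul_apply, hF, map_zero]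
    have e2 : ∀ d, (ZU ^ N) ((WU ^ N) (translate V d F')) = 0 := fun d => by
      rw [← Module.End.mul_apply, ← Module.End.mul_apply, (hct d).eq, Module.End.mul_apply,
        Module.End.mul_apply, hF', map_zero]
    change (ZU ^ N) ((WU ^ N) _) = 0
    rw [map_sub, map_sub, map_zsmul, map_zsmul, map_zsmul, map_zsmul, e1, e2, smul_zero, smul_zero,
      sub_zero]
  have hZW : (diffOp V ((1, 0, 0) : ℤ × ℤ × ℤ) (0, 1, 0) ^ K) (f n) = 0 := by
    rw [hf]
    funext x
    have e := hK.1.circDist_eq_zero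
    rw [Int.toNat_of_nonneg hK.2] at e
    simp [f, e]
  have key := diffOp_pow_eq_zero hZW hQ
  funext x
  -- Index `0` in the first variable is the residue in `z`, which is `a ∘ₙ b`. The operator in `w`
  -- and `u` does not move this index.
  have := congrFun key (0, x.1, x.2)
  rw [diffOp_pow_apply] at this ⊢
  simpa only [f, Prod.fst_add, Prod.snd_add, Prod.smul_mk, smul_eq_mul, mul_one,
      mul_zero, add_zero, circDist_zero_left, Pi.zero_apply] using this

/-! ### Algebras generated by mutually local fields -/

/-- Zorn's lemma gives a maximal mutually local set `Y` containing `X`. By maximality a field local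
with itself and with `Y` already lies in `Y`, so by Dong's lemma `Y` is itself a quantum operator
algebra and contains the generated one. -/
theorem isVertexAlgebra_generatedBy {X : Set (QO V)}
    (hX : ∀ a ∈ X, ∀ b ∈ X, QuantumCommute a b) : IsVertexAlgebra (generatedBy X) := by
  obtain ⟨Y, hXY, hY⟩ := zorn_subset_nonempty
    {Y : Set (QO V) | ∀ a ∈ Y, ∀ b ∈ Y, QuantumCommute a b} (by
      intro C hC hchain _
      refine ⟨⋃₀ C, ?_, fun s hs => Set.subset_sUnion_of_mem hs⟩
      rintro a ⟨s, hs, has⟩ b ⟨t, ht, hbt⟩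
      rcases hchain.total hs ht with h | h
      · exact hC ht a (h has) b hbt
      · exact hC hs a has b (h hbt)) X hX
  have hloc : ∀ a ∈ Y, ∀ b ∈ Y, QuantumCommute a b := hY.prop
  have hmem : ∀ a : QO V, (∀ b ∈ Y, QuantumCommute a b) → QuantumCommute a a → a ∈ Y := by
    intro a ha haa
    refine hY.le_of_ge (y := insert a Y) ?_ (Set.subset_insert a Y) (Set.mem_insert a Y)
    rintro b (rfl | hb) c (rfl | hc)
    · exact haa
    · exact ha c hc
    · exact (ha b hb).symm
    · exact hloc b hb c hc
  have hone : ∀ a : QO V, QuantumCommute one a := fun a =>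
    (fieldCommute_one a).symm.quantumCommute
  let A : Submodule ℂ (QO V) :=
    { carrier := Y
      zero_mem' := hmem 0 (fun b _ => ⟨0, fun m k => by simp⟩) ⟨0, fun m k => by simp⟩
      add_mem' := fun {a b} ha hb => by
        have h : ∀ c, QuantumCommute a c → QuantumCommute b c → QuantumCommute (a + b) c :=
          fun c h1 h2 => (h1.symm.add_right h2.symm).symm
        have h' : ∀ c ∈ Y, QuantumCommute (a + b) c := fun c hc =>
          h c (hloc a ha c hc) (hloc b hb c hc)
        exact hmem _ h' (h _ (h' a ha).symm (h' b hb).symm)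
      smul_mem' := fun r {a} ha => by
        have h' : ∀ c ∈ Y, QuantumCommute (r • a) c := fun c hc =>
          ((hloc c hc a ha).smul_right r).symm
        exact hmem _ h' ((h' a ha).smul_right r) }
  have hA : IsQOA A := by
    refine ⟨hmem one (fun b _ => hone b) (hone one), fun a ha b hb n => ?_⟩
    have h' : ∀ c ∈ Y, QuantumCommute (circ n a b) c := fun c hc =>
      (hloc a ha b hb).circ_left (hloc a ha c hc) (hloc b hb c hc) n
    exact hmem _ h' ((hloc a ha b hb).circ_left (h' a ha).symm (h' b hb).symm n)
  exact { isQOA_generatedBy X with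
    quantumCommute := fun a ha b hb =>
      hloc a (generatedBy_le hA hXY ha) b (generatedBy_le hA hXY hb) }

/-! ### The commutator formula -/

/-- Newton's forward difference formula on `ℤ`: both sides have the same differences, by induction
on `N`, and the same value at `0`. -/
theorem eq_sum_choose_smul_of_diffOp_pow_eq_zero {M : Type*} [AddCommGroup M] (N : ℕ) (g : ℤ → M)
    (h : (diffOp M (1 : ℤ) 0 ^ N) g = 0) (m : ℤ) :
    g m = ∑ i ∈ Finset.range N, Ring.choose m i • (diffOp M (1 : ℤ) 0 ^ i) g 0 := by
  induction N generalizing g m with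
  | zero => simpa using congrFun h m
  | succ N ih =>
    set Δ := diffOp M (1 : ℤ) 0 with hΔ
    have h1 : ∀ m, g (m + 1) - g m = ∑ i ∈ Finset.range N, Ring.choose m i • (Δ ^ (i + 1)) g 0 := by
      intro m
      have := ih (Δ g) (by rw [← Module.End.mul_apply, ← pow_succ, h]) m
      rw [show Δ g m = g (m + 1) - g m by rw [hΔ, diffOp_apply, add_zero]] at this
      rw [this]
      simp only [pow_succ, Module.End.mul_apply]
    let s : ℤ → M := fun m => ∑ i ∈ Finset.range (N + 1), Ring.choose m i • (Δ ^ i) g 0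
    have h2 : ∀ m, s (m + 1) - s m = g (m + 1) - g m := by
      intro m
      simp only [s]
      rw [h1, ← Finset.sum_sub_distrib, Finset.sum_range_succ']
      simp only [Ring.choose_succ_succ, Ring.choose_zero_right, sub_self, add_zero, add_smul,
        add_sub_cancel_right]
    have h0 : s 0 = g 0 := by
      simp only [s]
      rw [Finset.sum_range_succ']
      simp [Ring.choose_zero_succ]
    have h3 : ∀ m, g m - s m = 0 := by
      intro m
      induction m using Int.induction_on with
      | zero => rw [h0, sub_self]
      | succ m ih => rw [← ih, sub_eq_sub_iff_sub_eq_sub]; exact (h2 _).symm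
      | pred m ih =>
        have := h2 (-m - 1)
        rw [sub_add_cancel] at this
        rw [← ih, sub_eq_sub_iff_sub_eq_sub]
        rw [← neg_sub, ← this, neg_sub]
    exact sub_eq_zero.1 (h3 m)

theorem mode_circ_natCast_apply (i : ℕ) (a b : QO V) (k : ℤ) (v : V) :
    mode (circ i a b) k v = (diffOp V (1 : ℤ) 0 ^ i) (fun m =>
      mode a m (mode b (i + k - m) v) - mode b (i + k - m) (mode a m v)) 0 := by
  rw [← circDist_zero_left, circDist_natCast, diffOp_pow_apply]
  refine Finset.sum_congr rfl fun l _ => ?_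
  simp only [smul_eq_mul, mul_one, mul_zero, add_zero, zero_add]
  rw [show (i : ℤ) + k - (i - l) = k + l by ring]

/-- The commutator formula. -/
theorem commutator_eq_sum {a b : QO V} {N : ℕ} (h : CommuteToOrder N a b) (m k : ℤ) (v : V) :
    mode a m (mode b k v) - mode b k (mode a m v) =
      ∑ i ∈ Finset.range N, Ring.choose m i • mode (circ i a b) (m + k - i) v := by
  -- Along the line of constant `m+k` multiplication by `(z-w)^N` is the `N`-th forward difference,
  -- so locality makes the commutator polynomial in the first index.
  have h1 : (diffOp V (1 : ℤ) 0 ^ N) (fun l =>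
      mode a l (mode b (m + k - l) v) - mode b (m + k - l) (mode a l v)) = 0 := by
    funext l
    have := LinearMap.congr_fun (h l (m + k - l - N)) v
    rw [diffOp_pow_apply]
    simp only [LinearMap.sum_apply, LinearMap.smul_apply, LinearMap.sub_apply,
      Module.End.mul_apply, LinearMap.zero_apply] at this
    rw [Pi.zero_apply, ← this]
    refine Finset.sum_congr rfl fun i _ => ?_
    simp only [smul_eq_mul, mul_one, mul_zero, add_zero]
    rw [show m + k - (l + ((N : ℤ) - i)) = m + k - l - N + i by ring, add_sub_assoc l]
  have h2 := eq_sum_choose_smul_of_diffOp_pow_eq_zero N _ h1 m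
  simp only [add_sub_cancel_left] at h2
  rw [h2]
  refine Finset.sum_congr rfl fun i _ => ?_
  rw [mode_circ_natCast_apply, add_sub_cancel]

/-- Local fields without singular terms in their operator product commute. -/
theorem QuantumCommute.fieldCommute {a b : QO V} (h : QuantumCommute a b)
    (h0 : ∀ i : ℕ, circ i a b = 0) : FieldCommute a b := by
  obtain ⟨N, hN⟩ := h
  intro m k
  refine LinearMap.ext fun v => ?_
  have := commutator_eq_sum hN m k v
  rw [Finset.sum_eq_zero fun i _ => by simp [h0]] at this
  exact sub_eq_zero.1 this

theorem CommuteToOrder.circ_eq_zero {a b : QO V} {N : ℕ} (h : CommuteToOrder N a b) {k : ℤ}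
    (hk : N ≤ k) : circ k a b = 0 := by
  lift k to ℕ using by omega
  refine QO_ext fun m => ?_
  rw [← circDist_zero_left, (h.mono (by omega)).circDist_eq_zero, mode_zero]

/-- This and the next identity need no locality: the `i`-th circle product is the `i`-th difference
of the commutator at `0`, here for `i = 0` and `i = 1`. -/
theorem commutator_zero (a b : QO V) (k : ℤ) (v : V) :
    mode a 0 (mode b k v) - mode b k (mode a 0 v) = mode (circ 0 a b) k v := by
  have := mode_circ_natCast_apply 0 a b k v
  simpa using this.symm

theorem commutator_one (a b : QO V) (k : ℤ) (v : V) :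
    mode a 1 (mode b k v) - mode b k (mode a 1 v) =
      mode (circ 0 a b) (k + 1) v + mode (circ 1 a b) k v := by
  have := mode_circ_natCast_apply 1 a b k v
  rw [pow_one, diffOp_apply, Nat.cast_one] at this
  rw [this, ← commutator_zero]
  simp [add_comm k]

end Locality

section Vacuum

variable {V : Type*} [AddCommGroup V] [Module ℂ V]

/-! ### The state of a field -/

/-- The state `a(-1)Ω` of a field `a`. -/
def state (Ω : V) : QO V →ₗ[ℂ] V := (LinearMap.applyₗ Ω).comp (modeLin (-1))

theorem state_apply (Ω : V) (a : QO V) : state Ω a = mode a (-1) Ω := rfl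

/-- Vertex algebras of fields on `V` which are creative with respect to `Ω`, covariant with respect
to `T`, and determined by their states. -/
structure HasStates (S : Submodule ℂ (QO V)) (Ω : V) (T : Module.End ℂ V) : Prop
    extends IsVertexAlgebra S where
  creative : ∀ a ∈ S, ∀ m : ℤ, 0 ≤ m → mode a m Ω = 0
  covariant : ∀ a ∈ S, ∀ (m : ℤ) (v : V), T (mode a m v) - mode a m (T v) = mode (der a) m v
  map_vacuum : T Ω = 0
  eq_zero_of_state : ∀ a ∈ S, state Ω a = 0 → a = 0

/-- The fields which are creative with respect to `Ω`. -/
def creativeFields (Ω : V) : Submodule ℂ (QO V) where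
  carrier := {a | ∀ m : ℤ, 0 ≤ m → mode a m Ω = 0}
  zero_mem' := fun m _ => by simp
  add_mem' := fun {a b} ha hb m hm => by simp [ha m hm, hb m hm]
  smul_mem' := fun r {a} ha m hm => by simp [ha m hm]

theorem isQOA_creativeFields (Ω : V) : IsQOA (creativeFields Ω) where
  one_mem := fun m hm => by rw [mode_one, if_neg (by omega)]; rfl
  circ_mem := fun a ha b hb n m hm => by
    obtain ⟨K, hK⟩ := (mode_circ_eventually n a b m Ω).exists
    rw [hK, Finset.sum_eq_zero, Finset.sum_eq_zero, smul_zero, sub_zero]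
    · intro j _
      rw [ha j (by omega), map_zero, smul_zero]
    · intro j _
      rw [hb _ (by omega), map_zero, smul_zero]

/-- Only the summand `a(n)b(-1)Ω` survives, since all other summands apply a nonnegative mode to the
vacuum. -/
theorem state_circ_of_creative {Ω : V} {a b : QO V} (ha : a ∈ creativeFields Ω)
    (hb : b ∈ creativeFields Ω) (n : ℤ) : state Ω (circ n a b) = mode a n (state Ω b) := by
  rw [state_apply, mode_circ, finsum_eq_single _ 0]
  · simp [ha 0 le_rfl, state_apply]
  · intro j hj
    rw [hb _ (by omega), ha j (by omega)]
    simp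

/-- The fields which are covariant with respect to `T`. -/
def covariantFields (T : Module.End ℂ V) : Submodule ℂ (QO V) where
  carrier := {a | ∀ (m : ℤ) (v : V), T (mode a m v) - mode a m (T v) = mode (der a) m v}
  zero_mem' := fun m v => by simp [mode_der]
  add_mem' := fun {a b} ha hb m v => by
    rw [der_add, mode_add, mode_add, LinearMap.add_apply, LinearMap.add_apply, LinearMap.add_apply,
      ← ha m v, ← hb m v, map_add]
    abel
  smul_mem' := fun r {a} ha m v => by
    rw [der_smul, mode_smul, mode_smul, LinearMap.smul_apply, LinearMap.smul_apply,
      LinearMap.smul_apply, ← ha m v, map_smul, smul_sub]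

theorem isQOA_covariantFields (T : Module.End ℂ V) : IsQOA (covariantFields T) where
  one_mem := fun m v => by
    rw [mode_der, mode_one, mode_one]
    split_ifs with h1 h2
    · omega
    · simp
    · simp [show m = 0 by omega]
    · simp
  circ_mem := fun a ha b hb n m v => by
    obtain ⟨K, h1, h2, h3, h4⟩ := ((mode_circ_eventually n a b m v).and
      ((mode_circ_eventually n a b m (T v)).and ((mode_circ_eventually n (der a) b m v).and
      (mode_circ_eventually n a (der b) m v)))).exists
    rw [der_circ, mode_add, LinearMap.add_apply, h1, h2, h3, h4]
    have ha' : ∀ m v, T (mode a m v) = mode (der a) m v + mode a m (T v) := fun m v => by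
      rw [← ha m v]; abel
    have hb' : ∀ m v, T (mode b m v) = mode (der b) m v + mode b m (T v) := fun m v => by
      rw [← hb m v]; abel
    simp only [map_sub, map_sum, map_zsmul, Units.smul_def, ha', hb', map_add, smul_add,
      Finset.sum_add_distrib]
    abel

/-- If `a` is local with `b` and annihilates `v`, then it annihilates all `b(k)v`. -/
theorem QuantumCommute.mode_mode_eq_zero {a b : QO V} (h : QuantumCommute a b) {v : V}
    (hv : ∀ m, mode a m v = 0) (m k : ℤ) : mode a m (mode b k v) = 0 := by
  obtain ⟨N, hN⟩ := h
  obtain ⟨K, hK⟩ := mode_bdd b v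
  -- Descending induction on `k`: in the locality relation the term `i = 0` is `a(m)b(k)v`. The
  -- other terms contain `b(k+i)v` with `i > 0`, or a mode of `a` applied to `v`.
  have key : ∀ t : ℕ, ∀ k : ℤ, K - t ≤ k → ∀ m, mode a m (mode b k v) = 0 := by
    intro t
    induction t with
    | zero => intro k hk m; rw [hK k (by simpa using hk), map_zero]
    | succ t ih =>
      intro k hk m
      have := LinearMap.congr_fun (hN (m - N) k) v
      simp only [LinearMap.sum_apply, LinearMap.smul_apply, LinearMap.sub_apply,
        Module.End.mul_apply, LinearMap.zero_apply, hv, map_zero, sub_zero] at this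
      rw [Finset.sum_eq_single 0] at this
      · simpa using this
      · intro i _ hi
        rw [ih (k + i) (by push_cast at hk; omega), smul_zero]
      · simp
  exact key (K - k).toNat k (by omega) m

/-- A sufficient criterion for the algebra generated by a set of fields to be determined by
states. -/
theorem hasStates_generatedBy {X : Set (QO V)} {Ω : V} {T : Module.End ℂ V}
    (hloc : ∀ a ∈ X, ∀ b ∈ X, QuantumCommute a b) (hcr : X ⊆ creativeFields Ω)
    (hcov : X ⊆ covariantFields T) (hT : T Ω = 0)
    (hcyc : ∀ P : Submodule ℂ V, Ω ∈ P → (∀ a ∈ X, ∀ m, ∀ v ∈ P, mode a m v ∈ P) → P = ⊤) :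
    HasStates (generatedBy X) Ω T := by
  have hva := isVertexAlgebra_generatedBy hloc
  have hcr' := generatedBy_le (isQOA_creativeFields Ω) hcr
  have hcov' := generatedBy_le (isQOA_covariantFields T) hcov
  refine { hva with
    creative := fun a ha => hcr' ha
    covariant := fun a ha => hcov' ha
    map_vacuum := hT
    eq_zero_of_state := fun a ha h0 => ?_ }
  -- Covariance and `TΩ = 0` give `T(a(-k-1)Ω) = (k+1) a(-k-2)Ω`, so the vanishing of the state
  -- propagates to all creation modes.
  have hneg : ∀ k : ℕ, mode a (-k - 1) Ω = 0 := by
    intro k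
    induction k with
    | zero => simpa [state_apply] using h0
    | succ k ih =>
      have := hcov' ha (-k - 1) Ω
      rw [ih, hT, map_zero, map_zero, sub_zero, mode_der, LinearMap.smul_apply,
        ← Int.cast_smul_eq_zsmul ℂ] at this
      have h2 := (smul_eq_zero.1 this.symm).resolve_left (by
        rw [Int.cast_eq_zero]
        omega)
      rw [← h2]
      congr 2
      push_cast
      ring
  have hall : ∀ m, mode a m Ω = 0 := by
    intro m
    rcases le_or_gt 0 m with hm | hm
    · exact hcr' ha m hm
    · have := hneg (-m - 1).toNat
      rwa [show -(((-m - 1).toNat : ℕ) : ℤ) - 1 = m by omega] at this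
  let P : Submodule ℂ V := ⨅ m, LinearMap.ker (mode a m)
  have hP : P = ⊤ := hcyc P (by simpa [P] using hall) fun b hb k v hv => by
    simp only [P, Submodule.mem_iInf, LinearMap.mem_ker] at hv ⊢
    exact fun m => (hva.quantumCommute a ha b (subset_generatedBy X hb)).mode_mode_eq_zero hv m k
  refine QO_ext fun m => LinearMap.ext fun v => ?_
  have hv : v ∈ P := hP ▸ Submodule.mem_top
  simp only [P, Submodule.mem_iInf, LinearMap.mem_ker] at hv
  rw [hv m, mode_zero, LinearMap.zero_apply]

namespace HasStates

variable {S : Submodule ℂ (QO V)} {Ω : V} {T : Module.End ℂ V} {a b : QO V}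

theorem state_circ (hS : HasStates S Ω T) (ha : a ∈ S) (hb : b ∈ S) (n : ℤ) :
    state Ω (circ n a b) = mode a n (state Ω b) :=
  state_circ_of_creative (hS.creative a ha) (hS.creative b hb) n

theorem state_wick (hS : HasStates S Ω T) (ha : a ∈ S) (hb : b ∈ S) :
    state Ω (wick a b) = mode a (-1) (state Ω b) :=
  hS.state_circ ha hb (-1)

theorem state_der (hS : HasStates S Ω T) (ha : a ∈ S) : state Ω (der a) = T (state Ω a) := by
  rw [state_apply, ← hS.covariant a ha, hS.map_vacuum, map_zero, sub_zero, state_apply]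

theorem ext (hS : HasStates S Ω T) (ha : a ∈ S) (hb : b ∈ S) (h : state Ω a = state Ω b) :
    a = b :=
  sub_eq_zero.1 (hS.eq_zero_of_state _ (S.sub_mem ha hb) (by rw [map_sub, h, sub_self]))

theorem fieldCommute (hS : HasStates S Ω T) (ha : a ∈ S) (hb : b ∈ S)
    (h : ∀ i : ℕ, mode a i (state Ω b) = 0) : FieldCommute a b :=
  (hS.quantumCommute a ha b hb).fieldCommute fun i =>
    hS.eq_zero_of_state _ (hS.circ_mem a ha b hb i) (by rw [hS.state_circ ha hb, h])

theorem mode_state_eq_zero (hS : HasStates S Ω T) (ha : a ∈ S) (h : FieldCommute a b) {k : ℤ}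
    (hk : 0 ≤ k) : mode a k (state Ω b) = 0 := by
  rw [state_apply, h.apply, hS.creative a ha k hk, map_zero]

end HasStates

theorem state_one (Ω : V) : state Ω one = Ω := by
  rw [state_apply, mode_one, if_pos rfl, LinearMap.id_apply]

theorem mode_state_comm {Ω : V} {a b : QO V} (h : FieldCommute a b) :
    mode a (-1) (state Ω b) = mode b (-1) (state Ω a) := by
  rw [state_apply, h.apply, state_apply]

end Vacuum

section Heisenberg

variable {V : Type*} [AddCommGroup V] [Module ℂ V]

/-! ### Products of commuting vertex algebras -/

theorem sum_Ico_neg_natCast {M : Type*} [AddCommMonoid M] (f : ℤ → M) (K : ℕ) :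
    ∑ k ∈ Finset.Ico (-(K : ℤ)) K, f k =
      ∑ i ∈ Finset.range K, f (-1 - i) + ∑ i ∈ Finset.range K, f i := by
  induction K with
  | zero => simp
  | succ K ih =>
    have : Finset.Ico (-((K + 1 : ℕ) : ℤ)) ((K + 1 : ℕ) : ℤ) =
        insert (-1 - (K : ℤ)) (insert (K : ℤ) (Finset.Ico (-(K : ℤ)) K)) := by
      ext x
      simp only [Finset.mem_Ico, Finset.mem_insert]
      push_cast
      omega
    rw [this, Finset.sum_insert, Finset.sum_insert, ih, Finset.sum_range_succ,
      Finset.sum_range_succ]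
    · abel
    · simp
    · simp only [Finset.mem_insert, Finset.mem_Ico]
      omega

/-- For commuting fields the normal ordering is immaterial: the two halves of the Wick product join
into one convolution over all integers. -/
theorem FieldCommute.mode_wick_eventually {h a : QO V} (hc : FieldCommute h a) (n : ℤ) (v : V) :
    ∀ᶠ K : ℕ in atTop, mode (wick h a) n v =
      ∑ k ∈ Finset.Ico (-(K : ℤ)) K, mode h k (mode a (n - k - 1) v) := by
  filter_upwards [mode_circ_eventually (-1) h a n v] with K hK
  rw [wick, hK, sum_Ico_neg_natCast]
  simp only [signedChoose_neg_one, one_smul, Int.negOnePow_neg, Int.negOnePow_one, Units.neg_smul,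
    sub_neg_eq_add]
  congr 1
  · refine Finset.sum_congr rfl fun i _ => ?_
    rw [show n - (-1 - (i : ℤ)) - 1 = n + i by ring]
  · refine Finset.sum_congr rfl fun i _ => ?_
    rw [hc.apply, show n - (i : ℤ) - 1 = n + -1 - i by ring]

section Product

variable {S H A : Submodule ℂ (QO V)} {Ω : V} {T : Module.End ℂ V}

theorem finite_support_wick_circ (hS : HasStates S Ω T) {h h' a a' : QO V} (hh : h ∈ S)
    (hh' : h' ∈ S) (ha : a ∈ S) (ha' : a' ∈ S) (n : ℤ) :
    (Function.support fun k : ℤ => wick (circ k h h') (circ (n - k - 1) a a')).Finite := by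
  obtain ⟨N, hN⟩ := hS.quantumCommute h hh h' hh'
  obtain ⟨N', hN'⟩ := hS.quantumCommute a ha a' ha'
  refine (Set.finite_Ioo (n - 1 - N') (N : ℤ)).subset fun k hk => ?_
  by_contra hcon
  simp only [Set.mem_Ioo, not_and_or, not_lt] at hcon
  apply hk
  rcases hcon with h1 | h1
  · simp [hN'.circ_eq_zero (k := n - k - 1) (by omega), wick]
  · simp [hN.circ_eq_zero h1, wick]

/-- On states, `(:ha:)(n)` is the sum of `h(k) a(n-k-1)`. Modes of fields in `H` and `A` commute, so
each factor can be moved next to the vacuum vector of its own algebra. -/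
theorem circ_wick_wick (hS : HasStates S Ω T) (hH : IsQOA H) (hA : IsQOA A) (hHS : H ≤ S)
    (hAS : A ≤ S) (hc : ∀ h ∈ H, ∀ a ∈ A, FieldCommute h a) {h h' a a' : QO V} (hh : h ∈ H)
    (hh' : h' ∈ H) (ha : a ∈ A) (ha' : a' ∈ A) (n : ℤ) :
    circ n (wick h a) (wick h' a') =
      ∑ᶠ k : ℤ, wick (circ k h h') (circ (n - k - 1) a a') := by
  have hfin := finite_support_wick_circ hS (hHS hh) (hHS hh') (hAS ha) (hAS ha') n
  have hmem : ∀ k : ℤ, wick (circ k h h') (circ (n - k - 1) a a') ∈ S := fun k =>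
    hS.wick_mem (hHS (hH.circ_mem _ hh _ hh' _)) (hAS (hA.circ_mem _ ha _ ha' _))
  obtain ⟨K₀, hK₀⟩ : ∃ K₀ : ℕ, ∀ K ≥ K₀, (Function.support fun k : ℤ =>
      wick (circ k h h') (circ (n - k - 1) a a')) ⊆ Finset.Ico (-(K : ℤ)) K := by
    obtain ⟨u, hu⟩ := hfin.bddAbove
    obtain ⟨l, hl⟩ := hfin.bddBelow
    refine ⟨(u + 1).toNat + (-l).toNat, fun K hK k hk => ?_⟩
    have h1 := hu hk
    have h2 := hl hk
    simp only [Finset.coe_Ico, Set.mem_Ico]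
    omega
  obtain ⟨K, hK, hK'⟩ := (((hc h hh a ha).mode_wick_eventually n (state Ω (wick h' a'))).and
    (eventually_ge_atTop K₀)).exists
  rw [finsum_eq_sum_of_support_subset _ (hK₀ K hK')]
  refine hS.ext (hS.circ_mem _ (hS.wick_mem (hHS hh) (hAS ha)) _
    (hS.wick_mem (hHS hh') (hAS ha')) n) (S.sum_mem fun k _ => hmem k) ?_
  rw [hS.state_circ (hS.wick_mem (hHS hh) (hAS ha)) (hS.wick_mem (hHS hh') (hAS ha')), hK, map_sum]
  refine Finset.sum_congr rfl fun k _ => ?_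
  have m1 := hH.circ_mem _ hh _ hh' k
  have m2 := hA.circ_mem _ ha _ ha' (n - k - 1)
  rw [hS.state_wick (hHS m1) (hAS m2), mode_state_comm (hc _ m1 _ m2),
    hS.state_circ (hHS hh) (hHS hh'), ← (hc _ hh _ m2).apply, state_apply Ω h',
    ← (hc _ hh' _ m2).apply, ← state_apply Ω (circ _ a a'), hS.state_circ (hAS ha) (hAS ha'),
    hS.state_wick (hHS hh') (hAS ha'), (hc _ hh' _ ha).apply]

/-- The span of the products `:ha:`. -/
def wickSpan (H A : Submodule ℂ (QO V)) : Submodule ℂ (QO V) := Submodule.map₂ (circLin (-1)) H A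

theorem wick_mem_wickSpan {h a : QO V} (hh : h ∈ H) (ha : a ∈ A) : wick h a ∈ wickSpan H A :=
  Submodule.apply_mem_map₂ (circLin (-1)) hh ha

theorem isQOA_wickSpan (hS : HasStates S Ω T) (hH : IsQOA H) (hA : IsQOA A) (hHS : H ≤ S)
    (hAS : A ≤ S) (hc : ∀ h ∈ H, ∀ a ∈ A, FieldCommute h a) : IsQOA (wickSpan H A) where
  one_mem := by
    have : wick one one = (one : QO V) := hS.ext (hS.wick_mem hS.one_mem hS.one_mem) hS.one_mem (by
      rw [hS.state_wick hS.one_mem hS.one_mem, state_one, ← state_apply, state_one])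
    rw [← this]
    exact wick_mem_wickSpan hH.one_mem hA.one_mem
  circ_mem := by
    intro x hx y hy n
    suffices h : Submodule.map₂ (circLin n) (wickSpan H A) (wickSpan H A) ≤ wickSpan H A from
      h (Submodule.apply_mem_map₂ (circLin n) hx hy)
    rw [wickSpan, Submodule.map₂_eq_span_image2 (circLin (-1)), Submodule.map₂_span_span,
      Submodule.span_le]
    rintro _ ⟨_, ⟨h, hh, a, ha, rfl⟩, _, ⟨h', hh', a', ha', rfl⟩, rfl⟩
    change circ n (wick h a) (wick h' a') ∈ _
    rw [circ_wick_wick hS hH hA hHS hAS hc hh hh' ha ha',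
      finsum_eq_sum _ (finite_support_wick_circ hS (hHS hh) (hHS hh') (hAS ha) (hAS ha') n),
      ← Submodule.map₂_eq_span_image2]
    exact Submodule.sum_mem _ fun k _ =>
      wick_mem_wickSpan (hH.circ_mem _ hh _ hh' _) (hA.circ_mem _ ha _ ha' _)

end Product

/-! ### Heisenberg fields -/

/-- The span of the vectors `J(-k₁-1)⋯J(-kᵣ-1)Ω` with `r < d`. -/
def heisFiltration (J : QO V) (Ω : V) : ℕ → Submodule ℂ V
  | 0 => ⊥
  | d + 1 => Submodule.span ℂ {Ω} ⊔ ⨆ k : ℕ, (heisFiltration J Ω d).map (mode J (-k - 1))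

section Filtration

variable {J : QO V} {Ω : V} {κ : ℂ}

theorem heisFiltration_induction {d : ℕ} {p : V → Prop} (h0 : ∀ c : ℂ, p (c • Ω))
    (hadd : ∀ x y, p x → p y → p (x + y))
    (hJ : ∀ k : ℕ, ∀ y ∈ heisFiltration J Ω d, p (mode J (-k - 1) y)) {x : V}
    (hx : x ∈ heisFiltration J Ω (d + 1)) : p x := by
  rw [heisFiltration, Submodule.mem_sup] at hx
  obtain ⟨y, hy, z, hz, rfl⟩ := hx
  obtain ⟨c, rfl⟩ := Submodule.mem_span_singleton.1 hy
  refine hadd _ _ (h0 c) ?_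
  induction hz using Submodule.iSup_induction' with
  | mem i z hz =>
    obtain ⟨w, hw, rfl⟩ := hz
    exact hJ i w hw
  | zero => simpa using h0 0
  | add x y _ _ hx hy => exact hadd _ _ hx hy

theorem vacuum_mem_heisFiltration (d : ℕ) : Ω ∈ heisFiltration J Ω (d + 1) :=
  Submodule.mem_sup_left (Submodule.mem_span_singleton_self Ω)

theorem mode_mem_heisFiltration {d : ℕ} {x : V} (hx : x ∈ heisFiltration J Ω d) (k : ℕ) :
    mode J (-k - 1) x ∈ heisFiltration J Ω (d + 1) :=
  Submodule.mem_sup_right (Submodule.mem_iSup_of_mem k (Submodule.mem_map_of_mem hx))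

theorem heisFiltration_mono : Monotone (heisFiltration J Ω) := by
  refine monotone_nat_of_le_succ fun d => ?_
  induction d with
  | zero => exact bot_le
  | succ d ih =>
    intro x hx
    refine heisFiltration_induction (fun c => Submodule.smul_mem _ _ (vacuum_mem_heisFiltration _))
      (fun _ _ => Submodule.add_mem _) (fun k y hy => mode_mem_heisFiltration (ih hy) k) hx

theorem heisFiltration_one : heisFiltration J Ω 1 = Submodule.span ℂ {Ω} := by
  simp [heisFiltration]

theorem IsHeisenberg.commutator (hJ : IsHeisenberg J κ) (m k : ℤ) (v : V) :
    mode J m (mode J k v) =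
      mode J k (mode J m v) + if m + k = 0 then ((m : ℂ) * κ) • v else 0 := by
  obtain ⟨N, hN⟩ := hJ.quantumCommute
  have := commutator_eq_sum (hN.mono (le_max_left N 2)) m k v
  rw [sub_eq_iff_eq_add'] at this
  rw [this]
  congr 1
  rw [Finset.sum_eq_single 1]
  · rw [Nat.cast_one, hJ.circ_one, Ring.choose_one_right, mode_smul, mode_one,
      ← Int.cast_smul_eq_zsmul ℂ]
    by_cases h : m + k = 0
    · rw [if_pos (by omega), if_pos h]
      simp [smul_smul]
    · rw [if_neg (by omega), if_neg h]
      simp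
  · intro i _ hi
    rcases Nat.lt_or_gt_of_ne hi with h | h
    · obtain rfl : i = 0 := by omega
      simp [hJ.circ_zero]
    · simp [hJ.circ_high i (by omega)]
  · intro h
    simp at h

/-- A nonnegative mode kills the vacuum and has scalar commutators with the creation modes, so it
removes a factor. -/
theorem IsHeisenberg.lower (hJ : IsHeisenberg J κ) (hΩ : ∀ k : ℤ, 0 ≤ k → mode J k Ω = 0) {k : ℤ}
    (hk : 0 ≤ k) {d : ℕ} {x : V} (hx : x ∈ heisFiltration J Ω (d + 1)) :
    mode J k x ∈ heisFiltration J Ω d := by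
  induction d generalizing x with
  | zero =>
    rw [heisFiltration_one] at hx
    obtain ⟨c, rfl⟩ := Submodule.mem_span_singleton.1 hx
    rw [map_smul, hΩ k hk, smul_zero]
    exact zero_mem _
  | succ d ih =>
    refine heisFiltration_induction (p := fun x => mode J k x ∈ _) (fun c => ?_)
      (fun x y h1 h2 => by rw [map_add]; exact Submodule.add_mem _ h1 h2) (fun l y hy => ?_) hx
    · rw [map_smul, hΩ k hk, smul_zero]
      exact zero_mem _
    · rw [hJ.commutator]
      refine Submodule.add_mem _ (mode_mem_heisFiltration (ih hy) l) ?_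
      split_ifs
      · exact Submodule.smul_mem _ _ hy
      · exact zero_mem _

/-- The sum of `(kκ)⁻¹ J(-k)J(k)` over `k ≥ 1` counts Heisenberg factors. Level `d+1` of the
filtration consists of products of at most `d` factors, which is why the eigenvalue modulo level `d`
is `d`. -/
theorem IsHeisenberg.number_operator (hJ : IsHeisenberg J κ) (hκ : κ ≠ 0)
    (hΩ : ∀ k : ℤ, 0 ≤ k → mode J k Ω = 0) {d : ℕ} {x : V}
    (hx : x ∈ heisFiltration J Ω (d + 1)) :
    ∀ᶠ K : ℕ in atTop, ∑ k ∈ Finset.range K, (((k : ℂ) + 1) * κ)⁻¹ •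
      mode J (-k - 1) (mode J (k + 1) x) - (d : ℂ) • x ∈ heisFiltration J Ω d := by
  have h0 : ∀ (c : ℂ) (k : ℕ), mode J (k + 1) (c • Ω) = 0 := fun c k => by
    rw [map_smul, hΩ _ (by omega), smul_zero]
  induction d generalizing x with
  | zero =>
    rw [heisFiltration_one] at hx
    obtain ⟨c, rfl⟩ := Submodule.mem_span_singleton.1 hx
    refine Eventually.of_forall fun K => ?_
    simp [h0, zero_mem]
  | succ d ih =>
    refine heisFiltration_induction (p := fun x => ∀ᶠ K : ℕ in atTop,
      ∑ k ∈ Finset.range K, (((k : ℂ) + 1) * κ)⁻¹ •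
      mode J (-k - 1) (mode J (k + 1) x) - ((d + 1 : ℕ) : ℂ) • x ∈ heisFiltration J Ω (d + 1))
      (fun c => ?_) (fun x y h1 h2 => ?_) (fun l y hy => ?_) hx
    · refine Eventually.of_forall fun K => ?_
      simp only [h0, map_zero, smul_zero, Finset.sum_const_zero, zero_sub]
      exact Submodule.neg_mem _ (Submodule.smul_mem _ _ (Submodule.smul_mem _ _
        (vacuum_mem_heisFiltration d)))
    · filter_upwards [h1, h2] with K h1 h2
      have := Submodule.add_mem _ h1 h2
      simp only [map_add, smul_add, Finset.sum_add_distrib]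
      convert this using 1
      abel
    · filter_upwards [ih hy, eventually_gt_atTop l] with K h1 h2
      have := mode_mem_heisFiltration h1 l
      convert this using 1
      rw [map_sub, map_sum, map_smul, Nat.cast_add, Nat.cast_one, add_smul, one_smul,
        sub_add_eq_sub_sub, sub_right_comm]
      congr 1
      have e : ∀ k ∈ Finset.range K, (((k : ℂ) + 1) * κ)⁻¹ •
          mode J (-k - 1) (mode J (k + 1) (mode J (-l - 1) y)) =
          mode J (-l - 1) ((((k : ℂ) + 1) * κ)⁻¹ • mode J (-k - 1) (mode J (k + 1) y)) +
            if k = l then mode J (-l - 1) y else 0 := by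
        intro k _
        rw [hJ.commutator (k + 1), map_add, hJ.commutator (-k - 1), if_neg (by omega), add_zero,
          smul_add, map_smul]
        congr 1
        by_cases hkl : k = l
        · subst hkl
          rw [if_pos (by omega), if_pos rfl, map_smul, smul_smul]
          push_cast
          rw [inv_mul_cancel₀, one_smul]
          exact mul_ne_zero (by exact_mod_cast Nat.succ_ne_zero k) hκ
        · rw [if_neg (by omega), if_neg hkl, map_zero, smul_zero]
      rw [Finset.sum_congr rfl e, Finset.sum_add_distrib, Finset.sum_ite_eq',
        if_pos (by simpa using h2), add_sub_cancel_right]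

/-- The number operator annihilates such a vector, so `d • x` lies one level lower. For `d > 0` one
divides by `d` and descends until only multiples of the vacuum remain. -/
theorem IsHeisenberg.mem_span_vacuum (hJ : IsHeisenberg J κ) (hκ : κ ≠ 0)
    (hΩ : ∀ k : ℤ, 0 ≤ k → mode J k Ω = 0) {d : ℕ} {x : V} (hx : x ∈ heisFiltration J Ω d)
    (h0 : ∀ k : ℤ, 0 ≤ k → mode J k x = 0) : x ∈ Submodule.span ℂ {Ω} := by
  rw [← heisFiltration_one (J := J)]
  induction d with
  | zero => exact heisFiltration_mono (Nat.zero_le 1) hx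
  | succ d ih =>
    rcases Nat.eq_zero_or_pos d with rfl | hd
    · exact hx
    · obtain ⟨K, hK⟩ := (hJ.number_operator hκ hΩ hx).exists
      have e : ∀ k : ℕ, mode J (k + 1) x = 0 := fun k => h0 _ (by omega)
      simp only [e, map_zero, smul_zero, Finset.sum_const_zero, zero_sub] at hK
      have hd' : (d : ℂ) ≠ 0 := by exact_mod_cast hd.ne'
      rw [Submodule.neg_mem_iff, Submodule.smul_mem_iff _ hd'] at hK
      exact ih hK

/-- The fields all of whose modes preserve a subspace. -/
def preservingFields (P : Submodule ℂ V) : Submodule ℂ (QO V) where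
  carrier := {a | ∀ m, ∀ x ∈ P, mode a m x ∈ P}
  zero_mem' := fun m x _ => by simp
  add_mem' := fun {a b} ha hb m x hx => by
    simpa using P.add_mem (ha m x hx) (hb m x hx)
  smul_mem' := fun r {a} ha m x hx => by
    simpa using P.smul_mem r (ha m x hx)

theorem isQOA_preservingFields (P : Submodule ℂ V) : IsQOA (preservingFields P) where
  one_mem := fun m x hx => by
    rw [mode_one]
    split_ifs
    · exact hx
    · exact P.zero_mem
  circ_mem := fun a ha b hb n m x hx => by
    obtain ⟨K, hK⟩ := (mode_circ_eventually n a b m x).exists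
    rw [hK, Units.smul_def]
    exact P.sub_mem (P.sum_mem fun j _ => zsmul_mem (ha _ _ (hb _ _ hx)) _)
      (zsmul_mem (P.sum_mem fun j _ => zsmul_mem (hb _ _ (ha _ _ hx)) _) _)

/-- The union of the filtration is stable under the modes of `J`, hence under those of every field
generated by `J`. -/
theorem IsHeisenberg.state_mem_heisFiltration (hJ : IsHeisenberg J κ)
    (hΩ : ∀ k : ℤ, 0 ≤ k → mode J k Ω = 0) {h : QO V} (hh : h ∈ generatedBy {J}) :
    ∃ d, state Ω h ∈ heisFiltration J Ω d := by
  have hdir : Directed (· ≤ ·) (heisFiltration J Ω) := heisFiltration_mono.directed_le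
  have hJ' : {J} ⊆ (preservingFields (⨆ d, heisFiltration J Ω d) : Set (QO V)) := by
    rintro _ rfl m x hx
    rw [Submodule.mem_iSup_of_directed _ hdir] at hx ⊢
    obtain ⟨d, hd⟩ := hx
    rcases le_or_gt 0 m with hm | hm
    · exact ⟨d, hJ.lower hΩ hm (heisFiltration_mono (Nat.le_succ d) hd)⟩
    · have := mode_mem_heisFiltration hd (-m - 1).toNat
      rw [show -(((-m - 1).toNat : ℕ) : ℤ) - 1 = m by omega] at this
      exact ⟨d + 1, this⟩
  have h1 := generatedBy_le (isQOA_preservingFields _) hJ' hh (-1) Ω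
    (Submodule.mem_iSup_of_mem 1 (vacuum_mem_heisFiltration 0))
  rwa [Submodule.mem_iSup_of_directed _ hdir] at h1

/-- Freeness: vectors of the Heisenberg vacuum module multiplied by linearly independent fields
which commute with `J` do not cancel. -/
theorem IsHeisenberg.eq_zero_of_sum_eq_zero (hJ : IsHeisenberg J κ) (hκ : κ ≠ 0)
    (hΩ : ∀ k : ℤ, 0 ≤ k → mode J k Ω = 0) {ι : Type*} (s : Finset ι) (b : ι → QO V)
    (hb : ∀ i ∈ s, FieldCommute J (b i))
    (hli : ∀ c : ι → ℂ, ∑ i ∈ s, c i • state Ω (b i) = 0 → ∀ i ∈ s, c i = 0) (d : ℕ) (x : ι → V)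
    (hx : ∀ i ∈ s, x i ∈ heisFiltration J Ω d) (h0 : ∑ i ∈ s, mode (b i) (-1) (x i) = 0) :
    ∀ i ∈ s, x i = 0 := by
  induction d generalizing x with
  | zero => exact fun i hi => by simpa [heisFiltration] using hx i hi
  | succ d ih =>
    -- `J(k)` passes through the fields `b i` and turns the relation into one of lower degree. By
    -- induction every `x i` is then killed by all `J(k)`, hence is a multiple of the vacuum, and
    -- linear independence applies.
    have h1 : ∀ k : ℤ, 0 ≤ k → ∀ i ∈ s, mode J k (x i) = 0 := by
      intro k hk
      refine ih (fun i => mode J k (x i)) (fun i hi => hJ.lower hΩ hk (hx i hi)) ?_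
      rw [← map_zero (mode J k), ← h0, map_sum]
      exact Finset.sum_congr rfl fun i hi => ((hb i hi).apply _ _ _).symm
    have h2 : ∀ i, ∃ c : ℂ, i ∈ s → x i = c • Ω := by
      intro i
      by_cases hi : i ∈ s
      · obtain ⟨c, hc⟩ := Submodule.mem_span_singleton.1
          (hJ.mem_span_vacuum hκ hΩ (hx i hi) fun k hk => h1 k hk i hi)
        exact ⟨c, fun _ => hc.symm⟩
      · exact ⟨0, fun h => absurd h hi⟩
    choose c hc using h2
    have h3 := hli c (by
      rw [← h0]
      refine Finset.sum_congr rfl fun i hi => ?_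
      rw [hc i hi, map_smul, state_apply])
    intro i hi
    rw [hc i hi, h3 i hi, zero_smul]

end Filtration

/-! ### The tensor factorization by a Heisenberg algebra and its commutant -/

section Tensor

variable {S : Submodule ℂ (QO V)} {Ω : V} {T : Module.End ℂ V} {J : QO V} {κ : ℂ} {X : Set (QO V)}

/-- The span of the products `:ha:` is closed under circle products and contains the generators in
the form `:J1:` and `:1x:`. -/
theorem generatedBy_insert_eq_wickSpan (hS : HasStates S Ω T) (hJS : J ∈ S) (hX : X ⊆ S)
    (hc : ∀ x ∈ X, FieldCommute J x) :
    generatedBy (insert J X) = wickSpan (generatedBy {J}) (generatedBy X) := by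
  have hHS : generatedBy {J} ≤ S := generatedBy_le hS.toIsQOA (by simpa using hJS)
  have hBS : generatedBy X ≤ S := generatedBy_le hS.toIsQOA hX
  have hc' : ∀ h ∈ generatedBy {J}, ∀ a ∈ generatedBy X, FieldCommute h a := fun h hh a ha =>
    fieldCommute_generatedBy_generatedBy (by simpa using hc) hh ha
  have hH := isQOA_generatedBy {J}
  have hB := isQOA_generatedBy X
  have hU := isQOA_generatedBy (insert J X)
  apply le_antisymm
  · refine generatedBy_le (isQOA_wickSpan hS hH hB hHS hBS hc') ?_
    rintro x (rfl | hx)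
    · have h1 := wick_mem_wickSpan (subset_generatedBy {x} rfl) hB.one_mem
      rwa [show wick x one = x from hS.ext (hS.wick_mem hJS hS.one_mem) hJS (by
        rw [hS.state_wick hJS hS.one_mem, state_one, state_apply])] at h1
    · have : wick one x = x := hS.ext (hS.wick_mem hS.one_mem (hX hx)) (hX hx) (by
        rw [hS.state_wick hS.one_mem (hX hx), mode_one, if_pos rfl, LinearMap.id_apply])
      exact this ▸ wick_mem_wickSpan hH.one_mem (subset_generatedBy X hx)
  · refine Submodule.map₂_le.2 fun h hh a ha => ?_
    exact hU.wick_mem (generatedBy_mono (by simp) hh) (generatedBy_mono (by simp) ha)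

/-- Tensors in `H ⊗ B` expanded along a basis of `B`. -/
theorem exists_sum_tmul (H B : Submodule ℂ (QO V)) :
    ∃ (I : Set B) (_ : LinearIndependent ℂ (fun i : I => (i : B)))
      (e : TensorProduct ℂ H B ≃ₗ[ℂ] (I →₀ H)),
      ∀ (t : TensorProduct ℂ H B) (s : Finset I), (e t).support ⊆ s →
        t = ∑ i ∈ s, TensorProduct.tmul ℂ (e t i) (i : B) := by
  classical
  let b := Module.Basis.ofVectorSpace ℂ B
  refine ⟨Module.Basis.ofVectorSpaceIndex ℂ B, Module.Basis.ofVectorSpaceIndex.linearIndependent ℂ B,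
    TensorProduct.equivFinsuppOfBasisRight (M := H) b, fun t s hs => ?_⟩
  have := (TensorProduct.equivFinsuppOfBasisRight (M := H) b).symm_apply_apply t
  rw [TensorProduct.equivFinsuppOfBasisRight_symm_apply,
    Finsupp.sum_of_support_subset _ hs (fun i m => TensorProduct.tmul ℂ m (b i))
      (fun i _ => TensorProduct.zero_tmul _ _)] at this
  simpa only [b, Module.Basis.ofVectorSpace_apply_self] using this.symm

theorem state_linearIndependent (hS : HasStates S Ω T) {B : Submodule ℂ (QO V)} (hBS : B ≤ S)
    {ι : Type*} {b : ι → B} (hb : LinearIndependent ℂ b) (s : Finset ι) (c : ι → ℂ)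
    (h : ∑ i ∈ s, c i • state Ω (b i : QO V) = 0) : ∀ i ∈ s, c i = 0 := by
  have h1 : state Ω ((∑ i ∈ s, c i • b i : B) : QO V) = 0 := by
    rw [← h, AddSubmonoidClass.coe_finsetSum, map_sum]
    exact Finset.sum_congr rfl fun i _ => by rw [Submodule.coe_smul, map_smul]
  have h2 : ∑ i ∈ s, c i • b i = ∑ i ∈ s, (0 : ι → ℂ) i • b i := by
    simp only [Pi.zero_apply, zero_smul, Finset.sum_const_zero]
    exact Subtype.ext (hS.eq_zero_of_state _ (hBS (Subtype.mem _)) h1)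
  exact linearIndependent_iff'ₛ.1 hb s c 0 h2

theorem IsHeisenberg.wick_tensor_injective (hS : HasStates S Ω T) (hJ : IsHeisenberg J κ)
    (hκ : κ ≠ 0) (hJS : J ∈ S) {B : Submodule ℂ (QO V)} (hBS : B ≤ S)
    (hc : ∀ b ∈ B, FieldCommute J b) {ι : Type*} {b : ι → B} (hb : LinearIndependent ℂ b)
    (s : Finset ι) (h : ι → generatedBy {J})
    (h0 : ∑ i ∈ s, wick (h i : QO V) (b i : QO V) = 0) : ∀ i ∈ s, h i = 0 := by
  have hHS : generatedBy {J} ≤ S := generatedBy_le hS.toIsQOA (by simpa using hJS)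
  have hΩ := hS.creative J hJS
  choose d hd using fun i => hJ.state_mem_heisFiltration hΩ (h i).2
  have := hJ.eq_zero_of_sum_eq_zero hκ hΩ s (fun i => (b i : QO V)) (fun i _ => hc _ (b i).2)
    (state_linearIndependent hS hBS hb s) (s.sup d) (fun i => state Ω (h i : QO V))
    (fun i hi => heisFiltration_mono (Finset.le_sup hi) (hd i)) (by
      rw [← map_zero (state Ω), ← h0, map_sum]
      refine Finset.sum_congr rfl fun i _ => ?_
      rw [hS.state_wick (hHS (h i).2) (hBS (b i).2), mode_state_comm]
      exact fieldCommute_generatedBy (by simpa using (hc _ (b i).2).symm) (h i).2)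
  exact fun i hi => Subtype.ext (hS.eq_zero_of_state _ (hHS (h i).2) (this i hi))

/-- The linear map `h ⊗ a ↦ :ha:`. -/
def wickTensor (H B : Submodule ℂ (QO V)) : TensorProduct ℂ H B →ₗ[ℂ] QO V :=
  TensorProduct.lift ((circLin (-1)).domRestrict₁₂ H B)

theorem wickTensor_tmul {H B : Submodule ℂ (QO V)} (h : H) (b : B) :
    wickTensor H B (TensorProduct.tmul ℂ h b) = wick (h : QO V) (b : QO V) := rfl

theorem range_wickTensor (H B : Submodule ℂ (QO V)) :
    LinearMap.range (wickTensor H B) = wickSpan H B := by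
  apply le_antisymm
  · rintro _ ⟨t, rfl⟩
    induction t with
    | zero => simp
    | tmul h b => exact wick_mem_wickSpan h.2 b.2
    | add x y hx hy => rw [map_add]; exact Submodule.add_mem _ hx hy
  · exact Submodule.map₂_le.2 fun h hh b hb => ⟨TensorProduct.tmul ℂ ⟨h, hh⟩ ⟨b, hb⟩, rfl⟩

/-- A vertex algebra generated by a nondegenerate Heisenberg field and fields commuting with it is a
tensor product. -/
theorem IsHeisenberg.isTensorDecomposition (hS : HasStates S Ω T) (hJ : IsHeisenberg J κ)
    (hκ : κ ≠ 0) (hJS : J ∈ S) (hX : X ⊆ S) (hc : ∀ x ∈ X, FieldCommute J x) :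
    IsTensorDecomposition (generatedBy (insert J X)) (generatedBy {J}) (generatedBy X) := by
  have hHS : generatedBy {J} ≤ S := generatedBy_le hS.toIsQOA (by simpa using hJS)
  have hBS : generatedBy X ≤ S := generatedBy_le hS.toIsQOA hX
  have hc' : ∀ h ∈ generatedBy {J}, ∀ a ∈ generatedBy X, FieldCommute h a := fun h hh a ha =>
    fieldCommute_generatedBy_generatedBy (by simpa using hc) hh ha
  have hH := isQOA_generatedBy {J}
  have hB := isQOA_generatedBy X
  have hU := generatedBy_insert_eq_wickSpan hS hJS hX hc
  refine
    { left := { hH with quantumCommute := fun a ha b hb => hS.quantumCommute a (hHS ha) b (hHS hb) }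
      right := { hB with quantumCommute := fun a ha b hb => hS.quantumCommute a (hBS ha) b (hBS hb) }
      commute := hc'
      equiv := ?_
      finite := fun h hh h' hh' a ha a' ha' n =>
        finite_support_wick_circ hS (hHS hh) (hHS hh') (hBS ha) (hBS ha') n
      circ_wick := fun h hh h' hh' a ha a' ha' n =>
        circ_wick_wick hS hH hB hHS hBS hc' hh hh' ha ha' n }
  have hinj : Function.Injective (wickTensor (generatedBy {J}) (generatedBy X)) := by
    intro t t' ht
    classical
    obtain ⟨I, hb, e, he⟩ := exists_sum_tmul (generatedBy {J}) (generatedBy X)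
    obtain ⟨s, hs, hs'⟩ : ∃ s, (e t).support ⊆ s ∧ (e t').support ⊆ s :=
      ⟨_, Finset.subset_union_left, Finset.subset_union_right⟩
    rw [he t s hs, he t' s hs', map_sum, map_sum] at ht
    replace ht := sub_eq_zero.2 ht
    rw [← Finset.sum_sub_distrib] at ht
    have h1 := hJ.wick_tensor_injective hS hκ hJS hBS
      (fun b hb => hc' J (subset_generatedBy _ rfl) b hb) hb s (fun i => e t i - e t' i) (by
        rw [← ht]
        refine Finset.sum_congr rfl fun i _ => ?_
        rw [wickTensor_tmul, wickTensor_tmul, AddSubgroupClass.coe_sub]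
        exact LinearMap.map_sub₂ (circLin (-1)) _ _ _)
    rw [he t s hs, he t' s hs']
    refine Finset.sum_congr rfl fun i hi => ?_
    rw [show e t i = e t' i from
      Subtype.ext (sub_eq_zero.1 (congrArg Subtype.val (h1 i hi)))]
  refine ⟨(LinearEquiv.ofInjective _ hinj).trans (LinearEquiv.ofEq _ _ ?_), fun h a => rfl⟩
  rw [range_wickTensor, hU]

/-- The commutant of the Heisenberg algebra in the tensor product is the other factor. -/
theorem IsHeisenberg.commutant_eq (hS : HasStates S Ω T) (hJ : IsHeisenberg J κ)
    (hκ : κ ≠ 0) (hJS : J ∈ S) (hX : X ⊆ S) (hc : ∀ x ∈ X, FieldCommute J x) :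
    commutant (generatedBy {J}) (generatedBy (insert J X)) = generatedBy X := by
  have hHS : generatedBy {J} ≤ S := generatedBy_le hS.toIsQOA (by simpa using hJS)
  have hBS : generatedBy X ≤ S := generatedBy_le hS.toIsQOA hX
  have hc' : ∀ h ∈ generatedBy {J}, ∀ a ∈ generatedBy X, FieldCommute h a := fun h hh a ha =>
    fieldCommute_generatedBy_generatedBy (by simpa using hc) hh ha
  have hJmem : J ∈ generatedBy {J} := subset_generatedBy _ rfl
  have hΩ := hS.creative J hJS
  apply le_antisymm
  · rintro a ⟨haU, hcomm⟩
    rw [generatedBy_insert_eq_wickSpan hS hJS hX hc, ← range_wickTensor] at haU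
    obtain ⟨t, rfl⟩ := haU
    obtain ⟨I, hb, e, he⟩ := exists_sum_tmul (generatedBy {J}) (generatedBy X)
    obtain ⟨s, h, rfl⟩ : ∃ (s : Finset I) (h : I → generatedBy {J}),
        t = ∑ i ∈ s, TensorProduct.tmul ℂ (h i) (i : generatedBy X) := ⟨_, _, he t _ subset_rfl⟩
    rw [map_sum] at hcomm ⊢
    have hst : state Ω (∑ i ∈ s, wickTensor (generatedBy {J}) (generatedBy X)
        (TensorProduct.tmul ℂ (h i) (i : generatedBy X))) =
        ∑ i ∈ s, mode ((i : generatedBy X) : QO V) (-1) (state Ω (h i : QO V)) := by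
      rw [map_sum]
      refine Finset.sum_congr rfl fun i _ => ?_
      rw [wickTensor_tmul, hS.state_wick (hHS (h i).2) (hBS (i : generatedBy X).2), mode_state_comm]
      exact hc' _ (h i).2 _ (i : generatedBy X).2
    choose d hd using fun i => hJ.state_mem_heisFiltration hΩ (h i).2
    have hd' : ∀ i ∈ s, state Ω (h i : QO V) ∈ heisFiltration J Ω (s.sup d + 1) := fun i hi =>
      heisFiltration_mono ((Finset.le_sup hi).trans (Nat.le_succ _)) (hd i)
    -- A field commuting with `J` has a state killed by `J(k)`. Since `J(k)` acts on the Heisenberg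
    -- coefficients alone, freeness shows that it kills each of them, so each coefficient is a
    -- multiple of the vacuum.
    have h1 : ∀ k : ℤ, 0 ≤ k → ∀ i ∈ s, mode J k (state Ω (h i : QO V)) = 0 := by
      intro k hk
      refine hJ.eq_zero_of_sum_eq_zero hκ hΩ s (fun i : I => ((i : generatedBy X) : QO V))
        (fun i _ => hc' J hJmem _ (i : generatedBy X).2) (state_linearIndependent hS hBS hb s) (s.sup d)
        (fun i => mode J k (state Ω (h i : QO V))) (fun i hi => hJ.lower hΩ hk (hd' i hi)) ?_
      have := hS.mode_state_eq_zero hJS (hcomm J hJmem).symm hk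
      rw [hst, map_sum] at this
      rw [← this]
      exact Finset.sum_congr rfl fun i _ => ((hc' J hJmem _ (i : generatedBy X).2).apply _ _ _).symm
    refine Submodule.sum_mem _ fun i hi => ?_
    obtain ⟨c, hcΩ⟩ := Submodule.mem_span_singleton.1
      (hJ.mem_span_vacuum hκ hΩ (hd' i hi) fun k hk => h1 k hk i hi)
    have : wickTensor (generatedBy {J}) (generatedBy X) (TensorProduct.tmul ℂ (h i) (i : generatedBy X)) =
        c • ((i : generatedBy X) : QO V) := by
      have m1 := hS.wick_mem (hHS (h i).2) (hBS (i : generatedBy X).2)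
      refine hS.ext m1 (S.smul_mem _ (hBS (i : generatedBy X).2)) ?_
      rw [wickTensor_tmul, hS.state_wick (hHS (h i).2) (hBS (i : generatedBy X).2),
        mode_state_comm (hc' _ (h i).2 _ (i : generatedBy X).2), ← hcΩ, map_smul, map_smul, state_apply]
    rw [this]
    exact Submodule.smul_mem _ _ (i : generatedBy X).2
  · exact fun b hb => ⟨generatedBy_mono (by simp) hb, fun h hh => (hc' h hh b hb).symm⟩

end Tensor

end Heisenberg

open MvPolynomial

/-! ### The `βγ`-system -/

section BetaGamma

variable {n : ℕ}

theorem mode_freeField {σ : Type} (x y : ℕ → σ) (hy : Function.Injective y) (ε : ℂ) (m : ℤ) :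
    mode (freeField x y hy ε) m =
      if m < 0 then LinearMap.mulLeft ℂ (X (x (-m - 1).toNat))
      else ε • (pderiv (R := ℂ) (y m.toNat)).toLinearMap :=
  mode_ofModes _ _ m

theorem mode_beta (i : Fin n) (m : ℤ) :
    mode (beta n i) m =
      if m < 0 then LinearMap.mulLeft ℂ (X (Sum.inl (i, (-m - 1).toNat)))
      else (1 : ℂ) • (pderiv (R := ℂ) (Sum.inr (i, m.toNat))).toLinearMap :=
  mode_freeField _ _ _ _ m

theorem mode_gamma (i : Fin n) (m : ℤ) :
    mode (gamma n i) m =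
      if m < 0 then LinearMap.mulLeft ℂ (X (Sum.inr (i, (-m - 1).toNat)))
      else (-1 : ℂ) • (pderiv (R := ℂ) (Sum.inl (i, m.toNat))).toLinearMap :=
  mode_freeField _ _ _ _ m

theorem beta_neg (i : Fin n) (k : ℕ) (v : Fock n) :
    mode (beta n i) (-k - 1) v = X (Sum.inl (i, k)) * v := by
  have : (-(-(k : ℤ) - 1) - 1).toNat = k := by omega
  rw [mode_beta, if_pos (by omega), this, LinearMap.mulLeft_apply]

theorem beta_natCast (i : Fin n) (k : ℕ) (v : Fock n) :
    mode (beta n i) k v = pderiv (Sum.inr (i, k)) v := by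
  rw [mode_beta, if_neg (by omega), Int.toNat_natCast, one_smul]
  rfl

theorem gamma_neg (i : Fin n) (k : ℕ) (v : Fock n) :
    mode (gamma n i) (-k - 1) v = X (Sum.inr (i, k)) * v := by
  have : (-(-(k : ℤ) - 1) - 1).toNat = k := by omega
  rw [mode_gamma, if_pos (by omega), this, LinearMap.mulLeft_apply]

theorem gamma_natCast (i : Fin n) (k : ℕ) (v : Fock n) :
    mode (gamma n i) k v = -pderiv (Sum.inl (i, k)) v := by
  rw [mode_gamma, if_neg (by omega), Int.toNat_natCast, LinearMap.smul_apply, neg_one_smul]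
  rfl

theorem pderiv_comm {σ : Type*} (i j : σ) (v : MvPolynomial σ ℂ) :
    pderiv i (pderiv j v) = pderiv j (pderiv i v) := by
  classical
  have : ⁅pderiv (R := ℂ) i, pderiv (R := ℂ) j⁆ = 0 := by
    refine derivation_ext fun k => ?_
    rw [Derivation.commutator_apply, pderiv_X, pderiv_X, Derivation.coe_zero, Pi.zero_apply]
    simp only [Pi.single_apply]
    split_ifs <;> simp
  have h := DFunLike.congr_fun this v
  rwa [Derivation.commutator_apply, Derivation.coe_zero, Pi.zero_apply, sub_eq_zero] at h

theorem int_cases (m : ℤ) : (∃ k : ℕ, m = k) ∨ ∃ k : ℕ, m = -k - 1 := by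
  rcases le_or_gt 0 m with h | h
  · exact Or.inl ⟨m.toNat, by omega⟩
  · exact Or.inr ⟨(-m - 1).toNat, by omega⟩

theorem beta_beta_comm (i k : Fin n) (m l : ℤ) (v : Fock n) :
    mode (beta n i) m (mode (beta n k) l v) = mode (beta n k) l (mode (beta n i) m v) := by
  rcases int_cases m with ⟨a, rfl⟩ | ⟨a, rfl⟩ <;> rcases int_cases l with ⟨b, rfl⟩ | ⟨b, rfl⟩ <;>
    simp only [beta_neg, beta_natCast]
  · exact pderiv_comm _ _ _
  · rw [pderiv_mul, pderiv_X_of_ne (by simp), zero_mul, zero_add]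
  · rw [pderiv_mul, pderiv_X_of_ne (by simp), zero_mul, zero_add]
  · exact mul_left_comm _ _ _

theorem gamma_gamma_comm (i k : Fin n) (m l : ℤ) (v : Fock n) :
    mode (gamma n i) m (mode (gamma n k) l v) = mode (gamma n k) l (mode (gamma n i) m v) := by
  rcases int_cases m with ⟨a, rfl⟩ | ⟨a, rfl⟩ <;> rcases int_cases l with ⟨b, rfl⟩ | ⟨b, rfl⟩ <;>
    simp only [gamma_neg, gamma_natCast]
  · simp only [map_neg, pderiv_comm]
  · rw [pderiv_mul, pderiv_X_of_ne (by simp), zero_mul, zero_add, mul_neg]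
  · rw [pderiv_mul, pderiv_X_of_ne (by simp), zero_mul, zero_add, mul_neg]
  · exact mul_left_comm _ _ _

/-- The canonical commutation relations. -/
theorem beta_gamma_comm (i k : Fin n) (m l : ℤ) (v : Fock n) :
    mode (beta n i) m (mode (gamma n k) l v) =
      mode (gamma n k) l (mode (beta n i) m v) + if i = k ∧ m + l = -1 then v else 0 := by
  rcases int_cases m with ⟨a, rfl⟩ | ⟨a, rfl⟩ <;> rcases int_cases l with ⟨b, rfl⟩ | ⟨b, rfl⟩ <;>
    simp only [beta_neg, beta_natCast, gamma_neg, gamma_natCast]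
  · rw [if_neg (by omega), add_zero, map_neg, pderiv_comm]
  · rw [pderiv_mul, pderiv_X, Pi.single_apply]
    by_cases h : i = k ∧ a = b
    · obtain ⟨rfl, rfl⟩ := h
      rw [if_pos rfl, if_pos ⟨rfl, by ring⟩]
      ring
    · rw [if_neg (fun h' => h (by simpa [eq_comm] using h')), if_neg (fun h' => h ⟨h'.1, by omega⟩)]
      ring
  · rw [pderiv_mul, pderiv_X, Pi.single_apply]
    by_cases h : i = k ∧ a = b
    · obtain ⟨rfl, rfl⟩ := h
      rw [if_pos rfl, if_pos ⟨rfl, by ring⟩]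
      ring
    · rw [if_neg (fun h' => h (by simpa [eq_comm] using h')), if_neg (fun h' => h ⟨h'.1, by omega⟩)]
      ring
  · rw [if_neg (by omega), add_zero, mul_left_comm]

/-- The translation operator `∂` of the Fock space. -/
def transl (n : ℕ) : Derivation ℂ (Fock n) (Fock n) :=
  mkDerivation ℂ (Sum.elim (fun p => ((p.2 : ℂ) + 1) • X (Sum.inl (p.1, p.2 + 1)))
    (fun p => ((p.2 : ℂ) + 1) • X (Sum.inr (p.1, p.2 + 1))))

theorem transl_X_inl (i : Fin n) (k : ℕ) :
    transl n (X (Sum.inl (i, k))) = ((k : ℂ) + 1) • X (Sum.inl (i, k + 1)) := by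
  simp [transl]

theorem transl_X_inr (i : Fin n) (k : ℕ) :
    transl n (X (Sum.inr (i, k))) = ((k : ℂ) + 1) • X (Sum.inr (i, k + 1)) := by
  simp [transl]

theorem transl_mul (v w : Fock n) : transl n (v * w) = transl n v * w + v * transl n w := by
  rw [Derivation.leibniz, smul_eq_mul, smul_eq_mul, mul_comm w, add_comm]

/-- Both sides are derivations, so comparison on the variables suffices. For `k = 0` the truncated
index `k - 1` is harmless because its coefficient vanishes. -/
theorem transl_pderiv_inl (i : Fin n) (k : ℕ) (v : Fock n) :
    transl n (pderiv (Sum.inl (i, k)) v) - pderiv (Sum.inl (i, k)) (transl n v) =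
      (-(k : ℂ)) • pderiv (Sum.inl (i, k - 1)) v := by
  have : ⁅transl n, (pderiv (Sum.inl (i, k)) : Derivation ℂ (Fock n) (Fock n))⁆ =
      (-(k : ℂ)) • pderiv (R := ℂ) (Sum.inl (i, k - 1)) := by
    refine derivation_ext fun x => ?_
    rw [Derivation.commutator_apply, Derivation.smul_apply, pderiv_X, pderiv_X]
    rcases x with ⟨a, b⟩ | ⟨a, b⟩
    · rw [transl_X_inl, Derivation.map_smul, pderiv_X]
      simp only [Pi.single_apply, Sum.inl.injEq, Prod.mk.injEq]
      cases k with
      | zero => split_ifs <;> simp_all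
      | succ k => split_ifs <;> (simp_all; try module)
    · rw [transl_X_inr, Derivation.map_smul, pderiv_X]
      simp
  have h := DFunLike.congr_fun this v
  rwa [Derivation.commutator_apply, Derivation.smul_apply] at h

theorem transl_pderiv_inr (i : Fin n) (k : ℕ) (v : Fock n) :
    transl n (pderiv (Sum.inr (i, k)) v) - pderiv (Sum.inr (i, k)) (transl n v) =
      (-(k : ℂ)) • pderiv (Sum.inr (i, k - 1)) v := by
  have : ⁅transl n, (pderiv (Sum.inr (i, k)) : Derivation ℂ (Fock n) (Fock n))⁆ =
      (-(k : ℂ)) • pderiv (R := ℂ) (Sum.inr (i, k - 1)) := by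
    refine derivation_ext fun x => ?_
    rw [Derivation.commutator_apply, Derivation.smul_apply, pderiv_X, pderiv_X]
    rcases x with ⟨a, b⟩ | ⟨a, b⟩
    · rw [transl_X_inl, Derivation.map_smul, pderiv_X]
      simp
    · rw [transl_X_inr, Derivation.map_smul, pderiv_X]
      simp only [Pi.single_apply, Sum.inr.injEq, Prod.mk.injEq]
      cases k with
      | zero => split_ifs <;> simp_all
      | succ k => split_ifs <;> (simp_all; try module)
  have h := DFunLike.congr_fun this v
  rwa [Derivation.commutator_apply, Derivation.smul_apply] at h

theorem zsmul_mode_eq_smul {V : Type*} [AddCommGroup V] [Module ℂ V] (z : ℤ) (a : QO V) (m : ℤ)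
    (v : V) : (z • mode a m) v = (z : ℂ) • mode a m v := by
  rw [LinearMap.smul_apply, Int.cast_smul_eq_zsmul]

theorem beta_covariant (i : Fin n) :
    beta n i ∈ covariantFields (transl n : Module.End ℂ (Fock n)) := by
  intro m v
  rw [mode_der, zsmul_mode_eq_smul]
  simp only [Derivation.coeFn_coe]
  rcases int_cases m with ⟨a, rfl⟩ | ⟨a, rfl⟩
  · rw [beta_natCast, beta_natCast, transl_pderiv_inr]
    cases a with
    | zero => simp
    | succ a =>
      rw [show ((a + 1 : ℕ) : ℤ) - 1 = (a : ℕ) by push_cast; ring, beta_natCast]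
      simp
  · rw [beta_neg, beta_neg, transl_mul, transl_X_inl, add_sub_cancel_right,
      show -(a : ℤ) - 1 - 1 = -(a + 1 : ℕ) - 1 by push_cast; ring, beta_neg, smul_mul_assoc]
    congr 1
    push_cast
    ring

theorem gamma_covariant (i : Fin n) :
    gamma n i ∈ covariantFields (transl n : Module.End ℂ (Fock n)) := by
  intro m v
  rw [mode_der, zsmul_mode_eq_smul]
  simp only [Derivation.coeFn_coe]
  rcases int_cases m with ⟨a, rfl⟩ | ⟨a, rfl⟩
  · rw [gamma_natCast, gamma_natCast, map_neg, neg_sub_neg, ← neg_sub, transl_pderiv_inl]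
    cases a with
    | zero => simp
    | succ a =>
      rw [show ((a + 1 : ℕ) : ℤ) - 1 = (a : ℕ) by push_cast; ring, gamma_natCast]
      simp
  · rw [gamma_neg, gamma_neg, transl_mul, transl_X_inr, add_sub_cancel_right,
      show -(a : ℤ) - 1 - 1 = -(a + 1 : ℕ) - 1 by push_cast; ring, gamma_neg, smul_mul_assoc]
    congr 1
    push_cast
    ring

/-- The `βγ`-system as a vertex algebra. -/
def betaGamma (n : ℕ) : Submodule ℂ (QO (Fock n)) :=
  generatedBy (Set.range (beta n) ∪ Set.range (gamma n))

theorem beta_mem (i : Fin n) : beta n i ∈ betaGamma n :=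
  subset_generatedBy _ (Or.inl ⟨i, rfl⟩)

theorem gamma_mem (i : Fin n) : gamma n i ∈ betaGamma n :=
  subset_generatedBy _ (Or.inr ⟨i, rfl⟩)

/-- The commutator of modes depends only on the sum of the indices, so the two terms of the first
difference cancel. -/
theorem beta_gamma_local (i k : Fin n) : QuantumCommute (beta n i) (gamma n k) := by
  refine ⟨1, fun m l => LinearMap.ext fun v => ?_⟩
  simp only [Finset.sum_range_succ, Finset.sum_range_zero]
  simp only [LinearMap.add_apply, LinearMap.smul_apply, LinearMap.sub_apply, Module.End.mul_apply,
    LinearMap.zero_apply, beta_gamma_comm, add_sub_cancel_left]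
  simp only [Nat.cast_zero, Nat.cast_one, sub_zero, add_zero, add_sub_cancel_right, zero_add]
  rw [show m + (l + 1) = m + 1 + l by ring]
  split_ifs <;> simp

theorem fock_cyclic (P : Submodule ℂ (Fock n)) (h1 : (1 : Fock n) ∈ P)
    (hX : ∀ x, ∀ v ∈ P, X x * v ∈ P) : P = ⊤ := by
  rw [eq_top_iff]
  rintro v -
  induction v using MvPolynomial.induction_on with
  | C a =>
    have := P.smul_mem a h1
    rwa [MvPolynomial.smul_eq_C_mul, mul_one] at this
  | add p q hp hq => exact P.add_mem hp hq
  | mul_X p i hp => rw [mul_comm]; exact hX i p hp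

theorem hasStates_betaGamma (n : ℕ) : HasStates (betaGamma n) 1 (transl n : Module.End ℂ (Fock n)) := by
  refine hasStates_generatedBy ?_ ?_ ?_ ?_ ?_
  · rintro _ (⟨i, rfl⟩ | ⟨i, rfl⟩) _ (⟨k, rfl⟩ | ⟨k, rfl⟩)
    · exact FieldCommute.quantumCommute fun m l => LinearMap.ext fun v => beta_beta_comm i k m l v
    · exact beta_gamma_local i k
    · exact (beta_gamma_local k i).symm
    · exact FieldCommute.quantumCommute fun m l => LinearMap.ext fun v => gamma_gamma_comm i k m l v
  · rintro _ (⟨i, rfl⟩ | ⟨i, rfl⟩) m hm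
    · lift m to ℕ using hm
      rw [beta_natCast, pderiv_one]
    · lift m to ℕ using hm
      rw [gamma_natCast, pderiv_one, neg_zero]
  · rintro _ (⟨i, rfl⟩ | ⟨i, rfl⟩)
    · exact beta_covariant i
    · exact gamma_covariant i
  · exact Derivation.map_one_eq_zero _
  · intro P h1 h2
    refine fock_cyclic P h1 ?_
    rintro (⟨i, k⟩ | ⟨i, k⟩) v hv
    · rw [← beta_neg]
      exact h2 _ (Or.inl ⟨i, rfl⟩) _ v hv
    · rw [← gamma_neg]
      exact h2 _ (Or.inr ⟨i, rfl⟩) _ v hv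

end BetaGamma

/-! ### The fields `j^l` -/

section Quadratic

variable {V : Type*} [AddCommGroup V] [Module ℂ V]

/-- The falling factorial `x (x-1) ⋯ (x-l+1)`. -/
def falling (l : ℕ) (x : ℤ) : ℤ := ∏ i ∈ Finset.range l, (x - i)

@[simp] theorem falling_zero (x : ℤ) : falling 0 x = 1 := rfl

@[simp] theorem falling_one (x : ℤ) : falling 1 x = x := by simp [falling]

theorem falling_two (x : ℤ) : falling 2 x = x * (x - 1) := by
  simp [falling, Finset.prod_range_succ]

theorem falling_succ (l : ℕ) (x : ℤ) : falling (l + 1) x = x * falling l (x - 1) := by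
  rw [falling, Finset.prod_range_succ', falling, mul_comm]
  congr 1
  · simp
  · refine Finset.prod_congr rfl fun i _ => ?_
    push_cast
    ring

theorem falling_neg_one (l : ℕ) : (-1) ^ l * falling l (-1) = l.factorial := by
  rw [falling, ← Finset.prod_range_add_one_eq_factorial, Nat.cast_prod]
  nth_rw 1 [← Finset.card_range l]
  rw [← Finset.prod_const, ← Finset.prod_mul_distrib]
  refine Finset.prod_congr rfl fun i _ => ?_
  push_cast
  ring

theorem falling_reflect (l : ℕ) (q : ℤ) : (-1) ^ l * falling l (l - 1 - q) = falling l q := by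
  rw [falling, falling, ← Finset.prod_range_reflect (fun i : ℕ => q - (i : ℤ)) l]
  nth_rw 1 [← Finset.card_range l]
  rw [← Finset.prod_const, ← Finset.prod_mul_distrib]
  refine Finset.prod_congr rfl fun i hi => ?_
  have : ((l - 1 - i : ℕ) : ℤ) = l - 1 - i := by
    have := Finset.mem_range.1 hi
    omega
  rw [this]
  ring

theorem mode_der_iterate (l : ℕ) (a : QO V) (m : ℤ) :
    mode (der^[l] a) m = ((-1) ^ l * falling l m : ℤ) • mode a (m - l) := by
  induction l generalizing m with
  | zero => simp
  | succ l ih =>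
    rw [Function.iterate_succ_apply', mode_der, ih, smul_smul, falling_succ,
      show m - 1 - (l : ℤ) = m - (l + 1 : ℕ) by push_cast; ring]
    congr 1
    ring

theorem mode_wick_eventually (a b : QO V) (m : ℤ) (v : V) :
    ∀ᶠ K : ℕ in atTop, mode (wick a b) m v =
      ∑ k ∈ Finset.range K, mode a (-1 - k) (mode b (m + k) v) +
      ∑ k ∈ Finset.range K, mode b (m - 1 - k) (mode a k v) := by
  filter_upwards [mode_circ_eventually (-1) a b m v] with K hK
  rw [wick, hK]
  simp only [signedChoose_neg_one, one_smul, Int.negOnePow_neg, Int.negOnePow_one, Units.neg_smul,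
    sub_neg_eq_add, ← sub_eq_add_neg]

/-- The commutator of `:ab:` with an operator which commutes with `b` and has a single nonzero,
scalar, commutator with the modes of `a`. -/
theorem mode_wick_commutator_left {a b : QO V} {f : Module.End ℂ V} {p : ℤ} {α : ℂ}
    (ha : ∀ q v, mode a q (f v) = f (mode a q v) + if q = p then α • v else 0)
    (hb : ∀ q v, mode b q (f v) = f (mode b q v)) (m : ℤ) (v : V) :
    mode (wick a b) m (f v) = f (mode (wick a b) m v) + α • mode b (m - 1 - p) v := by
  obtain ⟨K, h1, h2, hK⟩ := ((mode_wick_eventually a b m v).and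
    ((mode_wick_eventually a b m (f v)).and (eventually_gt_atTop (p.natAbs)))).exists
  rw [h1, h2]
  simp only [ha, hb, map_add, map_sum, Finset.sum_add_distrib]
  rw [add_add_add_comm]
  congr 1
  -- The mode `a(p)` occurs in only one half of the Wick product: the second for `p ≥ 0`, the first
  -- for `p < 0`.
  rcases int_cases p with ⟨k, rfl⟩ | ⟨k, rfl⟩
  · rw [Finset.sum_eq_zero fun j _ => if_neg (by omega), zero_add, Finset.sum_eq_single k]
    · rw [if_pos rfl, map_smul]
    · intro j _ hj
      rw [if_neg (by omega), map_zero]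
    · intro hk
      exact absurd (Finset.mem_range.2 (by omega)) hk
  · rw [Finset.sum_eq_single k, Finset.sum_eq_zero, add_zero]
    · rw [if_pos (by omega), show m - 1 - (-(k : ℤ) - 1) = m + k by ring]
    · intro j _
      rw [if_neg (by omega), map_zero]
    · intro j _ hj
      rw [if_neg (by omega)]
    · intro hk
      exact absurd (Finset.mem_range.2 (by omega)) hk

/-- The commutator of `:ab:` with an operator which commutes with `a` and has a single nonzero,
scalar, commutator with the modes of `b`. -/
theorem mode_wick_commutator_right {a b : QO V} {f : Module.End ℂ V} {p : ℤ} {α : ℂ}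
    (ha : ∀ q v, mode a q (f v) = f (mode a q v))
    (hb : ∀ q v, mode b q (f v) = f (mode b q v) + if q = p then α • v else 0) (m : ℤ) (v : V) :
    mode (wick a b) m (f v) = f (mode (wick a b) m v) + α • mode a (m - 1 - p) v := by
  obtain ⟨K, h1, h2, hK⟩ := ((mode_wick_eventually a b m v).and
    ((mode_wick_eventually a b m (f v)).and (eventually_gt_atTop ((m - p).natAbs + 1)))).exists
  rw [h1, h2]
  simp only [ha, hb, map_add, map_sum, Finset.sum_add_distrib]
  rw [add_add_add_comm]
  congr 1
  rcases int_cases (m - 1 - p) with ⟨k, hk⟩ | ⟨k, hk⟩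
  · rw [Finset.sum_eq_zero fun j _ => by rw [if_neg (by omega), map_zero], zero_add,
      Finset.sum_eq_single k]
    · rw [if_pos (by omega), hk]
    · intro j _ hj
      rw [if_neg (by omega)]
    · intro hk'
      exact absurd (Finset.mem_range.2 (by omega)) hk'
  · rw [Finset.sum_eq_single k, Finset.sum_eq_zero fun j _ => if_neg (by omega), add_zero]
    · rw [if_pos (by omega), map_smul, hk, show -1 - (k : ℤ) = -k - 1 by ring]
    · intro j _ hj
      rw [if_neg (by omega), map_zero]
    · intro hk'
      exact absurd (Finset.mem_range.2 (by omega)) hk'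

end Quadratic

/-! ### The linear action of the currents on the modes of `β` and `γ` -/

section Currents

variable {n : ℕ}

theorem der_iterate_mem {S : Submodule ℂ (QO (Fock n))} (hS : IsQOA S) {a : QO (Fock n)}
    (ha : a ∈ S) (l : ℕ) : der^[l] a ∈ S := by
  induction l with
  | zero => exact ha
  | succ l ih => rw [Function.iterate_succ_apply']; exact hS.der_mem ih

theorem j_mem (n l : ℕ) : j n l ∈ betaGamma n := by
  have hS := (hasStates_betaGamma n).toIsQOA
  exact Submodule.sum_mem _ fun i _ => hS.wick_mem (gamma_mem i) (der_iterate_mem hS (beta_mem i) l)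

theorem mode_der_iterate_apply (l : ℕ) (a : QO (Fock n)) (m : ℤ) (v : Fock n) :
    mode (der^[l] a) m v = ((((-1) ^ l * falling l m : ℤ)) : ℂ) • mode a (m - l) v := by
  rw [mode_der_iterate, zsmul_mode_eq_smul]

/-- Only the factor `γ` of `jˡ` fails to commute with `β(q)`, through the single mode `γ(-1-q)`.
Together with `j_gamma` this determines the operators `jˡ(m)`, `m ≥ 0`, since these kill the vacuum.
-/
theorem j_beta (l : ℕ) (m q : ℤ) (i : Fin n) (v : Fock n) :
    mode (j n l) m (mode (beta n i) q v) = mode (beta n i) q (mode (j n l) m v) +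
      (((-1) ^ (l + 1) * falling l (m + q) : ℤ) : ℂ) • mode (beta n i) (m + q - l) v := by
  have key : ∀ k, mode (wick (gamma n k) (der^[l] (beta n k))) m (mode (beta n i) q v) =
      mode (beta n i) q (mode (wick (gamma n k) (der^[l] (beta n k))) m v) +
        (if i = k then (-1 : ℂ) else 0) • mode (der^[l] (beta n k)) (m - 1 - (-1 - q)) v := by
    intro k
    refine mode_wick_commutator_left (fun p w => ?_) (fun p w => ?_) m v
    · rw [beta_gamma_comm]
      by_cases h1 : i = k <;> by_cases h2 : p = -1 - q
      · rw [if_pos h2, if_pos ⟨h1, by omega⟩, if_pos h1]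
        module
      · rw [if_neg h2, if_neg (by omega)]
        simp
      · rw [if_neg h1, if_neg (by tauto)]
        simp
      · rw [if_neg h1, if_neg (by tauto)]
        simp
    · rw [mode_der_iterate_apply, mode_der_iterate_apply, beta_beta_comm, map_smul]
  rw [j, mode_sum, LinearMap.sum_apply, LinearMap.sum_apply, Finset.sum_congr rfl fun k _ => key k,
    Finset.sum_add_distrib, map_sum]
  congr 1
  simp only [ite_smul, zero_smul, Finset.sum_ite_eq, Finset.mem_univ, if_true]
  rw [mode_der_iterate_apply, smul_smul, show m - 1 - (-1 - q) = m + q by ring]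
  congr 1
  push_cast
  ring

theorem j_gamma (l : ℕ) (m q : ℤ) (i : Fin n) (v : Fock n) :
    mode (j n l) m (mode (gamma n i) q v) = mode (gamma n i) q (mode (j n l) m v) +
      (falling l q : ℂ) • mode (gamma n i) (m + q - l) v := by
  have key : ∀ k, mode (wick (gamma n k) (der^[l] (beta n k))) m (mode (gamma n i) q v) =
      mode (gamma n i) q (mode (wick (gamma n k) (der^[l] (beta n k))) m v) +
        (if i = k then (falling l q : ℂ) else 0) • mode (gamma n k) (m - 1 - (l - 1 - q)) v := by
    intro k
    refine mode_wick_commutator_right (fun p w => gamma_gamma_comm _ _ _ _ _) (fun p w => ?_) m v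
    rw [mode_der_iterate_apply, mode_der_iterate_apply, beta_gamma_comm, smul_add, map_smul]
    congr 1
    by_cases h1 : i = k <;> by_cases h2 : p = l - 1 - q
    · rw [if_pos h2, if_pos ⟨h1.symm, by omega⟩, if_pos h1, h2, falling_reflect]
    · rw [if_neg h2, if_neg (by omega)]
      simp
    · rw [if_neg h1, if_neg (by tauto)]
      simp
    · rw [if_neg h1, if_neg (by tauto)]
      simp
  rw [j, mode_sum, LinearMap.sum_apply, LinearMap.sum_apply, Finset.sum_congr rfl fun k _ => key k,
    Finset.sum_add_distrib, map_sum]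
  congr 1
  simp only [ite_smul, zero_smul, Finset.sum_ite_eq, Finset.mem_univ, if_true]
  rw [show m - 1 - (l - 1 - q) = m + q - l by ring]

theorem j_one (l : ℕ) {m : ℤ} (hm : 0 ≤ m) : mode (j n l) m 1 = 0 :=
  (hasStates_betaGamma n).creative _ (j_mem n l) m hm

theorem state_j (l : ℕ) : state 1 (j n l) =
    (l.factorial : ℂ) • ∑ i, (X (Sum.inr (i, 0)) * X (Sum.inl (i, l)) : Fock n) := by
  have hS := hasStates_betaGamma n
  rw [j, map_sum, Finset.smul_sum]
  refine Finset.sum_congr rfl fun i _ => ?_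
  rw [hS.state_wick (gamma_mem i) (der_iterate_mem hS.toIsQOA (beta_mem i) l), state_apply,
    mode_der_iterate_apply, falling_neg_one, map_smul, show -1 - (l : ℤ) = -l - 1 by ring, beta_neg,
    show (-1 : ℤ) = -(0 : ℕ) - 1 by simp, gamma_neg, mul_one]
  norm_cast

end Currents

/-! ### Action of the currents on quadratic states -/

section Pairs

variable {n : ℕ}

/-- The state `∑ᵢ γ^i(p) β^i(q) 1`. -/
def pairState (n : ℕ) (p q : ℤ) : Fock n := ∑ i, mode (gamma n i) p (mode (beta n i) q 1)

theorem pairState_of_nonneg_right (p : ℤ) {q : ℤ} (hq : 0 ≤ q) : pairState n p q = 0 :=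
  Finset.sum_eq_zero fun i _ => by
    rw [(hasStates_betaGamma n).creative _ (beta_mem i) q hq, map_zero]

/-- The origin of all central terms: moving `γ(p)` to the vacuum leaves a contraction `-1` for each
of the `n` pairs. -/
theorem pairState_of_nonneg_left {p : ℤ} (q : ℤ) (hp : 0 ≤ p) :
    pairState n p q = if p + q = -1 then (-(n : ℂ)) • 1 else 0 := by
  have key : ∀ i, mode (gamma n i) p (mode (beta n i) q 1) =
      if p + q = -1 then (-1 : Fock n) else 0 := by
    intro i
    have := beta_gamma_comm i i q p 1
    rw [(hasStates_betaGamma n).creative _ (gamma_mem i) p hp, map_zero] at this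
    rw [eq_neg_of_add_eq_zero_left this.symm, add_comm q p]
    split_ifs with h1 h2 h2
    · rfl
    · tauto
    · tauto
    · exact neg_zero
  rw [pairState, Finset.sum_congr rfl fun i _ => key i]
  split_ifs
  · simp [Algebra.smul_def]
  · simp

theorem mode_j_pairState (a : ℕ) {k : ℤ} (hk : 0 ≤ k) (p q : ℤ) :
    mode (j n a) k (pairState n p q) = (falling a p : ℂ) • pairState n (k + p - a) q +
      (((-1) ^ (a + 1) * falling a (k + q) : ℤ) : ℂ) • pairState n p (k + q - a) := by
  simp only [pairState, map_sum, j_gamma, j_beta, j_one a hk, map_zero, zero_add, map_smul,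
    Finset.sum_add_distrib, Finset.smul_sum]
  rw [add_comm]

theorem transl_mode {a : QO (Fock n)} (ha : a ∈ betaGamma n) (m : ℤ) (v : Fock n) :
    transl n (mode a m v) = mode a m (transl n v) + (-(m : ℂ)) • mode a (m - 1) v := by
  have := (hasStates_betaGamma n).covariant a ha m v
  rw [mode_der, zsmul_mode_eq_smul] at this
  simp only [Derivation.coeFn_coe] at this
  rw [eq_add_of_sub_eq' this, Int.cast_neg]

theorem mode_transl {a : QO (Fock n)} (ha : a ∈ betaGamma n) (m : ℤ) (v : Fock n) :
    mode a m (transl n v) = transl n (mode a m v) + (m : ℂ) • mode a (m - 1) v := by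
  rw [transl_mode ha]
  module

theorem transl_pairState (p q : ℤ) :
    transl n (pairState n p q) =
      (-(p : ℂ)) • pairState n (p - 1) q + (-(q : ℂ)) • pairState n p (q - 1) := by
  simp only [pairState, map_sum, transl_mode (gamma_mem _), transl_mode (beta_mem _), map_smul,
    Derivation.map_one_eq_zero, map_zero, zero_add, Finset.sum_add_distrib, Finset.smul_sum]
  rw [add_comm]

theorem state_j_eq (b : ℕ) : state 1 (j n b) = (b.factorial : ℂ) • pairState n (-1) (-1 - b) := by
  rw [state_j, pairState]
  congr 1
  refine Finset.sum_congr rfl fun i _ => ?_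
  rw [show -1 - (b : ℤ) = -b - 1 by ring, beta_neg, show (-1 : ℤ) = -(0 : ℕ) - 1 by simp, gamma_neg,
    mul_one]

theorem mode_j_state (a b : ℕ) {k : ℤ} (hk : 0 ≤ k) :
    mode (j n a) k (state 1 (j n b)) = (b.factorial : ℂ) •
      ((falling a (-1) : ℂ) • pairState n (k - 1 - a) (-1 - b) +
      (((-1) ^ (a + 1) * falling a (k - 1 - b) : ℤ) : ℂ) • pairState n (-1) (k - 1 - b - a)) := by
  rw [state_j_eq, map_smul, mode_j_pairState a hk, show k + (-1 - (b : ℤ)) = k - 1 - b by ring,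
    show k + -1 - (a : ℤ) = k - 1 - a by ring]

theorem mode_j_state_high (a b : ℕ) {k : ℤ} (hk : a + b + 2 ≤ k) :
    mode (j n a) k (state 1 (j n b)) = 0 := by
  rw [mode_j_state a b (by omega), pairState_of_nonneg_right (-1) (by omega),
    pairState_of_nonneg_left _ (by omega), if_neg (by omega)]
  simp

theorem mode_j_zero_state_zero (b : ℕ) : mode (j n 0) 0 (state 1 (j n b)) = 0 := by
  rw [mode_j_state 0 b le_rfl]
  simp

theorem mode_j_zero_state_succ (b k : ℕ) (h : b ≠ k) (hk : k ≤ b) :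
    mode (j n 0) (k + 1) (state 1 (j n b)) =
      (-(b.factorial / (b - k - 1).factorial : ℂ)) • state 1 (j n (b - k - 1)) := by
  rw [mode_j_state 0 b (by omega), pairState_of_nonneg_left _ (by push_cast; omega),
    if_neg (by push_cast; omega),
    state_j_eq, show -1 - ((b - k - 1 : ℕ) : ℤ) = -b + k by omega, smul_smul, neg_mul,
    div_mul_cancel₀ _ (Nat.cast_ne_zero.2 (Nat.factorial_ne_zero _))]
  simp
  congr 2
  ring

theorem mode_j_zero_state_top (b : ℕ) :
    mode (j n 0) (b + 1) (state 1 (j n b)) = (-(b.factorial * n : ℂ)) • 1 := by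
  rw [mode_j_state 0 b (by omega), pairState_of_nonneg_left _ (by push_cast; omega),
    if_pos (by push_cast; omega),
    pairState_of_nonneg_right _ (by push_cast; omega)]
  simp [smul_smul]

/-- Both operators kill the constants and have the same commutators with multiplication by the
variables. -/
theorem mode_j_one_zero (v : Fock n) : mode (j n 1) 0 v = -transl n v := by
  induction v using MvPolynomial.induction_on with
  | C r =>
    rw [C_eq_smul_one, map_smul, j_one _ le_rfl]
    simp
  | add p q hp hq => rw [map_add, hp, hq, map_add, neg_add]
  | mul_X p x hp =>
    rw [mul_comm, transl_mul]
    rcases x with ⟨i, k⟩ | ⟨i, k⟩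
    · rw [← beta_neg, j_beta, hp, transl_X_inl, map_neg, beta_neg,
        show (0 : ℤ) + (-k - 1) - (1 : ℕ) = -(k + 1 : ℕ) - 1 by push_cast; ring, beta_neg]
      simp
      module
    · rw [← gamma_neg, j_gamma, hp, transl_X_inr, map_neg, gamma_neg,
        show (0 : ℤ) + (-k - 1) - (1 : ℕ) = -(k + 1 : ℕ) - 1 by push_cast; ring, gamma_neg]
      simp
      module

theorem mode_j_one_one_state (b : ℕ) :
    mode (j n 1) 1 (state 1 (j n b)) = (-(b + 1 : ℂ)) • state 1 (j n b) := by
  rw [mode_j_state 1 b zero_le_one, state_j_eq, smul_comm]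
  congr 1
  simp only [falling_one, Nat.cast_one, sub_self, zero_sub]
  rw [show -(b : ℤ) - 1 = -1 - b by ring]
  push_cast
  module

theorem mode_j_one_two_state_zero : mode (j n 1) 2 (state 1 (j n 0)) = (n : ℂ) • 1 := by
  rw [mode_j_state 1 0 (by norm_num), pairState_of_nonneg_left _ (by norm_num),
    pairState_of_nonneg_right _ (by norm_num)]
  norm_num

theorem mode_j_one_two_state_one : mode (j n 1) 2 (state 1 (j n 1)) = 0 := by
  rw [mode_j_state 1 1 (by norm_num), pairState_of_nonneg_left _ (by norm_num)]
  norm_num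

theorem mode_j_one_two_state_two :
    mode (j n 1) 2 (state 1 (j n 2)) = (-2 : ℂ) • state 1 (j n 1) := by
  rw [mode_j_state 1 2 (by norm_num), pairState_of_nonneg_left _ (by norm_num), state_j_eq]
  norm_num

theorem mode_j_one_three_state_one : mode (j n 1) 3 (state 1 (j n 1)) = (n : ℂ) • 1 := by
  rw [mode_j_state 1 1 (by norm_num), pairState_of_nonneg_left _ (by norm_num),
    pairState_of_nonneg_right _ (by norm_num)]
  norm_num

theorem mode_j_one_three_state_two : mode (j n 1) 3 (state 1 (j n 2)) = 0 := by
  rw [mode_j_state 1 2 (by norm_num), pairState_of_nonneg_left _ (by norm_num)]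
  norm_num

theorem mode_j_one_four_state_two : mode (j n 1) 4 (state 1 (j n 2)) = (2 * n : ℂ) • 1 := by
  rw [mode_j_state 1 2 (by norm_num), pairState_of_nonneg_left _ (by norm_num),
    pairState_of_nonneg_right _ (by norm_num)]
  norm_num [smul_smul]

/-- The field `j^{b+1}` is a combination of `∂j^b` and `j² ∘₁ j^b`. -/
theorem smul_j_succ (b : ℕ) :
    (b + 2 : ℂ) • j n (b + 1) = (2 : ℂ) • der (j n b) - circ 1 (j n 2) (j n b) := by
  have hS := hasStates_betaGamma n
  have hb := j_mem n b
  refine hS.ext (Submodule.smul_mem _ _ (j_mem n _)) (Submodule.sub_mem _ (Submodule.smul_mem _ _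
    (hS.toIsQOA.der_mem hb)) (hS.circ_mem _ (j_mem n 2) _ hb 1)) ?_
  rw [map_smul, map_sub, map_smul, hS.state_der hb, hS.state_circ (j_mem n 2) hb,
    mode_j_state 2 b zero_le_one, Derivation.coeFn_coe, state_j_eq, state_j_eq, Derivation.map_smul,
    transl_pairState, falling_two, falling_two, Nat.factorial_succ]
  -- Only `γ(-2)β(-1-b)` and `γ(-1)β(-2-b)` occur. The first cancels, and the second has coefficient
  -- `b!` times `2(b+1) + b(b+1) = (b+1)(b+2)`.
  rw [show (1 : ℤ) - 1 - (2 : ℕ) = -1 - 1 by norm_num,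
    show (1 : ℤ) - 1 - b - (2 : ℕ) = -1 - (b + 1 : ℕ) by push_cast; ring,
    show -1 - (b : ℤ) - 1 = -1 - (b + 1 : ℕ) by push_cast; ring]
  push_cast
  module

end Pairs

/-! ### Diagonal operators -/

section Weight

variable {n : ℕ}

/-- The weight of a variable with respect to `-j¹(1)`. -/
def varWeight (n : ℕ) : Idx n → ℕ
  | Sum.inl (_, k) => k
  | Sum.inr (_, k) => k + 1

/-- With respect to `-j¹` the fields `β` have weight `0` and the fields `γ` weight `1`, and each
derivative adds one. -/
theorem mode_j_one_one_X_mul (x : Idx n) (v : Fock n) :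
    mode (j n 1) 1 (X x * v) = X x * mode (j n 1) 1 v - (varWeight n x : ℂ) • (X x * v) := by
  rcases x with ⟨i, k⟩ | ⟨i, k⟩
  · rw [← beta_neg, j_beta, beta_neg, show (1 : ℤ) + (-k - 1) - (1 : ℕ) = -k - 1 by push_cast; ring]
    simp [beta_neg, varWeight]
    module
  · rw [← gamma_neg, j_gamma, gamma_neg,
      show (1 : ℤ) + (-k - 1) - (1 : ℕ) = -k - 1 by push_cast; ring]
    simp [gamma_neg, varWeight]
    module

/-- The coefficients of the image of a polynomial under an operator which is diagonal in the basis
of monomials, with additive eigenvalues. -/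
theorem coeff_apply_of_X_mul {D : Module.End ℂ (Fock n)} {c : Idx n → ℂ} (h1 : D 1 = 0)
    (hX : ∀ x v, D (X x * v) = X x * D v + c x • (X x * v)) (v : Fock n) (d : Idx n →₀ ℕ) :
    coeff d (D v) = Finsupp.weight c d * coeff d v := by
  classical
  induction v using MvPolynomial.induction_on generalizing d with
  | C r =>
    rw [C_eq_smul_one, map_smul, h1, smul_zero, coeff_zero, coeff_smul, coeff_one]
    split_ifs with h
    · simp [← h]
    · simp
  | add p q hp hq => rw [map_add, coeff_add, hp, hq, coeff_add, mul_add]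
  | mul_X p x hp =>
    rw [mul_comm, hX, coeff_add, coeff_smul, coeff_X_mul', coeff_X_mul']
    split_ifs with h
    · have hd : d = (d - Finsupp.single x 1) + Finsupp.single x 1 :=
        (tsub_add_cancel_of_le (by simpa [Nat.one_le_iff_ne_zero] using h)).symm
      have hw : Finsupp.weight c d = Finsupp.weight c (d - Finsupp.single x 1) + c x := by
        conv_lhs => rw [hd, map_add, Finsupp.weight_single, one_smul]
      rw [hp, hw, smul_eq_mul]
      ring
    · simp

theorem coeff_mode_j_one_one (v : Fock n) (d : Idx n →₀ ℕ) :
    coeff d (mode (j n 1) 1 v) = -((Finsupp.weight (varWeight n) d : ℕ) : ℂ) * coeff d v := by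
  rw [coeff_apply_of_X_mul (c := fun x => -(varWeight n x : ℂ)) (j_one 1 zero_le_one) fun x v => by
    rw [mode_j_one_one_X_mul, neg_smul, sub_eq_add_neg]]
  simp [Finsupp.weight_apply, Finsupp.sum]

/-- The operator `-j¹(1)` has no negative eigenvalues. -/
theorem eq_zero_of_mode_j_one_one {v : Fock n} {e : ℤ} (he : e < 0)
    (h : mode (j n 1) 1 v = (-(e : ℂ)) • v) : v = 0 := by
  ext d
  have := congrArg (coeff d) h
  rw [coeff_mode_j_one_one, coeff_smul, smul_eq_mul] at this
  have h2 : (((Finsupp.weight (varWeight n) d : ℕ) : ℤ) - e : ℂ) * coeff d v = 0 := by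
    push_cast
    linear_combination -this
  rcases mul_eq_zero.1 h2 with h3 | h3
  · exfalso
    norm_cast at h3
    omega
  · rw [h3, coeff_zero]

end Weight

/-! ### The generators `j⁰`, `L`, `W` -/

section Generators

variable {n : ℕ}

theorem isHeisenberg_j (n : ℕ) : IsHeisenberg (j n 0) (-(n : ℂ)) := by
  have hS := hasStates_betaGamma n
  have hJ := j_mem n 0
  refine ⟨hS.quantumCommute _ hJ _ hJ, ?_, ?_, fun k hk => ?_⟩
  · refine hS.eq_zero_of_state _ (hS.circ_mem _ hJ _ hJ _) ?_
    rw [hS.state_circ hJ hJ, mode_j_zero_state_zero]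
  · refine hS.ext (hS.circ_mem _ hJ _ hJ _) (Submodule.smul_mem _ _ hS.one_mem) ?_
    rw [hS.state_circ hJ hJ, map_smul, state_one]
    simpa using mode_j_zero_state_top (n := n) 0
  · refine hS.eq_zero_of_state _ (hS.circ_mem _ hJ _ hJ _) ?_
    rw [hS.state_circ hJ hJ, mode_j_state_high 0 0 (by simpa using hk)]

theorem mode_j_zero_mode_j_zero {k : ℤ} (hk : 0 ≤ k) (v : Fock n) :
    mode (j n 0) k (mode (j n 0) (-1) v) =
      mode (j n 0) (-1) (mode (j n 0) k v) + if k = 1 then (-(n : ℂ)) • v else 0 := by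
  rw [(isHeisenberg_j n).commutator]
  congr 1
  by_cases h : k = 1
  · subst h; simp
  · rw [if_neg h, if_neg (by omega)]

/-- The commutator formula for `j¹` and `j⁰`, whose operator product has the coefficients `-∂j⁰`,
`-j⁰` and `n` at the poles of order one, two and three. -/
theorem mode_j_one_mode_j_zero {m : ℤ} (hm : 0 ≤ m) (k : ℤ) (v : Fock n) :
    mode (j n 1) m (mode (j n 0) k v) = mode (j n 0) k (mode (j n 1) m v) +
      (k : ℂ) • mode (j n 0) (m + k - 1) v +
      if m + k = 1 then ((m.toNat.choose 2 : ℂ) * n) • v else 0 := by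
  have hS := hasStates_betaGamma n
  have hJ := j_mem n 0
  have hP := j_mem n 1
  have h0 : circ (0 : ℕ) (j n 1) (j n 0) = (-1 : ℂ) • der (j n 0) := by
    refine hS.ext (hS.circ_mem _ hP _ hJ _) (Submodule.smul_mem _ _ (hS.toIsQOA.der_mem hJ)) ?_
    rw [hS.state_circ hP hJ, Nat.cast_zero, mode_j_one_zero, map_smul, hS.state_der hJ]
    simp
  have h1 : circ (1 : ℕ) (j n 1) (j n 0) = (-1 : ℂ) • j n 0 := by
    refine hS.ext (hS.circ_mem _ hP _ hJ _) (Submodule.smul_mem _ _ hJ) ?_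
    rw [hS.state_circ hP hJ, Nat.cast_one, mode_j_one_one_state, map_smul]
    simp
  have h2 : circ (2 : ℕ) (j n 1) (j n 0) = (n : ℂ) • one := by
    refine hS.ext (hS.circ_mem _ hP _ hJ _) (Submodule.smul_mem _ _ hS.one_mem) ?_
    rw [hS.state_circ hP hJ, map_smul, state_one]
    exact mode_j_one_two_state_zero
  have h3 : ∀ i : ℕ, 3 ≤ i → circ i (j n 1) (j n 0) = 0 := fun i hi => by
    refine hS.eq_zero_of_state _ (hS.circ_mem _ hP _ hJ _) ?_
    rw [hS.state_circ hP hJ, mode_j_state_high 1 0 (by push_cast; omega)]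
  obtain ⟨N, hN⟩ := hS.quantumCommute _ hP _ hJ
  have key := commutator_eq_sum (hN.mono (Nat.le_add_left N 3)) m k v
  rw [Finset.sum_range_add, Finset.sum_eq_zero (s := Finset.range N) fun i _ => by
    rw [h3 _ (by omega), mode_zero, LinearMap.zero_apply, smul_zero], add_zero,
    Finset.sum_range_succ, Finset.sum_range_succ, Finset.sum_range_one, h0, h1, h2] at key
  rw [eq_add_of_sub_eq' key]
  refine Eq.trans ?_ (add_assoc _ _ _).symm
  congr 1
  obtain ⟨m, rfl⟩ := Int.eq_ofNat_of_zero_le hm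
  simp only [mode_smul, mode_der, mode_one, LinearMap.smul_apply, Ring.choose_zero_right,
    Ring.choose_one_right, Ring.choose_natCast, Int.toNat_natCast, ← Int.cast_smul_eq_zsmul ℂ]
  by_cases h : (m : ℤ) + k = 1
  · rw [if_pos h, if_pos (by push_cast; omega), h]
    have : (k : ℂ) = 1 - m := by
      have : k = 1 - m := by omega
      rw [this]; push_cast; ring
    rw [this]
    simp
    module
  · rw [if_neg h, if_neg (by push_cast; omega)]
    simp
    module

theorem state_fieldL (n : ℕ) : state 1 (fieldL n) = (1 / (2 * n) : ℂ) •
    (mode (j n 0) (-1) (state 1 (j n 0)) + (n : ℂ) • transl n (state 1 (j n 0)) -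
      (2 * n : ℂ) • state 1 (j n 1)) := by
  have hS := hasStates_betaGamma n
  have hJ := j_mem n 0
  rw [fieldL, map_smul, map_sub, map_add, map_smul, map_smul, hS.state_wick hJ hJ, hS.state_der hJ,
    Derivation.coeFn_coe]

theorem state_fieldW (n : ℕ) : state 1 (fieldW n) =
    mode (j n 0) (-1) (mode (j n 0) (-1) (state 1 (j n 0))) +
      (3 * n / 2 : ℂ) • mode (j n 0) (-1) (transl n (state 1 (j n 0))) -
      (3 * n : ℂ) • mode (j n 0) (-1) (state 1 (j n 1)) +
      ((n : ℂ) ^ 2 / 4) • transl n (transl n (state 1 (j n 0))) -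
      (3 * (n : ℂ) ^ 2 / 2) • transl n (state 1 (j n 1)) +
      (3 * (n : ℂ) ^ 2 / 2) • state 1 (j n 2) := by
  have hS := hasStates_betaGamma n
  have hJ := j_mem n 0
  have hP := j_mem n 1
  have hd := hS.toIsQOA.der_mem hJ
  rw [fieldW, map_add, map_sub, map_add, map_sub, map_add, map_smul, map_smul, map_smul, map_smul,
    map_smul, hS.state_wick hJ (hS.toIsQOA.wick_mem hJ hJ), hS.state_wick hJ hJ,
    hS.state_wick hJ hd, hS.state_wick hJ hP, hS.state_der hd, hS.state_der hJ, hS.state_der hP]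
  simp only [Derivation.coeFn_coe]

theorem mode_j_zero_one_state_zero :
    mode (j n 0) 1 (state 1 (j n 0)) = (-(n : ℂ)) • 1 := by
  simpa using mode_j_zero_state_top (n := n) 0

theorem mode_j_zero_one_state_one :
    mode (j n 0) 1 (state 1 (j n 1)) = (-1 : ℂ) • state 1 (j n 0) := by
  simpa using mode_j_zero_state_succ (n := n) 1 0 (by norm_num) (by norm_num)

theorem mode_j_zero_two_state_one :
    mode (j n 0) 2 (state 1 (j n 1)) = (-(n : ℂ)) • 1 := by
  simpa using mode_j_zero_state_top (n := n) 1

theorem mode_j_zero_one_state_two :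
    mode (j n 0) 1 (state 1 (j n 2)) = (-2 : ℂ) • state 1 (j n 1) := by
  simpa using mode_j_zero_state_succ (n := n) 2 0 (by norm_num) (by norm_num)

theorem mode_j_zero_two_state_two :
    mode (j n 0) 2 (state 1 (j n 2)) = (-2 : ℂ) • state 1 (j n 0) := by
  simpa using mode_j_zero_state_succ (n := n) 2 1 (by norm_num) (by norm_num)

theorem mode_j_zero_three_state_two :
    mode (j n 0) 3 (state 1 (j n 2)) = (-(2 * n : ℂ)) • 1 := by
  simpa using mode_j_zero_state_top (n := n) 2

theorem fieldL_mem (n : ℕ) : fieldL n ∈ betaGamma n := by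
  have hS := (hasStates_betaGamma n).toIsQOA
  have hJ := j_mem n 0
  exact Submodule.smul_mem _ _ (Submodule.sub_mem _ (Submodule.add_mem _ (hS.wick_mem hJ hJ)
    (Submodule.smul_mem _ _ (hS.der_mem hJ))) (Submodule.smul_mem _ _ (j_mem n 1)))

/-- The part of `W` without `j²` involves only `j⁰` and `j¹`. This serves to recover `j²` from `W`
as well as `W` from `j²`. -/
theorem fieldW_mem_of {S : Submodule ℂ (QO (Fock n))} (hS : IsQOA S) (h0 : j n 0 ∈ S)
    (h1 : j n 1 ∈ S) : fieldW n - (3 * (n : ℂ) ^ 2 / 2) • j n 2 ∈ S := by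
  rw [fieldW, add_sub_cancel_right]
  exact Submodule.sub_mem _ (Submodule.add_mem _ (Submodule.sub_mem _ (Submodule.add_mem _
    (hS.wick_mem h0 (hS.wick_mem h0 h0)) (Submodule.smul_mem _ _ (hS.wick_mem h0 (hS.der_mem h0))))
    (Submodule.smul_mem _ _ (hS.wick_mem h0 h1)))
    (Submodule.smul_mem _ _ (hS.der_mem (hS.der_mem h0))))
    (Submodule.smul_mem _ _ (hS.der_mem h1))

theorem fieldW_mem (n : ℕ) : fieldW n ∈ betaGamma n := by
  have := Submodule.add_mem _ (fieldW_mem_of (hasStates_betaGamma n).toIsQOA (j_mem n 0) (j_mem n 1))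
    (Submodule.smul_mem _ (3 * (n : ℂ) ^ 2 / 2) (j_mem n 2))
  rwa [sub_add_cancel] at this

theorem mode_j_transl (l : ℕ) {m : ℤ} (_ : 0 ≤ m) (v : Fock n) :
    mode (j n l) m (transl n v) = transl n (mode (j n l) m v) + (m : ℂ) • mode (j n l) (m - 1) v :=
  mode_transl (j_mem n l) m v

theorem mode_j_neg_one_one (l : ℕ) : mode (j n l) (-1) 1 = state 1 (j n l) := rfl

/-- The corrections in `L` are made for this: `-2n j¹` cancels the multiple of `j⁰` that `j⁰(1)`
produces from `:j⁰j⁰:`, and under `j⁰(2)` the constants from `n ∂j⁰` and `-2n j¹` cancel. -/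
theorem mode_j_zero_fieldL (k : ℕ) : mode (j n 0) k (state 1 (fieldL n)) = 0 := by
  rw [state_fieldL]
  match k with
  | 0 =>
    simp [mode_j_zero_mode_j_zero, mode_transl (j_mem n 0), mode_j_zero_state_zero]
  | 1 =>
    simp [mode_j_zero_mode_j_zero, mode_transl (j_mem n 0), mode_j_zero_state_zero,
      mode_j_zero_one_state_zero, mode_j_zero_one_state_one, -smul_eq_zero, mode_j_neg_one_one]
    module
  | 2 =>
    simp [mode_j_zero_mode_j_zero, mode_transl (j_mem n 0), mode_j_state_high,
      mode_j_zero_one_state_zero, mode_j_zero_two_state_one, -smul_eq_zero]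
    module
  | k + 3 =>
    have h0 : mode (j n 0) ((k + 3 : ℕ) : ℤ) (state 1 (j n 0)) = 0 :=
      mode_j_state_high 0 0 (by push_cast; omega)
    have h1 : mode (j n 0) ((k + 3 : ℕ) : ℤ) (state 1 (j n 1)) = 0 :=
      mode_j_state_high 0 1 (by push_cast; omega)
    have h2 : mode (j n 0) ((k + 3 : ℕ) - 1 : ℤ) (state 1 (j n 0)) = 0 :=
      mode_j_state_high 0 0 (by push_cast; omega)
    rw [map_smul, map_sub, map_add, map_smul, map_smul, mode_j_zero_mode_j_zero (by omega),
      mode_transl (j_mem n 0), h0, h1, h2, if_neg (by push_cast; omega)]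
    simp

theorem mode_j_zero_fieldW (k : ℕ) : mode (j n 0) k (state 1 (fieldW n)) = 0 := by
  rw [state_fieldW]
  match k with
  | 0 =>
    simp [mode_j_zero_mode_j_zero, mode_j_transl, mode_j_zero_state_zero]
  | 1 =>
    simp [mode_j_zero_mode_j_zero, mode_j_transl, mode_j_zero_state_zero,
      mode_j_zero_one_state_zero, mode_j_zero_one_state_one, mode_j_zero_one_state_two,
      -smul_eq_zero, mode_j_neg_one_one]
    module
  | 2 =>
    simp [mode_j_zero_mode_j_zero, mode_j_transl, mode_j_state_high,
      mode_j_zero_state_zero, mode_j_zero_two_state_two, mode_j_zero_one_state_one,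
      mode_j_zero_one_state_zero, mode_j_zero_two_state_one, -smul_eq_zero, mode_j_neg_one_one]
    module
  | 3 =>
    simp [mode_j_zero_mode_j_zero, mode_j_transl, mode_j_state_high,
      mode_j_zero_three_state_two,
      mode_j_zero_one_state_zero, mode_j_zero_two_state_one, -smul_eq_zero]
    module
  | k + 4 =>
    have h0 : ∀ m : ℤ, 2 ≤ m → mode (j n 0) m (state 1 (j n 0)) = 0 := fun m hm =>
      mode_j_state_high 0 0 (by simpa using hm)
    have h1 : ∀ m : ℤ, 3 ≤ m → mode (j n 0) m (state 1 (j n 1)) = 0 := fun m hm =>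
      mode_j_state_high 0 1 (by push_cast; omega)
    have h2 : ∀ m : ℤ, 4 ≤ m → mode (j n 0) m (state 1 (j n 2)) = 0 := fun m hm =>
      mode_j_state_high 0 2 (by push_cast; omega)
    generalize hm : ((k + 4 : ℕ) : ℤ) = m
    have hm' : 4 ≤ m := by omega
    simp only [map_smul, map_sub, map_add, mode_j_transl 0 (show 0 ≤ m by omega),
      mode_j_transl 0 (show 0 ≤ m - 1 by omega), mode_j_zero_mode_j_zero (show 0 ≤ m by omega),
      if_neg (show ¬ m = 1 by omega),
      h0 m (by omega), h0 (m - 1) (by omega), h0 (m - 1 - 1) (by omega), h1 m (by omega),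
      h1 (m - 1) (by omega), h2 m (by omega), map_zero, smul_zero, add_zero, sub_zero]

theorem fieldCommute_j_fieldL (n : ℕ) : FieldCommute (j n 0) (fieldL n) :=
  (hasStates_betaGamma n).fieldCommute (j_mem n 0) (fieldL_mem n) mode_j_zero_fieldL

theorem fieldCommute_j_fieldW (n : ℕ) : FieldCommute (j n 0) (fieldW n) :=
  (hasStates_betaGamma n).fieldCommute (j_mem n 0) (fieldW_mem n) mode_j_zero_fieldW

/-- For `n ≠ 0` the fields `L` and `W` can be solved for `j¹` and `j²`, and `j² ∘₁ jᵇ` then yields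
`jᵇ⁺¹` from `jᵇ`. -/
theorem W1inf_eq (hn : n ≠ 0) : W1inf n = generatedBy (insert (j n 0) {fieldL n, fieldW n}) := by
  have hn' : (n : ℂ) ≠ 0 := Nat.cast_ne_zero.2 hn
  apply le_antisymm
  · have hG := isQOA_generatedBy (insert (j n 0) {fieldL n, fieldW n})
    have h0 : j n 0 ∈ generatedBy (insert (j n 0) {fieldL n, fieldW n}) :=
      subset_generatedBy _ (by simp)
    have hL : fieldL n ∈ generatedBy (insert (j n 0) {fieldL n, fieldW n}) :=
      subset_generatedBy _ (by simp)
    have hW : fieldW n ∈ generatedBy (insert (j n 0) {fieldL n, fieldW n}) :=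
      subset_generatedBy _ (by simp)
    have h1 : j n 1 ∈ generatedBy (insert (j n 0) {fieldL n, fieldW n}) := by
      have : j n 1 = (1 / (2 * n) : ℂ) • (wick (j n 0) (j n 0) + (n : ℂ) • der (j n 0)) -
          fieldL n := by
        rw [fieldL, smul_sub (1 / (2 * n) : ℂ), smul_smul,
          one_div_mul_cancel (mul_ne_zero two_ne_zero hn'), one_smul, sub_sub_cancel]
      rw [this]
      exact Submodule.sub_mem _ (Submodule.smul_mem _ _ (Submodule.add_mem _ (hG.wick_mem h0 h0)
        (Submodule.smul_mem _ _ (hG.der_mem h0)))) hL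
    have h2 : j n 2 ∈ generatedBy (insert (j n 0) {fieldL n, fieldW n}) := by
      have := Submodule.sub_mem _ hW (fieldW_mem_of hG h0 h1)
      rw [sub_sub_cancel] at this
      exact (Submodule.smul_mem_iff _ (by simpa using hn')).1 this
    refine generatedBy_le hG ?_
    rintro _ ⟨l, rfl⟩
    induction l with
    | zero => exact h0
    | succ b ih =>
      refine (Submodule.smul_mem_iff _ (show (b + 2 : ℂ) ≠ 0 by norm_cast)).1 ?_
      rw [smul_j_succ]
      exact Submodule.sub_mem _ (Submodule.smul_mem _ _ (hG.der_mem ih)) (hG.circ_mem _ h2 _ ih 1)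
  · have hG := isQOA_generatedBy (Set.range (j n))
    have h : ∀ l, j n l ∈ generatedBy (Set.range (j n)) := fun l => subset_generatedBy _ ⟨l, rfl⟩
    refine generatedBy_le hG ?_
    rintro x (rfl | rfl | rfl)
    · exact h 0
    · exact Submodule.smul_mem _ _ (Submodule.sub_mem _ (Submodule.add_mem _
        (hG.wick_mem (h 0) (h 0)) (Submodule.smul_mem _ _ (hG.der_mem (h 0))))
        (Submodule.smul_mem _ _ (h 1)))
    · have := Submodule.add_mem _ (fieldW_mem_of hG (h 0) (h 1))
        (Submodule.smul_mem _ (3 * (n : ℂ) ^ 2 / 2) (h 2))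
      rwa [sub_add_cancel] at this

theorem algA_eq (hn : n ≠ 0) : algA n = generatedBy {fieldL n, fieldW n} := by
  rw [algA, heis, W1inf_eq hn]
  refine (isHeisenberg_j n).commutant_eq (hasStates_betaGamma n) (by simpa using hn) (j_mem n 0) ?_ ?_
  · rintro x (rfl | rfl)
    exacts [fieldL_mem n, fieldW_mem n]
  · rintro x (rfl | rfl)
    exacts [fieldCommute_j_fieldL n, fieldCommute_j_fieldW n]

theorem isTensorDecomposition_W1inf (hn : n ≠ 0) :
    IsTensorDecomposition (W1inf n) (heis n) (algA n) := by
  rw [algA_eq hn, heis, W1inf_eq hn]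
  refine (isHeisenberg_j n).isTensorDecomposition (hasStates_betaGamma n) (by simpa using hn)
    (j_mem n 0) ?_ ?_
  · rintro x (rfl | rfl)
    exacts [fieldL_mem n, fieldW_mem n]
  · rintro x (rfl | rfl)
    exacts [fieldCommute_j_fieldL n, fieldCommute_j_fieldW n]

end Generators

/-! ### The conformal structure -/

section Conformal

variable {n : ℕ}

/-- On a vector killed by all `j⁰(k)`, `k ≥ 0`, the nonnegative modes of `:j⁰j⁰:` and `∂j⁰` vanish,
so only the term `-j¹` of `L` acts. -/
theorem mode_fieldL_eq (hn : n ≠ 0) {v : Fock n} (hv : ∀ k : ℤ, 0 ≤ k → mode (j n 0) k v = 0)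
    {m : ℤ} (hm : 0 ≤ m) : mode (fieldL n) m v = -mode (j n 1) m v := by
  have hn' : (n : ℂ) ≠ 0 := Nat.cast_ne_zero.2 hn
  obtain ⟨K, hK⟩ := (mode_wick_eventually (j n 0) (j n 0) m v).exists
  have h1 : mode (wick (j n 0) (j n 0)) m v = 0 := by
    rw [hK, Finset.sum_eq_zero, Finset.sum_eq_zero, add_zero]
    · intro k _
      rw [hv k (by omega), map_zero]
    · intro k _
      rw [hv (m + k) (by omega), map_zero]
  have h2 : mode (der (j n 0)) m v = 0 := by
    rw [mode_der, LinearMap.smul_apply]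
    rcases hm.eq_or_lt with rfl | hm
    · simp
    · rw [hv _ (by omega), smul_zero]
  rw [fieldL, mode_smul, mode_sub, mode_add, mode_smul, mode_smul]
  simp only [LinearMap.smul_apply, LinearMap.sub_apply, LinearMap.add_apply, h1, h2, smul_zero,
    add_zero, zero_sub, smul_neg, smul_smul]
  rw [one_div_mul_cancel (mul_ne_zero two_ne_zero hn'), one_smul]

theorem mode_j_one_mode_j_zero_neg_one {m : ℤ} (hm : 0 ≤ m) (v : Fock n) :
    mode (j n 1) m (mode (j n 0) (-1) v) = mode (j n 0) (-1) (mode (j n 1) m v) -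
      mode (j n 0) (m - 2) v + if m = 2 then (n : ℂ) • v else 0 := by
  rw [mode_j_one_mode_j_zero hm, show m + -1 - 1 = m - 2 by ring]
  by_cases h : m = 2
  · subst h
    simp
    module
  · rw [if_neg h, if_neg (by omega)]
    simp
    module

theorem mode_j_one_one_fieldL :
    mode (j n 1) 1 (state 1 (fieldL n)) = (-2 : ℂ) • state 1 (fieldL n) := by
  rw [state_fieldL]
  simp [mode_j_one_mode_j_zero_neg_one, mode_j_transl, mode_j_one_one_state, mode_j_one_zero]
  module

theorem mode_j_one_two_fieldL : mode (j n 1) 2 (state 1 (fieldL n)) = 0 := by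
  rw [state_fieldL]
  simp [mode_j_one_mode_j_zero_neg_one, mode_j_transl, mode_j_one_one_state,
    mode_j_one_two_state_zero, mode_j_one_two_state_one, mode_j_zero_state_zero,
    mode_j_neg_one_one, -smul_eq_zero]
  module

/-- The three terms of `2nL` contribute `n`, `3n²` and `-2n²`. Since `L` acts here as `-j¹`, the
result is `-c/2` with `c = -n-1`. -/
theorem mode_j_one_three_fieldL (hn : n ≠ 0) :
    mode (j n 1) 3 (state 1 (fieldL n)) = ((n + 1 : ℂ) / 2) • 1 := by
  have hn' : (n : ℂ) ≠ 0 := Nat.cast_ne_zero.2 hn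
  rw [state_fieldL]
  simp [mode_j_one_mode_j_zero_neg_one, mode_j_transl, mode_j_state_high,
    mode_j_one_two_state_zero, mode_j_one_three_state_one, mode_j_zero_one_state_zero,
    -smul_eq_zero]
  match_scalars
  field_simp
  ring

theorem mode_j_one_fieldL_high {m : ℤ} (hm : 4 ≤ m) :
    mode (j n 1) m (state 1 (fieldL n)) = 0 := by
  have h0 : ∀ m : ℤ, 3 ≤ m → mode (j n 1) m (state 1 (j n 0)) = 0 := fun m hm =>
    mode_j_state_high 1 0 (by push_cast; omega)
  have h1 : ∀ m : ℤ, 4 ≤ m → mode (j n 1) m (state 1 (j n 1)) = 0 := fun m hm =>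
    mode_j_state_high 1 1 (by push_cast; omega)
  have h2 : ∀ m : ℤ, 2 ≤ m → mode (j n 0) m (state 1 (j n 0)) = 0 := fun m hm =>
    mode_j_state_high 0 0 (by push_cast; omega)
  rw [state_fieldL]
  simp only [map_smul, map_sub, map_add, mode_j_transl 1 (show 0 ≤ m by omega),
    mode_j_one_mode_j_zero_neg_one (show 0 ≤ m by omega), if_neg (show ¬ m = 2 by omega),
    h0 m (by omega), h0 (m - 1) (by omega), h1 m (by omega), h2 (m - 2) (by omega), map_zero,
    smul_zero, add_zero, sub_zero]

theorem mode_j_one_one_fieldW :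
    mode (j n 1) 1 (state 1 (fieldW n)) = (-3 : ℂ) • state 1 (fieldW n) := by
  rw [state_fieldW]
  simp [mode_j_one_mode_j_zero_neg_one, mode_j_transl, mode_j_one_one_state, mode_j_one_zero]
  module

theorem mode_j_one_two_fieldW : mode (j n 1) 2 (state 1 (fieldW n)) = 0 := by
  rw [state_fieldW]
  simp [mode_j_one_mode_j_zero_neg_one, mode_j_zero_mode_j_zero, mode_j_transl,
    mode_j_one_one_state, mode_j_one_zero, mode_j_one_two_state_two,
    mode_j_one_two_state_zero, mode_j_one_two_state_one, mode_j_zero_state_zero,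
    mode_j_neg_one_one, -smul_eq_zero]
  module

theorem mode_j_one_three_fieldW : mode (j n 1) 3 (state 1 (fieldW n)) = 0 := by
  rw [state_fieldW]
  simp [mode_j_one_mode_j_zero_neg_one, mode_j_zero_mode_j_zero, mode_j_transl,
    mode_j_state_high, mode_j_one_one_state,
    mode_j_one_three_state_one, mode_j_one_three_state_two, mode_j_zero_one_state_zero,
    mode_j_zero_one_state_one,
    mode_j_one_two_state_zero, mode_j_one_two_state_one, mode_j_zero_state_zero,
    mode_j_neg_one_one, -smul_eq_zero]
  module

theorem mode_j_one_four_fieldW : mode (j n 1) 4 (state 1 (fieldW n)) = 0 := by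
  rw [state_fieldW]
  simp [mode_j_one_mode_j_zero_neg_one, mode_j_zero_mode_j_zero, mode_j_transl,
    mode_j_state_high, mode_j_one_four_state_two, mode_j_zero_two_state_one,
    mode_j_one_three_state_one, mode_j_zero_one_state_zero,
    mode_j_one_two_state_zero, -smul_eq_zero]
  module

theorem mode_j_one_fieldW_high {m : ℤ} (hm : 5 ≤ m) :
    mode (j n 1) m (state 1 (fieldW n)) = 0 := by
  have h0 : ∀ m : ℤ, 3 ≤ m → mode (j n 1) m (state 1 (j n 0)) = 0 := fun m hm =>
    mode_j_state_high 1 0 (by push_cast; omega)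
  have h1 : ∀ m : ℤ, 4 ≤ m → mode (j n 1) m (state 1 (j n 1)) = 0 := fun m hm =>
    mode_j_state_high 1 1 (by push_cast; omega)
  have h2 : ∀ m : ℤ, 5 ≤ m → mode (j n 1) m (state 1 (j n 2)) = 0 := fun m hm =>
    mode_j_state_high 1 2 (by push_cast; omega)
  have h3 : ∀ m : ℤ, 2 ≤ m → mode (j n 0) m (state 1 (j n 0)) = 0 := fun m hm =>
    mode_j_state_high 0 0 (by push_cast; omega)
  have h4 : ∀ m : ℤ, 3 ≤ m → mode (j n 0) m (state 1 (j n 1)) = 0 := fun m hm =>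
    mode_j_state_high 0 1 (by push_cast; omega)
  rw [state_fieldW]
  simp only [map_smul, map_sub, map_add, mode_j_transl 1 (show 0 ≤ m by omega),
    mode_j_transl 1 (show 0 ≤ m - 1 by omega), mode_j_transl 0 (show 0 ≤ m - 2 by omega),
    mode_j_zero_mode_j_zero (show 0 ≤ m - 2 by omega), if_neg (show ¬ m - 2 = 1 by omega),
    mode_j_one_mode_j_zero_neg_one (show 0 ≤ m by omega), if_neg (show ¬ m = 2 by omega),
    h0 m (by omega), h0 (m - 1) (by omega), h0 (m - 1 - 1) (by omega), h1 m (by omega),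
    h1 (m - 1) (by omega), h2 m (by omega), h3 (m - 2) (by omega), h3 (m - 2 - 1) (by omega),
    h4 (m - 2) (by omega), map_zero, smul_zero, add_zero, sub_zero]

theorem algA_le (n : ℕ) : algA n ≤ betaGamma n := fun a ha =>
  generatedBy_le (hasStates_betaGamma n).toIsQOA (by rintro _ ⟨l, rfl⟩; exact j_mem n l) ha.1

theorem mode_j_zero_state_eq_zero {a : QO (Fock n)} (ha : a ∈ algA n) {k : ℤ} (hk : 0 ≤ k) :
    mode (j n 0) k (state 1 a) = 0 :=
  (hasStates_betaGamma n).mode_state_eq_zero (j_mem n 0)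
    (ha.2 _ (subset_generatedBy _ rfl)).symm hk

theorem isQOA_algA (hn : n ≠ 0) : IsQOA (algA n) := by
  rw [algA_eq hn]
  exact isQOA_generatedBy _

theorem isVertexAlgebra_algA (hn : n ≠ 0) : IsVertexAlgebra (algA n) :=
  { isQOA_algA hn with
    quantumCommute := fun a ha b hb =>
      (hasStates_betaGamma n).quantumCommute a (algA_le n ha) b (algA_le n hb) }

theorem fieldL_mem_algA (hn : n ≠ 0) : fieldL n ∈ algA n := by
  rw [algA_eq hn]
  exact subset_generatedBy _ (by simp)

theorem fieldW_mem_algA (hn : n ≠ 0) : fieldW n ∈ algA n := by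
  rw [algA_eq hn]
  exact subset_generatedBy _ (by simp)

theorem state_circ_fieldL (hn : n ≠ 0) {a : QO (Fock n)} (ha : a ∈ algA n) {m : ℤ} (hm : 0 ≤ m) :
    state 1 (circ m (fieldL n) a) = -mode (j n 1) m (state 1 a) := by
  rw [(hasStates_betaGamma n).state_circ (fieldL_mem n) (algA_le n ha),
    mode_fieldL_eq hn (fun k hk => mode_j_zero_state_eq_zero ha hk) hm]

theorem circ_fieldL_eq (hn : n ≠ 0) {a b : QO (Fock n)} (ha : a ∈ algA n) (hb : b ∈ algA n) {m : ℤ}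
    (hm : 0 ≤ m) (h : -mode (j n 1) m (state 1 a) = state 1 b) : circ m (fieldL n) a = b :=
  (hasStates_betaGamma n).ext ((hasStates_betaGamma n).circ_mem _ (fieldL_mem n) _ (algA_le n ha) _)
    (algA_le n hb) (by rw [state_circ_fieldL hn ha hm, h])

theorem circ_zero_fieldL (hn : n ≠ 0) {a : QO (Fock n)} (ha : a ∈ algA n) :
    circ 0 (fieldL n) a = der a :=
  circ_fieldL_eq hn ha ((isQOA_algA hn).der_mem ha) le_rfl (by
    rw [mode_j_one_zero, neg_neg, (hasStates_betaGamma n).state_der (algA_le n ha),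
      Derivation.coeFn_coe])

theorem isVirasoro_fieldL (hn : n ≠ 0) : IsVirasoro (fieldL n) (-(n : ℂ) - 1) := by
  have hL := fieldL_mem_algA hn
  have hA := isVertexAlgebra_algA hn
  refine ⟨hA.quantumCommute _ hL _ hL, circ_zero_fieldL hn hL,
    circ_fieldL_eq hn hL (Submodule.smul_mem _ _ hL) zero_le_one ?_,
    circ_fieldL_eq hn hL (Submodule.zero_mem _) zero_le_two ?_,
    circ_fieldL_eq hn hL (Submodule.smul_mem _ _ hA.one_mem) zero_le_three ?_,
    fun k hk => circ_fieldL_eq hn hL (Submodule.zero_mem _) (by omega) ?_⟩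
  · rw [mode_j_one_one_fieldL, map_smul]
    module
  · rw [mode_j_one_two_fieldL, map_zero, neg_zero]
  · rw [mode_j_one_three_fieldL hn, map_smul, state_one]
    module
  · rw [mode_j_one_fieldL_high hk, map_zero, neg_zero]

theorem isPrimary_fieldW (hn : n ≠ 0) : IsPrimary (fieldL n) (fieldW n) 3 := by
  have hL := fieldL_mem_algA hn
  have hW := fieldW_mem_algA hn
  have hA := isVertexAlgebra_algA hn
  refine ⟨hA.quantumCommute _ hL _ hW, circ_zero_fieldL hn hW,
    circ_fieldL_eq hn hW (Submodule.smul_mem _ _ hW) zero_le_one ?_,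
    fun k hk => circ_fieldL_eq hn hW (Submodule.zero_mem _) (by omega) ?_⟩
  · rw [mode_j_one_one_fieldW, map_smul]
    module
  · rw [map_zero, neg_eq_zero]
    rcases (show k = 2 ∨ k = 3 ∨ k = 4 ∨ 5 ≤ k by omega) with rfl | rfl | rfl | hk
    exacts [mode_j_one_two_fieldW, mode_j_one_three_fieldW, mode_j_one_four_fieldW,
      mode_j_one_fieldW_high hk]

/-- `[L(1), a(m)]` is `(∂a)(m+1) + x a(m)`, and `(∂a)(m+1) = -(m+1) a(m)`. -/
theorem circ_one_fieldL_circ (hn : n ≠ 0) {a b : QO (Fock n)} (ha : a ∈ algA n) (hb : b ∈ algA n)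
    {x y : ℂ} (hx : circ 1 (fieldL n) a = x • a) (hy : circ 1 (fieldL n) b = y • b) (m : ℤ) :
    circ 1 (fieldL n) (circ m a b) = (x + y - m - 1) • circ m a b := by
  have hS := hasStates_betaGamma n
  have hA := isQOA_algA hn
  have hab := hA.circ_mem a ha b hb m
  refine hS.ext (algA_le n (hA.circ_mem _ (fieldL_mem_algA hn) _ hab 1))
    (Submodule.smul_mem _ _ (algA_le n hab)) ?_
  rw [hS.state_circ (fieldL_mem n) (algA_le n hab), map_smul,
    hS.state_circ (algA_le n ha) (algA_le n hb)]
  have hy' : mode (fieldL n) 1 (state 1 b) = y • state 1 b := by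
    rw [← hS.state_circ (fieldL_mem n) (algA_le n hb), hy, map_smul]
  have := commutator_one (fieldL n) a m (state 1 b)
  rw [circ_zero_fieldL hn ha, hx, hy', mode_der, mode_smul, zsmul_mode_eq_smul, map_smul,
    add_sub_cancel_right, LinearMap.smul_apply] at this
  rw [eq_add_of_sub_eq' this]
  push_cast
  module

theorem eq_zero_of_circ_one_fieldL (hn : n ≠ 0) {a : QO (Fock n)} (ha : a ∈ algA n) {e : ℤ}
    (he : e < 0) (h : circ 1 (fieldL n) a = (e : ℂ) • a) : a = 0 := by
  refine (hasStates_betaGamma n).eq_zero_of_state a (algA_le n ha)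
    (eq_zero_of_mode_j_one_one he ?_)
  rw [neg_smul, ← map_smul, ← h, state_circ_fieldL hn ha zero_le_one, neg_neg]

/-- The span of the homogeneous elements of `A`. -/
def gradedPart (n : ℕ) : Submodule ℂ (QO (Fock n)) :=
  Submodule.span ℂ {a | a ∈ algA n ∧ ∃ k : ℕ, circ 1 (fieldL n) a = (k : ℂ) • a}

theorem isQOA_gradedPart (hn : n ≠ 0) : IsQOA (gradedPart n) where
  one_mem := Submodule.subset_span ⟨(isQOA_algA hn).one_mem, 0, by
    refine circ_fieldL_eq hn (isQOA_algA hn).one_mem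
      (Submodule.smul_mem _ _ (isQOA_algA hn).one_mem) zero_le_one ?_
    rw [state_one, j_one _ zero_le_one, map_smul]
    simp⟩
  circ_mem := fun a ha b hb m => by
    induction ha, hb using Submodule.span_induction₂ with
    | mem_mem a b ha hb =>
      obtain ⟨ha, x, hx⟩ := ha
      obtain ⟨hb, y, hy⟩ := hb
      have hab := (isQOA_algA hn).circ_mem a ha b hb m
      have h := circ_one_fieldL_circ hn ha hb hx hy m
      -- A product whose weight would be negative is zero, because the Fock space has no negative
      -- weights.
      rcases int_cases ((x : ℤ) + y - m - 1) with ⟨k, hk⟩ | ⟨k, hk⟩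
      · refine Submodule.subset_span ⟨hab, k, ?_⟩
        rw [h]
        congr 1
        exact_mod_cast hk
      · rw [eq_zero_of_circ_one_fieldL hn hab (e := (x : ℤ) + y - m - 1) (by omega)
          (by rw [h]; push_cast; rfl)]
        exact Submodule.zero_mem _
    | zero_left b hb => rw [circ_zero_left]; exact Submodule.zero_mem _
    | zero_right a ha => rw [circ_zero_right]; exact Submodule.zero_mem _
    | add_left x y z hx hy hz h1 h2 => rw [circ_add_left]; exact Submodule.add_mem _ h1 h2
    | add_right x y z hx hy hz h1 h2 => rw [circ_add_right]; exact Submodule.add_mem _ h1 h2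
    | smul_left r x y hx hy h => rw [circ_smul_left]; exact Submodule.smul_mem _ _ h
    | smul_right r x y hx hy h => rw [circ_smul_right]; exact Submodule.smul_mem _ _ h

theorem isConformal_algA (hn : n ≠ 0) : IsConformal (algA n) (fieldL n) (-(n : ℂ) - 1) :=
  { isVertexAlgebra_algA hn with
    mem := fieldL_mem_algA hn
    virasoro := isVirasoro_fieldL hn
    circ_zero := fun _ ha => circ_zero_fieldL hn ha
    graded := by
      have : generatedBy {fieldL n, fieldW n} ≤ gradedPart n := by
        refine generatedBy_le (isQOA_gradedPart hn) ?_
        rintro x (rfl | rfl)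
        · exact Submodule.subset_span ⟨fieldL_mem_algA hn, 2, by
            simpa using (isVirasoro_fieldL hn).circ_one⟩
        · exact Submodule.subset_span ⟨fieldW_mem_algA hn, 3, by
            simpa using (isPrimary_fieldW hn).circ_one⟩
      rwa [← algA_eq hn] at this }

end Conformal

/-! ### The operator product of `W` with itself in rank one -/

section RankOne

theorem mode_wick_eq_zero {n : ℕ} {a b : QO (Fock n)} {v : Fock n}
    (ha : ∀ k : ℤ, 0 ≤ k → mode a k v = 0) (hb : ∀ k : ℤ, 0 ≤ k → mode b k v = 0) (k : ℤ)
    (hk : 0 ≤ k) : mode (wick a b) k v = 0 := by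
  obtain ⟨K, hK⟩ := (mode_wick_eventually a b k v).exists
  rw [hK, Finset.sum_eq_zero, Finset.sum_eq_zero, add_zero]
  · intro i _
    rw [ha i (by omega), map_zero]
  · intro i _
    rw [hb (k + i) (by omega), map_zero]

theorem mode_der_eq_zero {n : ℕ} {a : QO (Fock n)} {v : Fock n}
    (ha : ∀ k : ℤ, 0 ≤ k → mode a k v = 0) (k : ℤ) (hk : 0 ≤ k) : mode (der a) k v = 0 := by
  rw [mode_der, LinearMap.smul_apply]
  rcases hk.eq_or_lt with rfl | hk
  · simp
  · rw [ha _ (by omega), smul_zero]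

theorem mode_j_zero_state_fieldW {n : ℕ} (k : ℤ) (hk : 0 ≤ k) :
    mode (j n 0) k (state 1 (fieldW n)) = 0 := by
  obtain ⟨k, rfl⟩ := Int.eq_ofNat_of_zero_le hk
  exact mode_j_zero_fieldW k

theorem mode_j_zero_state_fieldL {n : ℕ} (k : ℤ) (hk : 0 ≤ k) :
    mode (j n 0) k (state 1 (fieldL n)) = 0 := by
  obtain ⟨k, rfl⟩ := Int.eq_ofNat_of_zero_le hk
  exact mode_j_zero_fieldL k

theorem mode_j_one_state_fieldW_high {n : ℕ} (k : ℤ) (hk : 2 ≤ k) :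
    mode (j n 1) k (state 1 (fieldW n)) = 0 := by
  rcases (show k = 2 ∨ k = 3 ∨ k = 4 ∨ 5 ≤ k by omega) with rfl | rfl | rfl | hk
  exacts [mode_j_one_two_fieldW, mode_j_one_three_fieldW, mode_j_one_four_fieldW,
    mode_j_one_fieldW_high hk]

/-- The state of `W` is killed by `j⁰(i)` for `i ≥ 0` and by `j¹(i)` for `i ≥ 2`, so at most the
first two summands of the Wick product survive. -/
theorem mode_wick_j_zero_j_one_fieldW {n : ℕ} (k : ℤ) (hk : 0 ≤ k) :
    mode (wick (j n 0) (j n 1)) k (state 1 (fieldW n)) =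
      mode (j n 0) (-1) (mode (j n 1) k (state 1 (fieldW n))) +
      mode (j n 0) (-2) (mode (j n 1) (k + 1) (state 1 (fieldW n))) := by
  obtain ⟨K, hK, h2⟩ := ((mode_wick_eventually (j n 0) (j n 1) k (state 1 (fieldW n))).and
    (eventually_ge_atTop 2)).exists
  obtain ⟨K, rfl⟩ := Nat.exists_eq_add_of_le h2
  rw [hK, Finset.sum_range_add, Finset.sum_eq_zero (s := Finset.range K), add_zero,
    Finset.sum_eq_zero (s := Finset.range (2 + K)), add_zero, Finset.sum_range_succ,
    Finset.sum_range_one]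
  · norm_num
  · intro i _
    rw [mode_j_zero_state_fieldW i (by omega), map_zero]
  · intro i _
    rw [mode_j_one_state_fieldW_high _ (by push_cast; omega), map_zero]

/-- All terms of `W` built from `j⁰` alone act by zero on a vector killed by the nonnegative modes
of `j⁰`. -/
theorem mode_fieldW_fieldW (k : ℤ) (hk : 0 ≤ k) :
    mode (fieldW 1) k (state 1 (fieldW 1)) =
      (3 / 2 : ℂ) • mode (j 1 2) k (state 1 (fieldW 1)) -
      (3 : ℂ) • (mode (j 1 0) (-1) (mode (j 1 1) k (state 1 (fieldW 1))) +
        mode (j 1 0) (-2) (mode (j 1 1) (k + 1) (state 1 (fieldW 1)))) +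
      (3 / 2 * k : ℂ) • mode (j 1 1) (k - 1) (state 1 (fieldW 1)) := by
  have hJ := mode_j_zero_state_fieldW (n := 1)
  have hJP := mode_wick_j_zero_j_one_fieldW (n := 1) k hk
  generalize state 1 (fieldW 1) = w at hJ hJP ⊢
  rw [fieldW]
  simp only [mode_add, mode_sub, mode_smul, LinearMap.add_apply, LinearMap.sub_apply,
    LinearMap.smul_apply, mode_wick_eq_zero hJ (mode_wick_eq_zero hJ hJ) k hk,
    mode_wick_eq_zero hJ (mode_der_eq_zero hJ) k hk, mode_der_eq_zero (mode_der_eq_zero hJ) k hk,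
    hJP, mode_der (j 1 1)]
  push_cast
  module

local notation "B" => mode (beta 1 0)
local notation "G" => mode (gamma 1 0)

theorem mode_j_zero_neg_two_one : mode (j 1 0) (-2) 1 = G (-2) (B (-1) 1) + G (-1) (B (-2) 1) := by
  have := transl_mode (j_mem 1 0) (-1) 1
  rw [mode_j_neg_one_one, state_j_eq, Derivation.map_smul, transl_pairState] at this
  simp [pairState] at this
  exact this.symm

theorem state_j_zero_one : state 1 (j 1 0) = G (-1) (B (-1) 1) := by
  simp [state_j_eq, pairState]

theorem state_j_one_one : state 1 (j 1 1) = G (-1) (B (-2) 1) := by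
  simp [state_j_eq, pairState]

theorem state_j_two_one : state 1 (j 1 2) = (2 : ℂ) • G (-1) (B (-3) 1) := by
  simp [state_j_eq, pairState]

/-- Written with creation modes only, states are polynomials. Modes of the currents are moved to the
vacuum by `j_beta` and `j_gamma`, and the remaining identity is one in a commutative polynomial
ring. -/
theorem state_fieldL_one : state 1 (fieldL 1) =
    (1 / 2 : ℂ) • B (-1) (B (-1) (G (-1) (G (-1) 1))) + B (-1) (G (-2) 1) - B (-2) (G (-1) 1) := by
  rw [state_fieldL]
  simp [state_j_zero_one, state_j_one_one, j_beta, j_gamma, mode_j_neg_one_one,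
    transl_mode (beta_mem _), transl_mode (gamma_mem _)]
  simp [mode_beta, mode_gamma]
  algebra

theorem state_fieldW_one : state 1 (fieldW 1) =
    B (-1) (B (-1) (B (-1) (G (-1) (G (-1) (G (-1) 1))))) +
    (9 / 2 : ℂ) • B (-1) (B (-1) (G (-1) (G (-2) 1))) -
    (9 / 2 : ℂ) • B (-1) (B (-2) (G (-1) (G (-1) 1))) +
    (3 : ℂ) • B (-1) (G (-3) 1) - (6 : ℂ) • B (-2) (G (-2) 1) + (3 : ℂ) • B (-3) (G (-1) 1) := by
  rw [state_fieldW]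
  simp [state_j_zero_one, state_j_one_one, j_beta, j_gamma, mode_j_neg_one_one,
    state_j_two_one, transl_mode (beta_mem _), transl_mode (gamma_mem _)]
  simp [mode_beta, mode_gamma]
  algebra

theorem mode_fieldL_neg_one_fieldL : mode (fieldL 1) (-1) (state 1 (fieldL 1)) =
    (1 / 2 : ℂ) • (mode (j 1 0) (-1) (mode (j 1 0) (-1) (state 1 (fieldL 1))) +
      mode (j 1 0) (-2) (state 1 (fieldL 1))) - mode (j 1 1) (-1) (state 1 (fieldL 1)) := by
  have hJ := mode_j_zero_state_fieldL (n := 1)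
  generalize state 1 (fieldL 1) = v at hJ ⊢
  have h1 : mode (wick (j 1 0) (j 1 0)) (-1) v = mode (j 1 0) (-1) (mode (j 1 0) (-1) v) := by
    obtain ⟨K, hK, h2⟩ := ((mode_wick_eventually (j 1 0) (j 1 0) (-1) v).and
      (eventually_ge_atTop 1)).exists
    obtain ⟨K, rfl⟩ := Nat.exists_eq_add_of_le h2
    rw [hK, Finset.sum_range_add, Finset.sum_eq_zero (s := Finset.range K), add_zero,
      Finset.sum_eq_zero (s := Finset.range (1 + K)), add_zero, Finset.sum_range_one]
    · norm_num
    · intro i _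
      rw [hJ i (by omega), map_zero]
    · intro i _
      rw [hJ _ (by push_cast; omega), map_zero]
  rw [fieldL]
  simp only [mode_add, mode_sub, mode_smul, LinearMap.add_apply, LinearMap.sub_apply,
    LinearMap.smul_apply, h1, mode_der]
  norm_num
  module

theorem mode_j_two_five_fieldW : mode (j 1 2) 5 (state 1 (fieldW 1)) = (-6 : ℂ) • 1 := by
  rw [state_fieldW_one]
  simp [j_beta, j_gamma, j_one, falling_two]
  simp [mode_beta, mode_gamma]
  algebra

theorem mode_j_two_four_fieldW : mode (j 1 2) 4 (state 1 (fieldW 1)) = 0 := by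
  rw [state_fieldW_one]
  simp [j_beta, j_gamma, j_one, falling_two]
  simp [mode_beta, mode_gamma]
  algebra

theorem mode_j_two_three_fieldW :
    mode (j 1 2) 3 (state 1 (fieldW 1)) = (18 : ℂ) • state 1 (fieldL 1) := by
  rw [state_fieldW_one, state_fieldL_one]
  simp [j_beta, j_gamma, j_one, falling_two]
  simp [mode_beta, mode_gamma]
  algebra

theorem fieldW_two_fieldW : mode (fieldW 1) 2 (state 1 (fieldW 1)) =
    (27 / 2 : ℂ) • transl 1 (state 1 (fieldL 1)) := by
  rw [mode_fieldW_fieldW 2 zero_le_two, mode_j_one_two_fieldW,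
    mode_j_one_state_fieldW_high (2 + 1) (by norm_num), show (2 : ℤ) - 1 = 1 by norm_num,
    mode_j_one_one_fieldW, state_fieldW_one, state_fieldL_one]
  simp [j_beta, j_gamma, j_one, falling_two, transl_mode (beta_mem _), transl_mode (gamma_mem _)]
  simp [mode_beta, mode_gamma]
  algebra

theorem fieldW_one_fieldW : mode (fieldW 1) 1 (state 1 (fieldW 1)) =
    (36 : ℂ) • mode (fieldL 1) (-1) (state 1 (fieldL 1)) -
      (27 / 4 : ℂ) • transl 1 (transl 1 (state 1 (fieldL 1))) := by
  rw [mode_fieldW_fieldW 1 zero_le_one, mode_j_one_one_fieldW,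
    mode_j_one_state_fieldW_high (1 + 1) (by norm_num), show (1 : ℤ) - 1 = 0 by norm_num,
    mode_j_one_zero, mode_fieldL_neg_one_fieldL, state_fieldW_one, state_fieldL_one]
  simp [j_beta, j_gamma, j_one, falling_two, transl_mode (beta_mem _), transl_mode (gamma_mem _),
    mode_j_neg_one_one, state_j_zero_one, state_j_one_one, mode_j_zero_neg_two_one]
  simp [mode_beta, mode_gamma]
  algebra

set_option maxHeartbeats 1000000 in
theorem fieldW_zero_fieldW : mode (fieldW 1) 0 (state 1 (fieldW 1)) =
    (18 : ℂ) • transl 1 (mode (fieldL 1) (-1) (state 1 (fieldL 1))) -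
      (9 / 2 : ℂ) • transl 1 (transl 1 (transl 1 (state 1 (fieldL 1)))) := by
  rw [mode_fieldW_fieldW 0 le_rfl, mode_j_one_zero, zero_add, mode_j_one_one_fieldW,
    mode_fieldL_neg_one_fieldL, state_fieldW_one, state_fieldL_one]
  simp [j_beta, j_gamma, j_one, falling_two, transl_mode (beta_mem _), transl_mode (gamma_mem _),
    mode_j_neg_one_one, state_j_zero_one, state_j_one_one, mode_j_zero_neg_two_one]
  simp [mode_beta, mode_gamma]
  algebra

end RankOne

/-! ### Simplicity in rank one -/

section Interpolation

variable {V : Type*} [AddCommGroup V] [Module ℂ V]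

/-- A finite family of vectors lies in a subspace as soon as its moments with respect to the
polynomials `(x+1)⋯(x+l)` do, for distinct nodes `x`. -/
theorem mem_of_sum_falling_smul_mem {ι : Type*} (M : Submodule ℂ V) (t : Finset ι) {x : ι → ℤ}
    (hx : Function.Injective x) (u : ι → V)
    (h : ∀ l : ℕ, ∑ i ∈ t, (falling l (x i + l) : ℂ) • u i ∈ M) {i : ι} (hi : i ∈ t) : u i ∈ M := by
  classical
  -- The recursion is `x (x+1)⋯(x+l) = (x+1)⋯(x+l+1) - (l+1) (x+1)⋯(x+l)` with the factor `x` on the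
  -- left multiplying `(x+1)⋯(x+l)`, so powers of `x` are gained one at a time.
  have hmon : ∀ k l : ℕ, ∑ i ∈ t, ((x i : ℂ) ^ k * falling l (x i + l)) • u i ∈ M := by
    intro k
    induction k with
    | zero => simpa using h
    | succ k ih =>
      intro l
      have := M.sub_mem (ih (l + 1)) (M.smul_mem (l + 1 : ℂ) (ih l))
      rw [Finset.smul_sum, ← Finset.sum_sub_distrib] at this
      convert this using 1
      refine Finset.sum_congr rfl fun i _ => ?_
      rw [falling_succ, show x i + ((l + 1 : ℕ) : ℤ) - 1 = x i + l by push_cast; ring]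
      push_cast
      module
  have hpol : ∀ f : Polynomial ℂ, ∑ i ∈ t, f.eval (x i : ℂ) • u i ∈ M := by
    intro f
    induction f using Polynomial.induction_on' with
    | add p q hp hq =>
      simp only [Polynomial.eval_add, add_smul, Finset.sum_add_distrib]
      exact M.add_mem hp hq
    | monomial k a =>
      have := M.smul_mem a (hmon k 0)
      rw [Finset.smul_sum] at this
      simpa [Polynomial.eval_monomial, smul_smul] using this
  -- This Lagrange polynomial vanishes at every node except `x i`.
  have := hpol (∏ k ∈ t.erase i, (Polynomial.X - Polynomial.C (x k : ℂ)))
  rw [Finset.sum_eq_single i] at this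
  · refine (Submodule.smul_mem_iff _ ?_).1 this
    rw [Polynomial.eval_prod, Finset.prod_ne_zero_iff]
    intro k hk
    simp only [Polynomial.eval_sub, Polynomial.eval_X, Polynomial.eval_C]
    rw [sub_ne_zero]
    exact_mod_cast fun e => Finset.ne_of_mem_erase hk (hx e).symm
  · intro k hk hki
    rw [Polynomial.eval_prod, Finset.prod_eq_zero (Finset.mem_erase.2 ⟨hki, hk⟩) (by simp),
      zero_smul]
  · exact fun h => absurd hi h

end Interpolation

/-! ### Extraction of the operators `β(q)γ(p)` and descent to the vacuum -/

section Annihilation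

/-- With the index `s+1+l` the bilinear terms no longer depend on `l`; only the weight `(x+1)⋯(x+l)`
does, where `x` is the index of the mode of `β`. -/
theorem mode_wick_der_iterate_eventually (l : ℕ) (s : ℤ) (v : Fock 1) :
    ∀ᶠ K : ℕ in atTop, mode (j 1 l) (s + 1 + l) v = (-1 : ℂ) ^ l •
      (∑ k ∈ Finset.range K, (falling l (s + 1 + k + l) : ℂ) •
          mode (gamma 1 0) (-1 - k) (mode (beta 1 0) (s + 1 + k) v) +
        ∑ k ∈ Finset.range K, (falling l (s - k + l) : ℂ) •
          mode (beta 1 0) (s - k) (mode (gamma 1 0) k v)) := by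
  filter_upwards [mode_wick_eventually (gamma 1 0) (der^[l] (beta 1 0)) (s + 1 + l) v] with K hK
  rw [j, Fin.sum_univ_one, hK, smul_add, Finset.smul_sum, Finset.smul_sum]
  congr 1 <;> refine Finset.sum_congr rfl fun k _ => ?_
  · rw [mode_der_iterate_apply, map_smul, smul_smul,
      show s + 1 + (l : ℤ) + k - l = s + 1 + k by ring,
      show s + 1 + (l : ℤ) + k = s + 1 + k + l by ring]
    push_cast
    rfl
  · rw [mode_der_iterate_apply, smul_smul, show s + 1 + (l : ℤ) - 1 - k - l = s - k by ring,
      show s + 1 + (l : ℤ) - 1 - k = s - k + l by ring]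
    push_cast
    rfl

/-- For fixed `p+q` the vectors `jˡ(p+q+1+l)v` are, up to sign, the moments of one finite family of
bilinear terms with distinct `β`-indices, so interpolation puts each term in `M`. -/
theorem mode_beta_mode_gamma_mem {M : Submodule ℂ (Fock 1)}
    (hM : ∀ l m, ∀ v ∈ M, mode (j 1 l) m v ∈ M) {v : Fock 1} (hv : v ∈ M) (p : ℕ) (q : ℤ) :
    mode (beta 1 0) q (mode (gamma 1 0) p v) ∈ M := by
  -- This `K` is independent of `l`, so the set of nodes is too; the terms beyond it vanish.
  obtain ⟨K, hK⟩ := eventually_atTop.1 ((eventually_mode_eq_zero (beta 1 0) v (p + q + 1)).and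
    ((eventually_mode_eq_zero (gamma 1 0) v 0).and (eventually_gt_atTop p)))
  let x : ℕ ⊕ ℕ → ℤ := Sum.elim (fun k => p + q + 1 + k) (fun k => p + q - k)
  let u : ℕ ⊕ ℕ → Fock 1 := Sum.elim
    (fun k => mode (gamma 1 0) (-1 - k) (mode (beta 1 0) (p + q + 1 + k) v))
    (fun k => mode (beta 1 0) (p + q - k) (mode (gamma 1 0) k v))
  have hx : Function.Injective x := by
    rintro (a | a) (b | b) h <;> simp only [x, Sum.elim_inl, Sum.elim_inr] at h
    · rw [show a = b by omega]
    · omega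
    · omega
    · rw [show a = b by omega]
  have key := mem_of_sum_falling_smul_mem M ((Finset.range K).disjSum (Finset.range K)) hx u
    (fun l => ?_) (i := Sum.inr p) (by simpa using (hK K le_rfl).2.2)
  · simpa [u] using key
  · obtain ⟨K', h1, h2⟩ := ((mode_wick_der_iterate_eventually l (p + q) v).and
      (eventually_ge_atTop K)).exists
    have h3 := M.smul_mem ((-1 : ℂ) ^ l) (hM l (p + q + 1 + l) v hv)
    rw [h1, smul_smul, ← mul_pow, neg_one_mul, neg_neg, one_pow, one_smul] at h3
    rw [Finset.sum_disjSum]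
    simp only [x, u, Sum.elim_inl, Sum.elim_inr]
    convert h3 using 2
    · refine Finset.sum_subset (Finset.range_mono h2) fun k _ hk => ?_
      rw [(hK k (by simpa using hk)).1, map_zero, smul_zero]
    · refine Finset.sum_subset (Finset.range_mono h2) fun k _ hk => ?_
      have := (hK k (by simpa using hk)).2.1
      rw [zero_add] at this
      rw [this, map_zero, smul_zero]

/-- The eigenvalues of `j⁰(0)` on the variables. -/
def varCharge : Idx 1 → ℂ := Sum.elim (fun _ => -1) (fun _ => 1)

theorem mode_j_zero_zero_X_mul (x : Idx 1) (v : Fock 1) :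
    mode (j 1 0) 0 (X x * v) = X x * mode (j 1 0) 0 v + varCharge x • (X x * v) := by
  rcases x with ⟨i, k⟩ | ⟨i, k⟩
  · rw [← beta_neg, j_beta, beta_neg]
    simp [varCharge, beta_neg]
  · rw [← gamma_neg, j_gamma, gamma_neg]
    simp [varCharge, gamma_neg]

theorem mode_j_zero_zero_beta_gamma (q p : ℤ) (v : Fock 1) :
    mode (j 1 0) 0 (mode (beta 1 0) q (mode (gamma 1 0) p v)) =
      mode (beta 1 0) q (mode (gamma 1 0) p (mode (j 1 0) 0 v)) := by
  rw [j_beta, j_gamma, map_add]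
  simp

/-- The charge is the number of `γ`-variables minus the number of `β`-variables. If one kind were
absent, it would equal the degree up to sign. -/
theorem exists_ne_zero_of_weight_varCharge {d : Idx 1 →₀ ℕ} (hd : d ≠ 0)
    (h0 : Finsupp.weight varCharge d = 0) :
    (∃ p, d (Sum.inl (0, p)) ≠ 0) ∧ ∃ q, d (Sum.inr (0, q)) ≠ 0 := by
  rw [Finsupp.weight_apply, Finsupp.sum] at h0
  have hdeg : d.degree ≠ 0 := by rwa [ne_eq, Finsupp.degree_eq_zero_iff]
  constructor <;> by_contra! hcon <;> refine hdeg ?_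
  · rw [Finset.sum_congr rfl (g := fun x => ((d x : ℕ) : ℂ))] at h0
    · rw [Finsupp.degree_apply]
      exact_mod_cast h0
    · rintro (⟨i, k⟩ | ⟨i, k⟩) hx
      · rw [Subsingleton.elim i 0] at hx
        exact absurd (hcon k) (Finsupp.mem_support_iff.1 hx)
      · simp [varCharge]
  · rw [Finset.sum_congr rfl (g := fun x => -((d x : ℕ) : ℂ)), Finset.sum_neg_distrib,
      neg_eq_zero] at h0
    · rw [Finsupp.degree_apply]
      exact_mod_cast h0
    · rintro (⟨i, k⟩ | ⟨i, k⟩) hx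
      · simp [varCharge]
      · rw [Subsingleton.elim i 0] at hx
        exact absurd (hcon k) (Finsupp.mem_support_iff.1 hx)

theorem coeff_pderiv_pderiv {σ : Type*} (v : MvPolynomial σ ℂ) (x y : σ) (d : σ →₀ ℕ) :
    coeff d (pderiv x (pderiv y v)) =
      coeff (d + Finsupp.single x 1 + Finsupp.single y 1) v *
        ((d + Finsupp.single x 1 : σ →₀ ℕ) y + 1) * (d x + 1) := by
  rw [coeff_pderiv, coeff_pderiv]

/-- A polynomial of charge zero with a nonconstant monomial has a nonzero mixed derivative. -/
theorem exists_pderiv_pderiv_ne_zero {v : Fock 1} (hv : mode (j 1 0) 0 v = 0)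
    {d : Idx 1 →₀ ℕ} (hd : d ≠ 0) (hdv : coeff d v ≠ 0) :
    ∃ p q : ℕ, pderiv (Sum.inr (0, q)) (pderiv (Sum.inl (0, p)) v) ≠ 0 := by
  classical
  have h0 : Finsupp.weight varCharge d = 0 := by
    have := coeff_apply_of_X_mul (j_one 0 le_rfl) mode_j_zero_zero_X_mul v d
    rw [hv, coeff_zero] at this
    exact (mul_eq_zero.1 this.symm).resolve_right hdv
  obtain ⟨⟨p, hp⟩, q, hq⟩ := exists_ne_zero_of_weight_varCharge hd h0
  refine ⟨p, q, fun h => hdv ?_⟩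
  let e := d - Finsupp.single (Sum.inl (0, p)) 1 - Finsupp.single (Sum.inr (0, q)) 1
  have he : e + Finsupp.single (Sum.inr (0, q)) 1 + Finsupp.single (Sum.inl (0, p)) 1 = d := by
    ext x
    simp only [e, Finsupp.add_apply, Finsupp.tsub_apply, Finsupp.single_apply]
    split_ifs with h1 h2 h2
    · exact absurd (h1.trans h2.symm) (by simp)
    · subst h1; omega
    · subst h2; omega
    · rfl
  have h1 := congrArg (coeff e) h
  rw [coeff_pderiv_pderiv, he, coeff_zero, mul_assoc] at h1
  exact (mul_eq_zero.1 h1).resolve_right (by norm_cast)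

/-- A subspace of the Fock space which is stable under the modes of the fields `j^l` and contains a
nonzero vector of charge zero contains the vacuum. -/
theorem one_mem_of_stable {M : Submodule ℂ (Fock 1)}
    (hM : ∀ l m, ∀ v ∈ M, mode (j 1 l) m v ∈ M) {v : Fock 1} (hvM : v ∈ M) (hv0 : v ≠ 0)
    (hv : mode (j 1 0) 0 v = 0) : (1 : Fock 1) ∈ M := by
  -- Induction on a bound for the degree: `β(q)γ(p)` with `p, q ≥ 0` is a second derivative up to
  -- sign. It lowers the degree, preserves charge zero, and can be chosen not to kill a nonconstant
  -- vector.
  suffices key : ∀ N : ℕ, ∀ v ∈ M, v ≠ 0 → mode (j 1 0) 0 v = 0 →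
      (∀ d, coeff d v ≠ 0 → d.degree ≤ N) → (1 : Fock 1) ∈ M from
    key (v.support.sup Finsupp.degree) v hvM hv0 hv fun d hd =>
      Finset.le_sup (f := Finsupp.degree) (mem_support_iff.2 hd)
  intro N
  induction N with
  | zero =>
    intro v hvM hv0 _ hdeg
    have : v = coeff 0 v • (1 : Fock 1) := by
      classical
      ext d
      rw [coeff_smul, coeff_one]
      split_ifs with h
      · simp [← h]
      · rw [smul_zero]
        by_contra hd
        exact h (((Finsupp.degree_eq_zero_iff d).1 (Nat.le_zero.1 (hdeg d hd))).symm)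
    rw [this] at hvM hv0
    exact (Submodule.smul_mem_iff _ (left_ne_zero_of_smul hv0)).1 hvM
  | succ N ih =>
    intro v hvM hv0 hv hdeg
    by_cases hcon : ∀ d, coeff d v ≠ 0 → d = 0
    · exact ih v hvM hv0 hv fun d hd => by rw [hcon d hd]; simp
    push Not at hcon
    obtain ⟨d, hdv, hd⟩ := hcon
    obtain ⟨p, q, hpq⟩ := exists_pderiv_pderiv_ne_zero hv hd hdv
    have hw : mode (beta 1 0) q (mode (gamma 1 0) p v) =
        -pderiv (Sum.inr (0, q)) (pderiv (Sum.inl (0, p)) v) := by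
      rw [gamma_natCast, beta_natCast, map_neg]
    refine ih _ (mode_beta_mode_gamma_mem hM hvM p q) (by rwa [hw, neg_ne_zero]) ?_ fun e he => ?_
    · rw [mode_j_zero_zero_beta_gamma, hv, map_zero, map_zero]
    · rw [hw, coeff_neg, neg_ne_zero, coeff_pderiv_pderiv, mul_assoc] at he
      have := hdeg _ (left_ne_zero_of_mul he)
      simp only [map_add, Finsupp.degree_single] at this
      omega

end Annihilation

/-! ### Ideals of a tensor factor and of the tensor product -/

section Ideals

variable {V : Type*} [AddCommGroup V] [Module ℂ V] {U H A I : Submodule ℂ (QO V)}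

/-- `H ⊗ I` absorbs products from `H ⊗ A` because each term of the product formula has its second
factor in `I`. -/
theorem circ_mem_wickSpan_of_ideal (hD : IsTensorDecomposition U H A) (hI : I ≤ A)
    (hideal : ∀ a ∈ A, ∀ b ∈ I, ∀ n : ℤ, circ n a b ∈ I) {u x : QO V} (hu : u ∈ U)
    (hx : x ∈ wickSpan H I) (n : ℤ) : circ n u x ∈ wickSpan H I := by
  obtain ⟨e, he⟩ := hD.equiv
  obtain ⟨t, ht⟩ := e.surjective ⟨u, hu⟩
  obtain rfl : (e t : QO V) = u := by rw [ht]
  clear ht hu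
  induction t with
  | zero =>
    rw [map_zero, Submodule.coe_zero, circ_zero_left]
    exact Submodule.zero_mem _
  | add s t hs ht =>
    rw [map_add, Submodule.coe_add, circ_add_left]
    exact Submodule.add_mem _ hs ht
  | tmul h a =>
    rw [he]
    suffices hle : wickSpan H I ≤ (wickSpan H I).comap (circLin n (wick (h : QO V) (a : QO V))) from
      hle hx
    refine Submodule.map₂_le.2 fun h' hh' b hb => ?_
    change circ n (wick (h : QO V) (a : QO V)) (wick h' b) ∈ wickSpan H I
    rw [hD.circ_wick _ h.2 _ hh' _ a.2 _ (hI hb),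
      finsum_eq_sum _ (hD.finite _ h.2 _ hh' _ a.2 _ (hI hb) n)]
    exact Submodule.sum_mem _ fun k _ =>
      wick_mem_wickSpan (hD.left.circ_mem _ h.2 _ hh' _) (hideal _ a.2 _ hb _)

/-- Otherwise some functional `φ` vanishes on `I` but not at the unit. The map `h ⊗ a ↦ φ(a)h` would
then kill `H ⊗ I` without killing `1 ⊗ 1`. -/
theorem one_mem_of_one_mem_wickSpan (hD : IsTensorDecomposition U H A) (hI : I ≤ A)
    (h1 : (one : QO V) ≠ 0) (hw : wick one one = (one : QO V)) (h : one ∈ wickSpan H I) :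
    one ∈ I := by
  by_contra hcon
  obtain ⟨φ, hφ, hφI⟩ := Submodule.exists_le_ker_of_notMem hcon
  obtain ⟨e, he⟩ := hD.equiv
  let Ψ : TensorProduct ℂ H A →ₗ[ℂ] QO V :=
    TensorProduct.lift (LinearMap.flip ((LinearMap.lsmul ℂ (QO V)).domRestrict₁₂ ⊤ H ∘ₗ
      (φ ∘ₗ A.subtype).codRestrict ⊤ fun _ => Submodule.mem_top))
  have hΨ : ∀ (h : H) (a : A), Ψ (TensorProduct.tmul ℂ h a) = φ (a : QO V) • (h : QO V) :=
    fun h a => rfl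
  have key : wickSpan H I ≤ (LinearMap.ker Ψ).map (U.subtype ∘ₗ e.toLinearMap) := by
    refine Submodule.map₂_le.2 fun h hh b hb => ?_
    refine ⟨TensorProduct.tmul ℂ ⟨h, hh⟩ ⟨b, hI hb⟩, ?_, he _ _⟩
    rw [SetLike.mem_coe, LinearMap.mem_ker, hΨ, show φ b = 0 from hφI hb, zero_smul]
  obtain ⟨t, ht, hte⟩ := key h
  have h2 : t = TensorProduct.tmul ℂ ⟨one, hD.left.one_mem⟩ ⟨one, hD.right.one_mem⟩ := by
    apply e.injective
    apply Subtype.ext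
    rw [he, hw]
    exact hte
  rw [h2, SetLike.mem_coe, LinearMap.mem_ker, hΨ] at ht
  exact (smul_ne_zero hφ h1) ht

end Ideals

/-! ### Simplicity and the `W₃` structure in rank one -/

theorem one_ne_zero_fock (n : ℕ) : (one : QO (Fock n)) ≠ 0 := by
  intro h
  have := congrArg (state (1 : Fock n)) h
  rw [state_one, map_zero] at this
  exact one_ne_zero this

theorem HasStates.circ_neg_one_one {V : Type*} [AddCommGroup V] [Module ℂ V]
    {S : Submodule ℂ (QO V)} {Ω : V} {T : Module.End ℂ V} (hS : HasStates S Ω T) {a : QO V}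
    (ha : a ∈ S) : circ (-1) a one = a :=
  hS.ext (hS.circ_mem _ ha _ hS.one_mem _) ha (by
    rw [hS.state_circ ha hS.one_mem, state_one, state_apply])

theorem HasStates.circ_neg_one_left {V : Type*} [AddCommGroup V] [Module ℂ V]
    {S : Submodule ℂ (QO V)} {Ω : V} {T : Module.End ℂ V} (hS : HasStates S Ω T) {a : QO V}
    (ha : a ∈ S) : circ (-1) one a = a :=
  hS.ext (hS.circ_mem _ hS.one_mem _ ha _) ha (by
    rw [hS.state_circ hS.one_mem ha, mode_one, if_pos rfl, LinearMap.id_apply])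

/-- The states of `H ⊗ I` are stable under the modes of the `jˡ` and include the state of a nonzero
`b ∈ I`. That state has charge zero because `b` commutes with `j⁰`, so the vacuum is reached. -/
theorem isSimpleVA_algA_one : IsSimpleVA (algA 1) where
  ne_bot := fun h => one_ne_zero_fock 1 (by
    have := (isQOA_algA one_ne_zero).one_mem
    rwa [h, Submodule.mem_bot] at this)
  eq_bot_or_eq := fun I hI hideal => by
    have hS := hasStates_betaGamma 1
    have hD := isTensorDecomposition_W1inf (one_ne_zero (α := ℕ))
    have hW : W1inf 1 ≤ betaGamma 1 :=
      generatedBy_le hS.toIsQOA (by rintro _ ⟨l, rfl⟩; exact j_mem 1 l)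
    have hH : heis 1 ≤ betaGamma 1 :=
      generatedBy_le hS.toIsQOA (Set.singleton_subset_iff.2 (j_mem 1 0))
    have hIS : I ≤ betaGamma 1 := hI.trans (algA_le 1)
    have hwS : wickSpan (heis 1) I ≤ betaGamma 1 :=
      Submodule.map₂_le.2 fun h hh b hb => hS.wick_mem (hH hh) (hIS hb)
    refine or_iff_not_imp_left.2 fun hbot => ?_
    obtain ⟨b, hb, hb0⟩ := Submodule.exists_mem_ne_zero_of_ne_bot hbot
    have hbw : b ∈ wickSpan (heis 1) I := by
      rw [← hS.circ_neg_one_left (hIS hb)]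
      exact wick_mem_wickSpan hD.left.one_mem hb
    have h1 : (1 : Fock 1) ∈ (wickSpan (heis 1) I).map (state 1) := by
      refine one_mem_of_stable ?_ (Submodule.mem_map_of_mem hbw)
        (fun h => hb0 (hS.eq_zero_of_state b (hIS hb) h)) (mode_j_zero_state_eq_zero (hI hb) le_rfl)
      rintro l m _ ⟨x, hx, rfl⟩
      rw [← hS.state_circ (j_mem 1 l) (hwS hx)]
      exact Submodule.mem_map_of_mem (circ_mem_wickSpan_of_ideal hD hI
        (fun a ha b hb n => (hideal a ha b hb n).1) (subset_generatedBy _ ⟨l, rfl⟩) hx m)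
    obtain ⟨x, hx, hx1⟩ := h1
    obtain rfl : x = one := hS.ext (hwS hx) hS.one_mem (by rw [hx1, state_one])
    have hone : one ∈ I := one_mem_of_one_mem_wickSpan hD hI (one_ne_zero_fock 1)
      (hS.circ_neg_one_one hS.one_mem) hx
    refine le_antisymm hI fun a ha => ?_
    rw [← hS.circ_neg_one_one (algA_le 1 ha)]
    exact (hideal a ha one hone (-1)).1

theorem circ_smul_smul {V : Type*} [AddCommGroup V] [Module ℂ V] (r : ℂ) (a : QO V) (n : ℤ) :
    circ n (r • a) (r • a) = r ^ 2 • circ n a a := by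
  rw [circ_smul_left, circ_smul_right, smul_smul, sq]

theorem generatedBy_pair_smul {V : Type*} [AddCommGroup V] [Module ℂ V] {r : ℂ} (hr : r ≠ 0)
    (a b : QO V) : generatedBy {a, r • b} = generatedBy {a, b} := by
  apply le_antisymm <;> refine generatedBy_le (isQOA_generatedBy _) ?_ <;> rintro x (rfl | rfl)
  · exact subset_generatedBy _ (by simp)
  · exact Submodule.smul_mem _ _ (subset_generatedBy _ (by simp))
  · exact subset_generatedBy _ (by simp)
  · exact (Submodule.smul_mem_iff _ hr).1 (subset_generatedBy _ (by simp))

theorem IsPrimary.smul {V : Type*} [AddCommGroup V] [Module ℂ V] {L a : QO V} {h : ℂ}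
    (ha : IsPrimary L a h) (r : ℂ) : IsPrimary L (r • a) h where
  quantumCommute := ha.quantumCommute.smul_right r
  circ_zero := by rw [circ_smul_right, ha.circ_zero, der_smul]
  circ_one := by rw [circ_smul_right, ha.circ_one, smul_comm]
  circ_high := fun k hk => by rw [circ_smul_right, ha.circ_high k hk, smul_zero]

theorem circ_fieldW_fieldW_eq {x : QO (Fock 1)} (hx : x ∈ algA 1) (k : ℤ) {r : ℂ}
    (h : r • mode (fieldW 1) k (state 1 (fieldW 1)) = state 1 x) :
    r • circ k (fieldW 1) (fieldW 1) = x := by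
  have hS := hasStates_betaGamma 1
  have hW := fieldW_mem 1
  refine hS.ext (Submodule.smul_mem _ _ (hS.circ_mem _ hW _ hW _)) (algA_le 1 hx) ?_
  rw [map_smul, hS.state_circ hW hW, h]

/-- The normalization is forced by the pole of order six: `W ∘₅ W = (3/2)(-6) = -9`, and `μ²(-9)`
has to be `c/3 = -2/3`. -/
theorem isZamolodchikovW3_algA_one {μ : ℂ} (hμ : μ ^ 2 = 2 / 27) :
    IsZamolodchikovW3 (algA 1) (fieldL 1) (μ • fieldW 1) (-2) := by
  have hS := hasStates_betaGamma 1
  have hL := fieldL_mem_algA (one_ne_zero (α := ℕ))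
  have hW := fieldW_mem_algA (one_ne_zero (α := ℕ))
  have hA := isVertexAlgebra_algA (one_ne_zero (α := ℕ))
  have hμ0 : μ ≠ 0 := by
    rintro rfl
    norm_num at hμ
  have hLS := fieldL_mem 1
  have hdL := hA.der_mem hL
  have hddL := hA.der_mem hdL
  have hΛ : quasiLL (fieldL 1) ∈ algA 1 :=
    Submodule.sub_mem _ (hA.wick_mem hL hL) (Submodule.smul_mem _ _ hddL)
  have hsdd : state 1 (der (der (fieldL 1))) = transl 1 (transl 1 (state 1 (fieldL 1))) := by
    rw [hS.state_der (algA_le 1 hdL), hS.state_der hLS]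
    rfl
  have hsΛ : state 1 (quasiLL (fieldL 1)) = mode (fieldL 1) (-1) (state 1 (fieldL 1)) -
      (3 / 10 : ℂ) • transl 1 (transl 1 (state 1 (fieldL 1))) := by
    rw [quasiLL, map_sub, map_smul, hS.state_wick hLS hLS, hsdd]
  refine { hA, isSimpleVA_algA_one with
    generated := by rw [generatedBy_pair_smul hμ0, algA_eq one_ne_zero]
    virasoro := by
      have := isVirasoro_fieldL (one_ne_zero (α := ℕ))
      norm_num at this
      exact this
    primary := (isPrimary_fieldW one_ne_zero).smul μ
    circ_zero := ?_
    circ_one := ?_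
    circ_two := ?_
    circ_three := ?_
    circ_four := ?_
    circ_five := ?_
    circ_high := fun k hk => ?_ }
  · rw [circ_smul_smul, hμ]
    refine circ_fieldW_fieldW_eq (Submodule.add_mem _ (Submodule.smul_mem _ _ (hA.der_mem hΛ))
      (Submodule.smul_mem _ _ (hA.der_mem hddL))) 0 ?_
    rw [map_add, map_smul, map_smul, hS.state_der (algA_le 1 hΛ), hS.state_der (algA_le 1 hddL),
      hsΛ, hsdd, fieldW_zero_fieldW]
    simp only [Derivation.coeFn_coe, map_sub, Derivation.map_smul]
    module
  · rw [circ_smul_smul, hμ]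
    refine circ_fieldW_fieldW_eq (Submodule.add_mem _ (Submodule.smul_mem _ _ hΛ)
      (Submodule.smul_mem _ _ hddL)) 1 ?_
    rw [map_add, map_smul, map_smul, hsΛ, hsdd, fieldW_one_fieldW]
    module
  · rw [circ_smul_smul, hμ]
    refine circ_fieldW_fieldW_eq hdL 2 ?_
    rw [hS.state_der hLS, fieldW_two_fieldW, Derivation.coeFn_coe]
    module
  · rw [circ_smul_smul, hμ]
    refine circ_fieldW_fieldW_eq (Submodule.smul_mem _ _ hL) 3 ?_
    rw [map_smul, mode_fieldW_fieldW 3 (by norm_num), mode_j_two_three_fieldW,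
      mode_j_one_state_fieldW_high 3 (by norm_num),
      mode_j_one_state_fieldW_high (3 + 1) (by norm_num),
      mode_j_one_state_fieldW_high (3 - 1) (by norm_num)]
    simp only [map_zero]
    module
  · rw [circ_smul_smul, hμ]
    refine circ_fieldW_fieldW_eq (Submodule.zero_mem _) 4 ?_
    rw [map_zero, mode_fieldW_fieldW 4 (by norm_num), mode_j_two_four_fieldW,
      mode_j_one_state_fieldW_high 4 (by norm_num),
      mode_j_one_state_fieldW_high (4 + 1) (by norm_num),
      mode_j_one_state_fieldW_high (4 - 1) (by norm_num)]
    simp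
  · rw [circ_smul_smul, hμ]
    refine circ_fieldW_fieldW_eq (Submodule.smul_mem _ _ hA.one_mem) 5 ?_
    rw [map_smul, state_one, mode_fieldW_fieldW 5 (by norm_num), mode_j_two_five_fieldW,
      mode_j_one_state_fieldW_high 5 (by norm_num),
      mode_j_one_state_fieldW_high (5 + 1) (by norm_num),
      mode_j_one_state_fieldW_high (5 - 1) (by norm_num)]
    simp only [map_zero]
    module
  -- `W ∘ₖ W` has weight `5-k`, which is negative for `k ≥ 6`.
  · have h3 := (isPrimary_fieldW (one_ne_zero (α := ℕ))).circ_one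
    rw [circ_smul_smul, eq_zero_of_circ_one_fieldL one_ne_zero (hA.circ_mem _ hW _ hW k)
      (e := 5 - k) (by omega) ?_, smul_zero]
    rw [circ_one_fieldL_circ one_ne_zero hW hW h3 h3]
    congr 1
    push_cast
    ring

end WInfinity

end

theorem mainTheorem5 (n : ℕ) (hn : 1 ≤ n) :
    WInfinity.IsVertexAlgebra (WInfinity.W1inf n) ∧
    WInfinity.IsHeisenberg (WInfinity.j n 0) (-(n : ℂ)) ∧
    WInfinity.IsTensorDecomposition (WInfinity.W1inf n) (WInfinity.heis n) (WInfinity.algA n) ∧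
    WInfinity.algA n = WInfinity.generatedBy {WInfinity.fieldL n, WInfinity.fieldW n} ∧
    WInfinity.IsConformal (WInfinity.algA n) (WInfinity.fieldL n) (-(n : ℂ) - 1) ∧
    WInfinity.IsPrimary (WInfinity.fieldL n) (WInfinity.fieldW n) 3 ∧
    (n = 1 → ∃ μ : ℂ, μ ≠ 0 ∧
      WInfinity.IsZamolodchikovW3 (WInfinity.algA n) (WInfinity.fieldL n)
        (μ • WInfinity.fieldW n) (-2)) := by
  have hn0 : n ≠ 0 := by omega
  refine ⟨WInfinity.isVertexAlgebra_generatedBy ?_, WInfinity.isHeisenberg_j n,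
    WInfinity.isTensorDecomposition_W1inf hn0, WInfinity.algA_eq hn0,
    WInfinity.isConformal_algA hn0, WInfinity.isPrimary_fieldW hn0, ?_⟩
  · rintro _ ⟨l, rfl⟩ _ ⟨k, rfl⟩
    exact (WInfinity.hasStates_betaGamma n).quantumCommute _ (WInfinity.j_mem n l) _
      (WInfinity.j_mem n k)
  · rintro rfl
    obtain ⟨μ, hμ⟩ := IsAlgClosed.exists_pow_nat_eq (2 / 27 : ℂ) (n := 2) two_pos
    refine ⟨μ, ?_, WInfinity.isZamolodchikovW3_algA_one hμ⟩
    rintro rfl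
    norm_num at hμ
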